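/- Let $\tilde\chi:[0,\infty)\to[0,\infty)$ be a smooth nonnegative bump function with $\tilde\chi(r)=1$ for $0\le r\le 1$ and $\tilde\chi(r)=0$ for $r>2$. Then there are a smooth function $\psi$ supported in $1\le r\le 2$ and a constant $C>0$, both depending only on $\tilde\chi$, such that the following holds. Let $I_0\subset\mathbb R$ be a compact interval and let $\phi,\mathcal N:I_0\times\mathbb R^3\to\mathbb C$ be smooth, with all space-time derivatives decreasing rapidly in space uniformly in $t\in I_0$, and satisfy $i\partial_t\phi+\Delta\phi=\mathcal N$ on $I_0\times\mathbb R^3$. Then \begin{align*} 8\pi&\int_{I_0}\int_{\mathbb R^3}|\phi(t,y)|^4\,dy\,dt +2\int_{I_0}\int_{\mathbb R^3}\int_{\mathbb R^3}|\phi(t,y)|^2\Big[\tilde\chi(|x-y|)\frac{x-y}{|x-y|}\Big]\cdot\{\mathcal N,\phi\}_p(t,x)\,dx\,dy\,dt\\ \le{}&4\Big(\sup_{r\ge0}\tilde\chi(r)\Big)\,\|\phi\|_{L^\infty_tL^2_x(I_0\times\mathbb R^3)}^3\,\|\phi\|_{L^\infty_t\dot H^1_x(I_0\times\mathbb R^3)}\\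 &+4\int_{I_0}\int_{\mathbb R^3}\int_{\mathbb R^3}|\{\mathcal N,\phi\}_m(t,y)|\,|\tilde\chi(|x-y|)|\,|\phi(t,x)|\,|\nabla\phi(t,x)|\,dx\,dy\,dt\\ &+C\int_{I_0}\int_{\mathbb R^3}\int_{\mathbb R^3}|\phi(t,y)|^2\,|\psi(|x-y|)|\,\big[|\phi(t,x)|^2+|\partial_{r(y)}\phi(t,x)|^2\big]\,dx\,dy\,dt . \end{align*} Here $\{f,g\}_m=\operatorname{Im}(f\bar g)$ and $\{f,g\}_p=\operatorname{Re}(f\nabla\bar g-g\nabla\bar f)$ are the mass and momentum brackets, $\partial_{r(y)}=\frac{x-y}{|x-y|}\cdot\nabla_x$ is the radial derivative centred at $y$, and $\|\phi\|_{L^\infty_t\dot H^1_x}=\sup_{t\in I_0}\|\nabla\phi(t)\|_{L^2_x}$. (For the usual normalization $0\le\tilde\chi\le1$ the supremum equals $1$.) -/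

import Mathlib

open MeasureTheory
open scoped ContDiff

namespace InteractionMorawetz

/-- Physical space `ℝ³` with its Euclidean norm. -/
abbrev Space : Type := EuclideanSpace ℝ (Fin 3)

/-- The partial derivative `∂ⱼ f` of a complex-valued function on `ℝ³`. -/
noncomputable def partialDeriv (f : Space → ℂ) (j : Fin 3) (x : Space) : ℂ :=
  fderiv ℝ f x (EuclideanSpace.single j (1 : ℝ))

/-- The gradient `∇ f = (∂₁ f, ∂₂ f, ∂₃ f) ∈ ℂ³`; its norm is `(∑ⱼ |∂ⱼ f|²)^(1/2)`. -/
noncomputable def grad (f : Space → ℂ) (x : Space) : EuclideanSpace ℂ (Fin 3) :=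
  WithLp.toLp 2 (fun j => partialDeriv f j x)

/-- The unit vector `(x - y) / |x - y|` (equal to `0` on the null set `x = y`). -/
noncomputable def unitVec (x y : Space) : Space := ‖x - y‖⁻¹ • (x - y)

/-- The radial derivative centered at `y`: `∂_{r(y)} f (x) = (x - y)/|x - y| · ∇ f (x)`. -/
noncomputable def radialDeriv (f : Space → ℂ) (y x : Space) : ℂ :=
  fderiv ℝ f x (unitVec x y)

/-- The mass bracket `{f, g}_m = Im (f \bar g)`. -/
noncomputable def massBracket (f g : Space → ℂ) (x : Space) : ℝ :=
  (f x * (starRingEnd ℂ) (g x)).im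

/-- The momentum bracket, the real vector field `{f, g}_p = Re (f ∇ \bar g - g ∇ \bar f)`. -/
noncomputable def momentumBracket (f g : Space → ℂ) (x : Space) : Space :=
  WithLp.toLp 2 (fun j =>
    (f x * (starRingEnd ℂ) (partialDeriv g j x)
      - g x * (starRingEnd ℂ) (partialDeriv f j x)).re)

/-- The field `φ` is smooth on the slab `[a, b] × ℝ³` (up to the boundary in time), and all its
space-time derivatives decrease rapidly in space, uniformly in time. -/
structure IsSchwartzOnSlab (a b : ℝ) (φ : ℝ → Space → ℂ) : Prop where
  smooth : ContDiffOn ℝ ∞ (fun p : ℝ × Space => φ p.1 p.2) (Set.Icc a b ×ˢ Set.univ)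
  decay : ∀ k n : ℕ, ∃ C : ℝ, ∀ t ∈ Set.Icc a b, ∀ x : Space,
    ‖x‖ ^ k * ‖iteratedFDerivWithin ℝ n (fun p : ℝ × Space => φ p.1 p.2)
      (Set.Icc a b ×ˢ Set.univ) (t, x)‖ ≤ C

/-- `φ` is a Schwartz solution of `i ∂ₜ φ + Δ φ = N` on `[a, b] × ℝ³`
(the time derivative is one-sided at the end points). -/
structure IsSchwartzSolution (a b : ℝ) (φ N : ℝ → Space → ℂ) : Prop where
  schwartz : IsSchwartzOnSlab a b φ
  schwartz_forcing : IsSchwartzOnSlab a b N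
  equation : ∀ t ∈ Set.Icc a b, ∀ x : Space,
    Complex.I * derivWithin (fun s => φ s x) (Set.Icc a b) t
      + Laplacian.laplacian (φ t) x = N t x

/-- A smooth nonnegative bump function on `r ≥ 0`, equal to `1` on `0 ≤ r ≤ 1` and supported
on `0 ≤ r ≤ 2`. -/
structure IsRadialCutoff (χ : ℝ → ℝ) : Prop where
  smooth : ContDiffOn ℝ ∞ χ (Set.Ici 0)
  nonneg : ∀ r, 0 ≤ r → 0 ≤ χ r
  eq_one : ∀ r, 0 ≤ r → r ≤ 1 → χ r = 1
  eq_zero : ∀ r, 2 < r → χ r = 0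

/-- A smooth function of `r`, supported on the annulus `1 ≤ r ≤ 2`. -/
structure IsAnnularCutoff (ψ : ℝ → ℝ) : Prop where
  smooth : ContDiff ℝ ∞ ψ
  support_subset : Function.support ψ ⊆ Set.Icc 1 2

/-- `‖φ‖_{L^∞_t L^2_x([a,b] × ℝ³)}`. The fields considered are continuous in time, so that the
supremum is the essential supremum. -/
noncomputable def normLinftyL2 (a b : ℝ) (φ : ℝ → Space → ℂ) : ℝ :=
  ⨆ t : Set.Icc a b, Real.sqrt (∫ x, ‖φ t x‖ ^ 2)

/-- `‖φ‖_{L^∞_t \dot H^1_x([a,b] × ℝ³)} = sup_t ‖∇ φ(t)‖_{L^2_x}`. -/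
noncomputable def normLinftyHdot1 (a b : ℝ) (φ : ℝ → Space → ℂ) : ℝ :=
  ⨆ t : Set.Icc a b, Real.sqrt (∫ x, ‖grad (φ t) x‖ ^ 2)

end InteractionMorawetz

namespace InteractionMorawetz

/-! At a fixed time write u = p + iq for the solution, ρ = |u|² (`dens`) and T_j = 2 Im(ū ∂_j u)
(`mom`). The Morawetz action is M(t) = ∫∫ a(x−y)·T(x) ρ(y) dx dy with the vector field a(z) = χ(|z|)
z/|z| (`field`). Cauchy–Schwarz gives |M| ≤ 2 (sup χ) ‖u‖₂³ ‖∇u‖₂ (`abs_action_le`), so M(b) − M(a)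
accounts for the first term on the right. What remains is a lower bound for dM/dt.

The local conservation laws `densT_eq` and `momT_eq`, followed by integrations by parts, express
dM/dt through three kinds of terms (`pairing_morawetz_identity`): the mass and momentum brackets;
the derivative of a contracted with 4ρ(y) Re(∂_j u ∂_k ū)(x) − T_k(y) T_j(x); and minus the pairing
of Δ div a with ρ(y)ρ(x). Near the origin a = z/|z| and −Δ div a = 8πδ, which produces the |φ|⁴
term; away from the origin Δ div a lives on the annulus. After symmetrization in x and y the
contracted tensor is a sum of squares (`flux_form`). The derivative of a has angular eigenvalue
χ(r)/r ≥ 0 and radial eigenvalue χ'(r), which vanishes off 1 ≤ r ≤ 2. So positivity fails only in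
the radial direction on the annulus, where `flux_form_le` bounds the loss by |∂_r u|².

Because a is singular at 0, the identity is first proved for a smooth field h(|z|²) z with h =
`regProfile χ e`: the smooth tail (1−χ)/|z| is kept and 1/|z| becomes (|z|²+e)^(-1/2). The delta is
then replaced by `peak e`, an approximate identity of mass 8π (`tendsto_pairing_peak`), and
positivity is lost only by O(√e) (`regProfile_form_ge`). The limit e → 0 is taken at each fixed time
(`pairing_morawetz_le`), the time derivatives being expressed through the equation. The integration
in time (`integral_deriv_pairing`) then uses the singular field itself, for which being a bounded
measurable kernel is enough.

Finally the two annular profiles must lie below one smooth function whose support does not leave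
[1,2]. They vanish to infinite order at both ends of the annulus, which makes such a majorant
possible (`exists_smooth_majorant`, `exists_annularCutoff`). -/

/-- The partial derivative `∂ⱼ f` of a real-valued function on `ℝ³`. -/
noncomputable def pd (j : Fin 3) (f : Space → ℝ) (x : Space) : ℝ :=
  fderiv ℝ f x (EuclideanSpace.single j (1 : ℝ))

/-! ### Rapidly decreasing and Schwartz families depending on a parameter. -/

section Families

variable {τ : Type*} [TopologicalSpace τ]

/-- A jointly continuous family of functions, rapidly decreasing in space uniformly in the
parameter. -/
structure RapidFamily (f : τ → Space → ℝ) : Prop where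
  continuous : Continuous fun p : τ × Space => f p.1 p.2
  decay : ∀ k : ℕ, ∃ C : ℝ, ∀ t x, (1 + ‖x‖) ^ k * |f t x| ≤ C

theorem RapidFamily.bound {f : τ → Space → ℝ} (hf : RapidFamily f) (k : ℕ) :
    ∃ C : ℝ, 0 ≤ C ∧ ∀ t x, |f t x| ≤ C * ((1 + ‖x‖) ^ k)⁻¹ := by
  obtain ⟨C, hC⟩ := hf.decay k
  refine ⟨max C 0, le_max_right _ _, fun t x => ?_⟩
  rw [← div_eq_mul_inv, le_div_iff₀ (by positivity), mul_comm]
  exact (hC t x).trans (le_max_left _ _)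

theorem RapidFamily.add {f g : τ → Space → ℝ} (hf : RapidFamily f) (hg : RapidFamily g) :
    RapidFamily fun t x => f t x + g t x := by
  refine ⟨hf.continuous.add hg.continuous, fun k => ?_⟩
  obtain ⟨C, hC⟩ := hf.decay k
  obtain ⟨D, hD⟩ := hg.decay k
  refine ⟨C + D, fun t x => ?_⟩
  calc (1 + ‖x‖) ^ k * |f t x + g t x|
      ≤ (1 + ‖x‖) ^ k * (|f t x| + |g t x|) := by gcongr; exact abs_add_le _ _
    _ ≤ C + D := by rw [mul_add]; exact add_le_add (hC t x) (hD t x)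

theorem RapidFamily.mul {f g : τ → Space → ℝ} (hf : RapidFamily f) (hg : RapidFamily g) :
    RapidFamily fun t x => f t x * g t x := by
  refine ⟨hf.continuous.mul hg.continuous, fun k => ?_⟩
  obtain ⟨C, hC⟩ := hf.decay k
  obtain ⟨D, hD0, hD⟩ := hg.bound 0
  refine ⟨C * D, fun t x => ?_⟩
  have h1 := hC t x
  have h2 := hD t x
  simp only [pow_zero, inv_one, mul_one] at h2
  rw [abs_mul, ← mul_assoc]
  exact mul_le_mul h1 h2 (abs_nonneg _) (le_trans (by positivity) h1)

theorem RapidFamily.const_mul {f : τ → Space → ℝ} (hf : RapidFamily f) (c : ℝ) :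
    RapidFamily fun t x => c * f t x := by
  refine ⟨continuous_const.mul hf.continuous, fun k => ?_⟩
  obtain ⟨C, hC⟩ := hf.decay k
  refine ⟨|c| * C, fun t x => ?_⟩
  rw [abs_mul, mul_left_comm]
  exact mul_le_mul_of_nonneg_left (hC t x) (abs_nonneg c)

theorem RapidFamily.comp {σ : Type*} [TopologicalSpace σ] {f : τ → Space → ℝ}
    (hf : RapidFamily f) {g : σ → τ} (hg : Continuous g) : RapidFamily fun s => f (g s) :=
  ⟨hf.continuous.comp ((hg.comp continuous_fst).prodMk continuous_snd), fun k =>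
    (hf.decay k).imp fun _ h t => h (g t)⟩

/-- The spatial derivatives of order at most `n` are rapidly decreasing families. -/
def SchwartzFamilyOrder : ℕ → (τ → Space → ℝ) → Prop
  | 0, f => RapidFamily f ∧ ∀ t, ContDiff ℝ ∞ (f t)
  | n + 1, f => (RapidFamily f ∧ ∀ t, ContDiff ℝ ∞ (f t)) ∧
      ∀ j, SchwartzFamilyOrder n fun t => pd j (f t)

/-- A family of functions which are smooth in space, all of whose spatial derivatives are jointly
continuous and rapidly decreasing, uniformly in the parameter. -/
def SchwartzFamily (f : τ → Space → ℝ) : Prop := ∀ n, SchwartzFamilyOrder n f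

theorem SchwartzFamilyOrder.base {n : ℕ} {f : τ → Space → ℝ} (hf : SchwartzFamilyOrder n f) :
    RapidFamily f ∧ ∀ t, ContDiff ℝ ∞ (f t) := by
  cases n with
  | zero => exact hf
  | succ n => exact hf.1

theorem SchwartzFamilyOrder.of_succ {n : ℕ} {f : τ → Space → ℝ}
    (hf : SchwartzFamilyOrder (n + 1) f) : SchwartzFamilyOrder n f := by
  induction n generalizing f with
  | zero => exact hf.1
  | succ n ih => exact ⟨hf.1, fun j => ih (hf.2 j)⟩

theorem SchwartzFamily.rapid {f : τ → Space → ℝ} (hf : SchwartzFamily f) : RapidFamily f :=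
  (hf 0).1

theorem SchwartzFamily.contDiff {f : τ → Space → ℝ} (hf : SchwartzFamily f) (t : τ) :
    ContDiff ℝ ∞ (f t) :=
  (hf 0).2 t

theorem SchwartzFamily.pd {f : τ → Space → ℝ} (hf : SchwartzFamily f) (j : Fin 3) :
    SchwartzFamily fun t => pd j (f t) :=
  fun n => (hf (n + 1)).2 j

theorem pd_add {f g : Space → ℝ} (hf : ContDiff ℝ ∞ f) (hg : ContDiff ℝ ∞ g) (j : Fin 3) :
    pd j (fun x => f x + g x) = fun x => pd j f x + pd j g x := by
  funext x
  have h1 := hf.differentiable (by simp) x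
  have h2 := hg.differentiable (by simp) x
  simp [pd, fderiv_fun_add h1 h2]

theorem pd_mul {f g : Space → ℝ} (hf : ContDiff ℝ ∞ f) (hg : ContDiff ℝ ∞ g) (j : Fin 3) :
    pd j (fun x => f x * g x) = fun x => pd j f x * g x + f x * pd j g x := by
  funext x
  have h1 := hf.differentiable (by simp) x
  have h2 := hg.differentiable (by simp) x
  simp [pd, fderiv_fun_mul h1 h2]
  ring

theorem pd_const_mul {f : Space → ℝ} (hf : ContDiff ℝ ∞ f) (c : ℝ) (j : Fin 3) :
    pd j (fun x => c * f x) = fun x => c * pd j f x := by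
  funext x
  have h1 := hf.differentiable (by simp) x
  simp [pd, fderiv_const_mul h1]

theorem contDiff_pd {f : Space → ℝ} (hf : ContDiff ℝ ∞ f) (j : Fin 3) : ContDiff ℝ ∞ (pd j f) :=
  (hf.fderiv_right (m := ∞) (by simp)).clm_apply contDiff_const

theorem pd_comm {f : Space → ℝ} (hf : ContDiff ℝ ∞ f) (j k : Fin 3) :
    pd j (pd k f) = pd k (pd j f) := by
  funext x
  have hd : DifferentiableAt ℝ (fderiv ℝ f) x :=
    (hf.fderiv_right (m := ∞) (by simp)).differentiable (by simp) x
  have hs : IsSymmSndFDerivAt ℝ f x :=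
    (hf.contDiffAt (x := x)).isSymmSndFDerivAt (by
      rw [minSmoothness_of_isRCLikeNormedField]
      exact ENat.LEInfty.out)
  have key : ∀ i l : Fin 3, pd i (pd l f) x =
      fderiv ℝ (fderiv ℝ f) x (EuclideanSpace.single i 1) (EuclideanSpace.single l 1) := by
    intro i l
    change fderiv ℝ (fun y => fderiv ℝ f y (EuclideanSpace.single l 1)) x _ = _
    rw [fderiv_clm_apply hd (differentiableAt_const _)]
    simp
  rw [key, key]
  exact hs _ _

theorem SchwartzFamilyOrder.add {n : ℕ} {f g : τ → Space → ℝ} (hf : SchwartzFamilyOrder n f)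
    (hg : SchwartzFamilyOrder n g) : SchwartzFamilyOrder n fun t x => f t x + g t x := by
  have base : RapidFamily (fun t x => f t x + g t x) ∧
      ∀ t, ContDiff ℝ ∞ (fun x => f t x + g t x) :=
    ⟨hf.base.1.add hg.base.1, fun t => (hf.base.2 t).add (hg.base.2 t)⟩
  induction n generalizing f g with
  | zero => exact base
  | succ n ih =>
    refine ⟨base, fun j => ?_⟩
    have e : (fun t => InteractionMorawetz.pd j (fun x => f t x + g t x)) = fun t x =>
        InteractionMorawetz.pd j (f t) x + InteractionMorawetz.pd j (g t) x := by
      funext t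
      exact pd_add (hf.1.2 t) (hg.1.2 t) j
    rw [e]
    have h1 := hf.2 j
    have h2 := hg.2 j
    exact ih h1 h2 ⟨h1.base.1.add h2.base.1, fun t => (h1.base.2 t).add (h2.base.2 t)⟩

theorem SchwartzFamilyOrder.const_mul {n : ℕ} {f : τ → Space → ℝ} (hf : SchwartzFamilyOrder n f)
    (c : ℝ) : SchwartzFamilyOrder n fun t x => c * f t x := by
  have base : ∀ {f : τ → Space → ℝ} {n : ℕ}, SchwartzFamilyOrder n f →
      RapidFamily (fun t x => c * f t x) ∧ ∀ t, ContDiff ℝ ∞ (fun x => c * f t x) := fun hf =>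
    ⟨hf.base.1.const_mul c, fun t => contDiff_const.mul (hf.base.2 t)⟩
  induction n generalizing f with
  | zero => exact base hf
  | succ n ih =>
    refine ⟨base hf, fun j => ?_⟩
    have e : (fun t => InteractionMorawetz.pd j (fun x => c * f t x)) = fun t x =>
        c * InteractionMorawetz.pd j (f t) x := by
      funext t
      exact pd_const_mul (hf.1.2 t) c j
    rw [e]
    exact ih (hf.2 j)

theorem SchwartzFamilyOrder.mul {n : ℕ} {f g : τ → Space → ℝ} (hf : SchwartzFamilyOrder n f)
    (hg : SchwartzFamilyOrder n g) : SchwartzFamilyOrder n fun t x => f t x * g t x := by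
  have base : ∀ {f g : τ → Space → ℝ} {n : ℕ}, SchwartzFamilyOrder n f → SchwartzFamilyOrder n g →
      RapidFamily (fun t x => f t x * g t x) ∧ ∀ t, ContDiff ℝ ∞ (fun x => f t x * g t x) :=
    fun hf hg => ⟨hf.base.1.mul hg.base.1, fun t => (hf.base.2 t).mul (hg.base.2 t)⟩
  induction n generalizing f g with
  | zero => exact base hf hg
  | succ n ih =>
    refine ⟨base hf hg, fun j => ?_⟩
    have e : (fun t => InteractionMorawetz.pd j (fun x => f t x * g t x)) = fun t x =>
        InteractionMorawetz.pd j (f t) x * g t x + f t x * InteractionMorawetz.pd j (g t) x := by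
      funext t
      exact pd_mul (hf.1.2 t) (hg.1.2 t) j
    rw [e]
    exact (ih (hf.2 j) hg.of_succ).add (ih hf.of_succ (hg.2 j))

theorem SchwartzFamily.add {f g : τ → Space → ℝ} (hf : SchwartzFamily f) (hg : SchwartzFamily g) :
    SchwartzFamily fun t x => f t x + g t x :=
  fun n => (hf n).add (hg n)

theorem SchwartzFamily.mul {f g : τ → Space → ℝ} (hf : SchwartzFamily f) (hg : SchwartzFamily g) :
    SchwartzFamily fun t x => f t x * g t x :=
  fun n => (hf n).mul (hg n)

theorem SchwartzFamily.const_mul {f : τ → Space → ℝ} (hf : SchwartzFamily f) (c : ℝ) :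
    SchwartzFamily fun t x => c * f t x :=
  fun n => (hf n).const_mul c

theorem SchwartzFamily.neg {f : τ → Space → ℝ} (hf : SchwartzFamily f) :
    SchwartzFamily fun t x => - f t x := by
  simpa using hf.const_mul (-1)

theorem SchwartzFamily.sub {f g : τ → Space → ℝ} (hf : SchwartzFamily f) (hg : SchwartzFamily g) :
    SchwartzFamily fun t x => f t x - g t x := by
  simpa [sub_eq_add_neg] using hf.add hg.neg

theorem SchwartzFamily.sum3 {f : Fin 3 → τ → Space → ℝ} (hf : ∀ k, SchwartzFamily (f k)) :
    SchwartzFamily fun t x => ∑ k, f k t x := by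
  simpa [Fin.sum_univ_three] using ((hf 0).add (hf 1)).add (hf 2)

theorem SchwartzFamilyOrder.comp {σ : Type*} [TopologicalSpace σ] {n : ℕ} {f : τ → Space → ℝ}
    (hf : SchwartzFamilyOrder n f) {g : σ → τ} (hg : Continuous g) :
    SchwartzFamilyOrder n fun s => f (g s) := by
  induction n generalizing f with
  | zero => exact ⟨hf.1.comp hg, fun s => hf.2 (g s)⟩
  | succ n ih => exact ⟨⟨hf.1.1.comp hg, fun s => hf.1.2 (g s)⟩, fun j => ih (hf.2 j)⟩

theorem SchwartzFamily.comp {σ : Type*} [TopologicalSpace σ] {f : τ → Space → ℝ}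
    (hf : SchwartzFamily f) {g : σ → τ} (hg : Continuous g) :
    SchwartzFamily fun s => f (g s) :=
  fun n => (hf n).comp hg

end Families

/-! ### From fields on the space-time slab to Schwartz families in space. -/

section Slab

variable {a b : ℝ} {φ : ℝ → Space → ℂ}

theorem uniqueDiffOn_slab (hab : a < b) :
    UniqueDiffOn ℝ (Set.Icc a b ×ˢ (Set.univ : Set Space)) :=
  (uniqueDiffOn_Icc hab).prod uniqueDiffOn_univ

theorem IsSchwartzOnSlab.hasFDerivAt (h : IsSchwartzOnSlab a b φ) {t : ℝ} (ht : t ∈ Set.Icc a b)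
    (x : Space) :
    HasFDerivAt (φ t) ((fderivWithin ℝ (fun p : ℝ × Space => φ p.1 p.2)
      (Set.Icc a b ×ˢ Set.univ) (t, x)).comp (ContinuousLinearMap.inr ℝ ℝ Space)) x := by
  have h1 : HasFDerivWithinAt (fun p : ℝ × Space => φ p.1 p.2) _ _ (t, x) :=
    (h.smooth.differentiableOn (by simp) (t, x) ⟨ht, trivial⟩).hasFDerivWithinAt
  have h2 : HasFDerivWithinAt (fun y : Space => (t, y)) (ContinuousLinearMap.inr ℝ ℝ Space)
      Set.univ x := (hasFDerivAt_prodMk_right t x).hasFDerivWithinAt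
  exact (h1.comp x h2 (fun y _ => ⟨ht, trivial⟩)).hasFDerivAt Filter.univ_mem

theorem IsSchwartzOnSlab.partialDeriv_eq (h : IsSchwartzOnSlab a b φ) {t : ℝ}
    (ht : t ∈ Set.Icc a b) (x : Space) (j : Fin 3) :
    partialDeriv (φ t) j x = fderivWithin ℝ (fun p : ℝ × Space => φ p.1 p.2)
      (Set.Icc a b ×ˢ Set.univ) (t, x) (0, EuclideanSpace.single j (1 : ℝ)) := by
  rw [partialDeriv, (h.hasFDerivAt ht x).fderiv]
  simp

theorem IsSchwartzOnSlab.contDiff (h : IsSchwartzOnSlab a b φ) {t : ℝ} (ht : t ∈ Set.Icc a b) :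
    ContDiff ℝ ∞ (φ t) := by
  rw [← contDiffOn_univ]
  have h2 : ContDiff ℝ ∞ (fun y : Space => (t, y)) := contDiff_const.prodMk contDiff_id
  exact h.smooth.comp h2.contDiffOn (fun y _ => ⟨ht, trivial⟩)

/-- A spatial derivative is evaluation of the space-time derivative in a fixed direction, so its
derivatives of order n are controlled by those of φ of order n + 1. Nondegeneracy of the interval
enters through unique differentiability on the slab. -/
theorem IsSchwartzOnSlab.partialDeriv (hab : a < b) (h : IsSchwartzOnSlab a b φ) (j : Fin 3) :
    IsSchwartzOnSlab a b (fun t => partialDeriv (φ t) j) := by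
  set S : Set (ℝ × Space) := Set.Icc a b ×ˢ Set.univ with hS
  set L : ((ℝ × Space) →L[ℝ] ℂ) →L[ℝ] ℂ :=
    ContinuousLinearMap.apply ℝ ℂ ((0, EuclideanSpace.single j (1 : ℝ)) : ℝ × Space)
  have hu : UniqueDiffOn ℝ S := uniqueDiffOn_slab hab
  have hF : ContDiffOn ℝ ∞ (fderivWithin ℝ (fun p : ℝ × Space => φ p.1 p.2) S) S :=
    h.smooth.fderivWithin hu (by simp)
  have e : Set.EqOn (fun p : ℝ × Space => InteractionMorawetz.partialDeriv (φ p.1) j p.2)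
      (L ∘ fderivWithin ℝ (fun p : ℝ × Space => φ p.1 p.2) S) S := by
    rintro ⟨t, x⟩ ⟨ht, -⟩
    exact h.partialDeriv_eq ht x j
  refine ⟨(L.contDiff.comp_contDiffOn hF).congr e, fun k n => ?_⟩
  obtain ⟨C, hC⟩ := h.decay k (n + 1)
  refine ⟨‖L‖ * C, fun t ht x => ?_⟩
  have hx : (t, x) ∈ S := ⟨ht, trivial⟩
  rw [iteratedFDerivWithin_congr e hx, L.iteratedFDerivWithin_comp_left (hF _ hx) hu hx
    (by exact_mod_cast le_top)]
  calc ‖x‖ ^ k * ‖L.compContinuousMultilinearMap (iteratedFDerivWithin ℝ n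
        (fderivWithin ℝ (fun p : ℝ × Space => φ p.1 p.2) S) S (t, x))‖
      ≤ ‖x‖ ^ k * (‖L‖ * ‖iteratedFDerivWithin ℝ n
        (fderivWithin ℝ (fun p : ℝ × Space => φ p.1 p.2) S) S (t, x)‖) := by
        gcongr
        exact L.norm_compContinuousMultilinearMap_le _
    _ = ‖L‖ * (‖x‖ ^ k * ‖iteratedFDerivWithin ℝ (n + 1)
        (fun p : ℝ × Space => φ p.1 p.2) S (t, x)‖) := by
        rw [norm_iteratedFDerivWithin_fderivWithin hu hx]; ring
    _ ≤ ‖L‖ * C := by gcongr; exact hC t ht x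

theorem IsSchwartzOnSlab.rapid (h : IsSchwartzOnSlab a b φ) (L : ℂ →L[ℝ] ℝ) :
    RapidFamily fun (t : Set.Icc a b) x => L (φ t x) := by
  refine ⟨?_, fun k => ?_⟩
  · have h1 : Continuous fun p : Set.Icc a b × Space => φ p.1 p.2 :=
      h.smooth.continuousOn.comp_continuous
        (f := fun p : Set.Icc a b × Space => ((p.1 : ℝ), p.2)) (by fun_prop)
        (fun p => ⟨p.1.2, trivial⟩)
    exact L.continuous.comp h1
  · obtain ⟨C, hC⟩ := h.decay 0 0
    obtain ⟨D, hD⟩ := h.decay k 0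
    refine ⟨2 ^ k * (‖L‖ * (C + D)), fun t x => ?_⟩
    have h0 := hC t t.2 x
    have h1 := hD t t.2 x
    simp only [norm_iteratedFDerivWithin_zero, pow_zero, one_mul] at h0 h1
    have hL : |L (φ t x)| ≤ ‖L‖ * ‖φ t x‖ := L.le_opNorm _
    -- The hypotheses control the weights 1 and ‖x‖^k; together they dominate (1 + ‖x‖)^k.
    have hp : (1 + ‖x‖) ^ k ≤ 2 ^ k * (1 + ‖x‖ ^ k) := by
      rcases le_total ‖x‖ 1 with hx | hx
      · calc (1 + ‖x‖) ^ k ≤ 2 ^ k := by gcongr; linarith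
          _ ≤ 2 ^ k * (1 + ‖x‖ ^ k) := le_mul_of_one_le_right (by positivity)
            (by linarith [pow_nonneg (norm_nonneg x) k])
      · calc (1 + ‖x‖) ^ k ≤ (2 * ‖x‖) ^ k := by gcongr; linarith
          _ = 2 ^ k * ‖x‖ ^ k := mul_pow _ _ _
          _ ≤ 2 ^ k * (1 + ‖x‖ ^ k) := by gcongr; linarith
    calc (1 + ‖x‖) ^ k * |L (φ t x)|
        ≤ (2 ^ k * (1 + ‖x‖ ^ k)) * (‖L‖ * ‖φ t x‖) := by gcongr
      _ = 2 ^ k * (‖L‖ * (‖φ t x‖ + ‖x‖ ^ k * ‖φ t x‖)) := by ring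
      _ ≤ 2 ^ k * (‖L‖ * (C + D)) := by gcongr

theorem pd_clm_comp {f : Space → ℂ} (hf : ContDiff ℝ ∞ f) (L : ℂ →L[ℝ] ℝ) (j : Fin 3) :
    pd j (fun x => L (f x)) = fun x => L (partialDeriv f j x) := by
  funext x
  have h1 := (hf.differentiable (by simp) x).hasFDerivAt
  have h2 := (L.hasFDerivAt.comp x h1).fderiv
  simp only [pd, partialDeriv]
  change fderiv ℝ (L ∘ f) x _ = _
  rw [h2]
  rfl

/-- The map L will be the real or imaginary part. Only spatial derivatives are recorded: time
derivatives are later eliminated with the equation. -/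
theorem IsSchwartzOnSlab.schwartzFamily (hab : a < b) (h : IsSchwartzOnSlab a b φ)
    (L : ℂ →L[ℝ] ℝ) : SchwartzFamily fun (t : Set.Icc a b) x => L (φ t x) := by
  intro n
  have base : ∀ {φ : ℝ → Space → ℂ}, IsSchwartzOnSlab a b φ →
      RapidFamily (fun (t : Set.Icc a b) x => L (φ t x)) ∧
        ∀ t : Set.Icc a b, ContDiff ℝ ∞ fun x => L (φ t x) := fun h =>
    ⟨h.rapid L, fun t => L.contDiff.comp (h.contDiff t.2)⟩
  induction n generalizing φ with
  | zero => exact base h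
  | succ n ih =>
    refine ⟨base h, fun j => ?_⟩
    have e : (fun t : Set.Icc a b => pd j (fun x => L (φ t x))) =
        fun (t : Set.Icc a b) x => L (InteractionMorawetz.partialDeriv (φ t) j x) := by
      funext t
      exact pd_clm_comp (h.contDiff t.2) L j
    rw [e]
    exact ih (h.partialDeriv hab j)

end Slab

/-! ### Smooth majorants of flat functions. -/

section Majorant

/-- A smooth function vanishing on the negative half-line is flat at the origin. -/
theorem exists_abs_le_pow {F : ℝ → ℝ} (hF : ContDiff ℝ ∞ F) (h0 : ∀ x ≤ 0, F x = 0) (n : ℕ) :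
    ∃ C, 0 ≤ C ∧ ∀ x ∈ Set.Icc (0 : ℝ) 2, |F x| ≤ C * x ^ n := by
  induction n generalizing F with
  | zero =>
    obtain ⟨C, hC⟩ := isCompact_Icc.exists_bound_of_continuousOn
      (hF.continuous.continuousOn (s := Set.Icc (0 : ℝ) 2))
    refine ⟨C, (norm_nonneg _).trans (hC 0 (by norm_num)), fun x hx => ?_⟩
    simpa using hC x hx
  | succ n ih =>
    have hF' : ContDiff ℝ ∞ (deriv F) := (contDiff_infty_iff_deriv.1 hF).2
    have h0' : ∀ x ≤ 0, deriv F x = 0 := by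
      have h1 : ∀ x < 0, deriv F x = 0 := fun x hx => by
        have : F =ᶠ[nhds x] fun _ => 0 := by
          filter_upwards [Iio_mem_nhds hx] with y hy using h0 y hy.le
        rw [this.deriv_eq, deriv_const]
      intro x hx
      have hcl : x ∈ closure (Set.Iio (0 : ℝ)) := by simpa using hx
      exact closure_minimal (fun y hy => h1 y hy)
        (isClosed_singleton.preimage hF'.continuous) hcl
    obtain ⟨C, hC0, hC⟩ := ih hF' h0'
    refine ⟨C, hC0, fun x hx => ?_⟩
    -- The mean value inequality on [0, x] gains one power of x over the bound for the derivative.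
    have key := (convex_Icc 0 x).norm_image_sub_le_of_norm_deriv_le (f := F) (C := C * x ^ n)
      (fun y _ => hF.differentiable (by simp) y)
      (fun y hy => (hC y ⟨hy.1, hy.2.trans hx.2⟩).trans
        (mul_le_mul_of_nonneg_left (pow_le_pow_left₀ hy.1 hy.2 n) hC0))
      (Set.left_mem_Icc.2 hx.1) (Set.right_mem_Icc.2 hx.1)
    rw [h0 0 le_rfl, sub_zero, sub_zero, Real.norm_eq_abs, Real.norm_eq_abs,
      abs_of_nonneg hx.1] at key
    rw [pow_succ, ← mul_assoc]
    exact key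

theorem exists_two_pow_mul_mem_Icc {x : ℝ} (hx0 : 0 < x) (hx2 : x ≤ 2) :
    ∃ k : ℕ, 1 ≤ 2 ^ k * x ∧ 2 ^ k * x ≤ 2 := by
  obtain ⟨n, hn, hn'⟩ := exists_nat_pow_near (one_le_inv_iff₀.2 ⟨by positivity, by linarith⟩ : 1 ≤ (x / 2)⁻¹)
    (one_lt_two : (1 : ℝ) < 2)
  refine ⟨n, ?_, ?_⟩
  · rw [inv_div, div_lt_iff₀ hx0, pow_succ] at hn'
    nlinarith
  · rw [inv_div, le_div_iff₀ hx0] at hn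
    linarith

/-- A smooth function vanishing on the negative half-line has a smooth majorant on `[0, 2]` which
vanishes on the negative half-line and is positive on the positive one. -/
theorem exists_smooth_majorant {F : ℝ → ℝ} (hF : ContDiff ℝ ∞ F) (h0 : ∀ x ≤ 0, F x = 0) :
    ∃ A : ℝ → ℝ, ContDiff ℝ ∞ A ∧ (∀ x ≤ 0, A x = 0) ∧ (∀ x, 0 < x → 0 < A x) ∧
      ∀ x ∈ Set.Icc (0 : ℝ) 2, |F x| ≤ A x := by
  -- A bump equal to 1 on [1, 2] and vanishing on the negative half-line. Its dilates β(2^k x) equal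
  -- 1 on the dyadic intervals 2^(-k)[1, 2], which cover (0, 2].
  let β : ContDiffBump (3 / 2 : ℝ) := ⟨1 / 2, 1, by norm_num, by norm_num⟩
  have hβ1 : ∀ x, 1 ≤ x → x ≤ 2 → β x = 1 := fun x h1 h2 =>
    β.one_of_mem_closedBall (by
      rw [Metric.mem_closedBall, Real.dist_eq, abs_le]; constructor <;> norm_num [β] <;> linarith)
  have hβ0 : ∀ x, x ≤ 0 → β x = 0 := fun x h => β.zero_of_le_dist (by
    rw [Real.dist_eq, abs_of_nonpos (by linarith)]; norm_num [β]; linarith)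
  -- M_k is the maximum of |F| on [0, 2·2^(-k)]. By flatness it decays faster than any power of
  -- 2^(-k).
  have hsup : ∀ k : ℕ, ∃ M, 0 ≤ M ∧ (∀ x, 0 ≤ x → x ≤ 2 * (2⁻¹ : ℝ) ^ k → |F x| ≤ M) ∧
      ∀ n C, (∀ x ∈ Set.Icc (0 : ℝ) 2, |F x| ≤ C * x ^ n) → M ≤ C * (2 * (2⁻¹ : ℝ) ^ k) ^ n := by
    intro k
    have hk : (0 : ℝ) ≤ 2 * (2⁻¹ : ℝ) ^ k := by positivity
    have hk2 : 2 * (2⁻¹ : ℝ) ^ k ≤ 2 := by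
      have : (2⁻¹ : ℝ) ^ k ≤ 1 := pow_le_one₀ (by norm_num) (by norm_num)
      linarith
    obtain ⟨y, hy, hmax⟩ := isCompact_Icc.exists_isMaxOn (Set.nonempty_Icc.2 hk)
      (hF.continuous.abs.continuousOn (s := Set.Icc 0 (2 * (2⁻¹ : ℝ) ^ k)))
    refine ⟨|F y|, abs_nonneg _, fun x hx hx' => hmax ⟨hx, hx'⟩, fun n C hC => ?_⟩
    have h1 := hC y ⟨hy.1, hy.2.trans hk2⟩
    have hC0 : 0 ≤ C := by
      have := (abs_nonneg _).trans (hC 1 (by norm_num))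
      simpa using this
    exact h1.trans (mul_le_mul_of_nonneg_left (pow_le_pow_left₀ hy.1 hy.2 n) hC0)
  choose M hM0 hMF hMC using hsup
  have hcs : ∀ n : ℕ, ∃ B, ∀ x, ‖iteratedFDeriv ℝ n β x‖ ≤ B := fun n => by
    have h1 : HasCompactSupport (iteratedFDeriv ℝ n β) := β.hasCompactSupport.iteratedFDeriv n
    exact h1.exists_bound_of_continuous
      (β.contDiff.continuous_iteratedFDeriv (m := n) (n := ∞) (by exact_mod_cast le_top))
  choose B hB using hcs
  have hB0 : ∀ n, 0 ≤ B n := fun n => (norm_nonneg _).trans (hB n 0)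
  choose C hC0 hC using fun n => exists_abs_le_pow hF h0 n
  -- Differentiating the k-th term n times costs 2^(kn). Flatness of order n + 1 pays for this and
  -- leaves a summable factor 2^(-k).
  have hbound : ∀ (n k : ℕ) (x : ℝ),
      ‖iteratedFDeriv ℝ n (fun x => M k * β (2 ^ k * x)) x‖ ≤
        (C (n + 1) * 2 ^ (n + 1) * B n) * (2⁻¹ : ℝ) ^ k := by
    intro n k x
    rw [norm_iteratedFDeriv_eq_norm_iteratedDeriv, iteratedDeriv_const_mul_field,
      iteratedDeriv_comp_const_mul (β.contDiff.of_le (by exact_mod_cast le_top))]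
    have h1 : ‖iteratedDeriv n β (2 ^ k * x)‖ ≤ B n := by
      rw [← norm_iteratedFDeriv_eq_norm_iteratedDeriv]; exact hB _ _
    have h2 := hMC k (n + 1) _ (hC (n + 1))
    rw [norm_mul, norm_mul, Real.norm_of_nonneg (hM0 k), Real.norm_of_nonneg (by positivity)]
    calc M k * ((2 ^ k) ^ n * ‖iteratedDeriv n β (2 ^ k * x)‖)
        ≤ (C (n + 1) * (2 * (2⁻¹ : ℝ) ^ k) ^ (n + 1)) * ((2 ^ k) ^ n * B n) := by
          have := hC0 (n + 1)
          gcongr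
      _ = (C (n + 1) * 2 ^ (n + 1) * B n) * ((2 ^ k * (2⁻¹ : ℝ) ^ k) ^ n * (2⁻¹ : ℝ) ^ k) := by
        rw [mul_pow, mul_pow, pow_succ ((2⁻¹ : ℝ) ^ k)]; ring
      _ = _ := by rw [← mul_pow, mul_inv_cancel₀ two_ne_zero, one_pow, one_pow, one_mul]
  have hsum : ∀ n : ℕ, Summable fun k : ℕ => (C (n + 1) * 2 ^ (n + 1) * B n) * (2⁻¹ : ℝ) ^ k :=
    fun n => (summable_geometric_of_lt_one (by norm_num) (by norm_num)).mul_left _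
  have hcd : ∀ k, ContDiff ℝ ∞ fun x => M k * β (2 ^ k * x) := fun k =>
    contDiff_const.mul (β.contDiff.comp (contDiff_const.mul contDiff_id))
  have hnn : ∀ k x, 0 ≤ M k * β (2 ^ k * x) := fun k x => mul_nonneg (hM0 k) β.nonneg
  have hsx : ∀ x, Summable fun k => M k * β (2 ^ k * x) := fun x =>
    Summable.of_nonneg_of_le (fun k => hnn k x)
      (fun k => (Real.le_norm_self _).trans (by
        rw [← norm_iteratedFDeriv_zero (𝕜 := ℝ) (f := fun x => M k * β (2 ^ k * x))]
        exact hbound 0 k x)) (hsum 0)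
  -- The sum already dominates |F|; the added `expNegInvGlue` makes the majorant strictly positive
  -- for x > 0 without spoiling smoothness or the vanishing for x ≤ 0.
  refine ⟨fun x => (∑' k, M k * β (2 ^ k * x)) + expNegInvGlue x, ?_, ?_, ?_, ?_⟩
  · exact (contDiff_tsum (N := (⊤ : ℕ∞)) hcd (fun n _ => hsum n) (fun n k x _ => hbound n k x)).add
      expNegInvGlue.contDiff
  · intro x hx
    have : ∀ k : ℕ, M k * β (2 ^ k * x) = 0 := fun k => by
      rw [hβ0 _ (mul_nonpos_of_nonneg_of_nonpos (by positivity) hx), mul_zero]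
    simp [this, expNegInvGlue.zero_of_nonpos hx]
  · intro x hx
    exact add_pos_of_nonneg_of_pos (tsum_nonneg fun k => hnn k x) (expNegInvGlue.pos_of_pos hx)
  · intro x hx
    rcases hx.1.eq_or_lt with rfl | hx0
    · rw [h0 0 le_rfl, abs_zero]
      exact add_nonneg (tsum_nonneg fun k => hnn k 0) (expNegInvGlue.nonneg 0)
    obtain ⟨k, hk1, hk2⟩ := exists_two_pow_mul_mem_Icc hx0 hx.2
    have h1 : |F x| ≤ M k := hMF k x hx.1 (by
      rw [inv_pow, ← div_eq_mul_inv, le_div_iff₀ (by positivity)]; linarith)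
    calc |F x| ≤ M k * β (2 ^ k * x) := by rw [hβ1 _ hk1 hk2, mul_one]; exact h1
      _ ≤ ∑' k, M k * β (2 ^ k * x) := (hsx x).le_tsum k fun i _ => hnn i x
      _ ≤ _ := le_add_of_nonneg_right (expNegInvGlue.nonneg x)

/-- A smooth function `w` of `s = r²`, supported in `1 ≤ s ≤ 4`, is dominated by a nonnegative
annular cutoff in `r`. -/
theorem exists_annularCutoff {w : ℝ → ℝ} (hw : ContDiff ℝ ∞ w) (h1 : ∀ s ≤ 1, w s = 0)
    (h4 : ∀ s, 4 ≤ s → w s = 0) :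
    ∃ ψ : ℝ → ℝ, IsAnnularCutoff ψ ∧ (∀ r, 0 ≤ ψ r) ∧ ∀ r, 0 ≤ r → |w (r ^ 2)| ≤ ψ r := by
  obtain ⟨A, hA, hA0, hApos, hAw⟩ := exists_smooth_majorant (F := fun x => w (1 + x))
    (hw.comp (contDiff_const.add contDiff_id)) (fun x hx => h1 _ (by linarith))
  obtain ⟨D, hD, hD0, hDpos, hDw⟩ := exists_smooth_majorant (F := fun x => w (4 - x))
    (hw.comp (contDiff_const.sub contDiff_id)) (fun x hx => h4 _ (by linarith))
  have hAn : ∀ x, 0 ≤ A x := fun x => by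
    rcases le_or_gt x 0 with h | h
    exacts [(hA0 x h).ge, (hApos x h).le]
  have hDn : ∀ x, 0 ≤ D x := fun x => by
    rcases le_or_gt x 0 with h | h
    exacts [(hD0 x h).ge, (hDpos x h).le]
  have hlow : ∀ E : ℝ → ℝ, Continuous E → (∀ x, 0 < x → 0 < E x) →
      ∃ c, 0 < c ∧ ∀ x ∈ Set.Icc (1 : ℝ) 3, c ≤ E x := fun E hE hpos => by
    obtain ⟨y, hy, hmin⟩ := isCompact_Icc.exists_isMinOn (Set.nonempty_Icc.2 (by norm_num : (1 : ℝ) ≤ 3))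
      (hE.continuousOn (s := Set.Icc (1 : ℝ) 3))
    exact ⟨E y, hpos y (by linarith [hy.1]), fun x hx => hmin hx⟩
  obtain ⟨c, hc, hcA⟩ := hlow A hA.continuous hApos
  obtain ⟨d, hd, hdD⟩ := hlow D hD.continuous hDpos
  have hcd : 0 < c⁻¹ + d⁻¹ := by positivity
  -- In s = r² one factor majorizes near s = 1, the other near s = 4, and the constants undo the
  -- size of the factor that is far from its zero. The condition `0 < r` removes the mirror annulus
  -- −2 ≤ r ≤ −1.
  refine ⟨fun r => if 0 < r then (c⁻¹ + d⁻¹) * (A (r ^ 2 - 1) * D (4 - r ^ 2)) else 0,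
    ⟨?_, ?_⟩, ?_, ?_⟩
  · rw [contDiff_iff_contDiffAt]
    intro r
    rcases lt_or_ge r 1 with hr | hr
    · have : (fun r : ℝ => if 0 < r then (c⁻¹ + d⁻¹) * (A (r ^ 2 - 1) * D (4 - r ^ 2)) else 0)
          =ᶠ[nhds r] fun _ => 0 := by
        filter_upwards [Iio_mem_nhds hr] with y hy
        split_ifs with h
        · rw [hA0 _ (by simp only [Set.mem_Iio] at hy; nlinarith), zero_mul, mul_zero]
        · rfl
      exact contDiffAt_const.congr_of_eventuallyEq this
    · have : (fun r : ℝ => if 0 < r then (c⁻¹ + d⁻¹) * (A (r ^ 2 - 1) * D (4 - r ^ 2)) else 0)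
          =ᶠ[nhds r] fun r => (c⁻¹ + d⁻¹) * (A (r ^ 2 - 1) * D (4 - r ^ 2)) := by
        filter_upwards [Ioi_mem_nhds (lt_of_lt_of_le one_pos hr)] with y hy
        rw [if_pos (Set.mem_Ioi.1 hy)]
      refine ContDiffAt.congr_of_eventuallyEq ?_ this
      exact (contDiff_const.mul ((hA.comp ((contDiff_id.pow 2).sub contDiff_const)).mul
        (hD.comp (contDiff_const.sub (contDiff_id.pow 2))))).contDiffAt
  · intro r hr
    rw [Function.mem_support] at hr
    split_ifs at hr with h
    · by_contra hcon
      rw [Set.mem_Icc, not_and_or, not_le, not_le] at hcon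
      rcases hcon with h' | h'
      · exact hr (by rw [hA0 _ (by nlinarith), zero_mul, mul_zero])
      · exact hr (by rw [hD0 _ (by nlinarith), mul_zero, mul_zero])
    · exact absurd rfl hr
  · intro r
    dsimp only
    split_ifs
    · exact mul_nonneg hcd.le (mul_nonneg (hAn _) (hDn _))
    · exact le_rfl
  · intro r hr
    rcases hr.eq_or_lt with rfl | hr0
    · simp [h1]
    dsimp only
    rw [if_pos hr0]
    have hnn : 0 ≤ (c⁻¹ + d⁻¹) * (A (r ^ 2 - 1) * D (4 - r ^ 2)) :=
      mul_nonneg hcd.le (mul_nonneg (hAn _) (hDn _))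
    rcases le_or_gt (r ^ 2) 1 with hs1 | hs1
    · rw [h1 _ hs1, abs_zero]; exact hnn
    rcases le_or_gt 4 (r ^ 2) with hs4 | hs4
    · rw [h4 _ hs4, abs_zero]; exact hnn
    -- Splitting at s = 2 keeps the majorizing argument in [0, 2] and the argument of the other
    -- factor in [1, 3], where it is at least c or d.
    rcases le_total (r ^ 2) 2 with hs2 | hs2
    · have e1 := hAw (r ^ 2 - 1) ⟨by linarith, by linarith⟩
      have e2 := hdD (4 - r ^ 2) ⟨by linarith, by linarith⟩
      simp only [add_sub_cancel] at e1
      calc |w (r ^ 2)| ≤ A (r ^ 2 - 1) := e1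
        _ = d⁻¹ * (A (r ^ 2 - 1) * d) := by field_simp
        _ ≤ (c⁻¹ + d⁻¹) * (A (r ^ 2 - 1) * D (4 - r ^ 2)) :=
          mul_le_mul (by linarith [inv_pos.2 hc]) (mul_le_mul_of_nonneg_left e2 (hAn _))
            (mul_nonneg (hAn _) hd.le) hcd.le
    · have e1 := hDw (4 - r ^ 2) ⟨by linarith, by linarith⟩
      have e2 := hcA (r ^ 2 - 1) ⟨by linarith, by linarith⟩
      simp only [sub_sub_cancel] at e1
      calc |w (r ^ 2)| ≤ D (4 - r ^ 2) := e1
        _ = c⁻¹ * (c * D (4 - r ^ 2)) := by field_simp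
        _ ≤ (c⁻¹ + d⁻¹) * (A (r ^ 2 - 1) * D (4 - r ^ 2)) :=
          mul_le_mul (by linarith [inv_pos.2 hd]) (mul_le_mul_of_nonneg_right e2 (hDn _))
            (mul_nonneg hc.le (hDn _)) hcd.le

end Majorant

/-! ### Radial profiles as functions of s = |z|². -/

section Profiles

/-- The function `(s + e)^(-1/2)`. -/
noncomputable def invSqrt (e s : ℝ) : ℝ := (√(s + e))⁻¹

theorem invSqrt_nonneg (e s : ℝ) : 0 ≤ invSqrt e s := inv_nonneg.2 (Real.sqrt_nonneg _)

theorem invSqrt_sq {e s : ℝ} (h : 0 < s + e) : (s + e) * invSqrt e s ^ 2 = 1 := by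
  rw [invSqrt, inv_pow, Real.sq_sqrt h.le, mul_inv_cancel₀ h.ne']

theorem hasDerivAt_invSqrt {e s : ℝ} (h : 0 < s + e) :
    HasDerivAt (invSqrt e) (-(1 / 2) * invSqrt e s ^ 3) s := by
  have h1 : HasDerivAt (fun s => s + e) 1 s := (hasDerivAt_id s).add_const e
  have h2 := (h1.sqrt h.ne').inv (Real.sqrt_ne_zero'.2 h)
  refine h2.congr_deriv ?_
  have h3 : √(s + e) ≠ 0 := Real.sqrt_ne_zero'.2 h
  unfold invSqrt
  field_simp

theorem hasDerivAt_invSqrt_pow {e s : ℝ} (h : 0 < s + e) (c : ℝ) (n : ℕ) :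
    HasDerivAt (fun s => c * invSqrt e s ^ (n + 1)) (-(c * (n + 1) / 2) * invSqrt e s ^ (n + 3)) s := by
  refine (((hasDerivAt_invSqrt h).pow (n + 1)).const_mul c).congr_deriv ?_
  rw [Nat.add_sub_cancel]
  push_cast
  ring

theorem invSqrt_le {e s : ℝ} (he : 0 < e) (hs : 0 ≤ s) : invSqrt e s ≤ invSqrt e 0 := by
  unfold invSqrt
  gcongr

theorem invSqrt_anti {e s : ℝ} (he : 0 ≤ e) (hs : 0 < s) : invSqrt e s ≤ invSqrt 0 s := by
  unfold invSqrt
  have : 0 < √(s + 0) := Real.sqrt_pos.2 (by simpa)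
  gcongr

/-- A function on `[0, ∞)` with three derivatives which are bounded. -/
structure IsProfile (h h₁ h₂ h₃ : ℝ → ℝ) : Prop where
  deriv_zero : ∀ s, 0 ≤ s → HasDerivAt h (h₁ s) s
  deriv_one : ∀ s, 0 ≤ s → HasDerivAt h₁ (h₂ s) s
  deriv_two : ∀ s, 0 ≤ s → HasDerivAt h₂ (h₃ s) s
  continuousOn_three : ContinuousOn h₃ (Set.Ici 0)
  bounded : ∃ B, ∀ s, 0 ≤ s → |h s| ≤ B ∧ |h₁ s| ≤ B ∧ |h₂ s| ≤ B ∧ |h₃ s| ≤ B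

theorem IsProfile.sub {h h₁ h₂ h₃ g g₁ g₂ g₃ : ℝ → ℝ} (hh : IsProfile h h₁ h₂ h₃)
    (hg : IsProfile g g₁ g₂ g₃) :
    IsProfile (fun s => h s - g s) (fun s => h₁ s - g₁ s) (fun s => h₂ s - g₂ s)
      (fun s => h₃ s - g₃ s) := by
  refine ⟨fun s hs => (hh.1 s hs).sub (hg.1 s hs), fun s hs => (hh.2 s hs).sub (hg.2 s hs),
    fun s hs => (hh.3 s hs).sub (hg.3 s hs), hh.4.sub hg.4, ?_⟩
  obtain ⟨B, hB⟩ := hh.5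
  obtain ⟨D, hD⟩ := hg.5
  refine ⟨B + D, fun s hs => ?_⟩
  obtain ⟨a, b, c, d⟩ := hB s hs
  obtain ⟨a', b', c', d'⟩ := hD s hs
  exact ⟨(abs_sub _ _).trans (add_le_add a a'), (abs_sub _ _).trans (add_le_add b b'),
    (abs_sub _ _).trans (add_le_add c c'), (abs_sub _ _).trans (add_le_add d d')⟩

theorem continuousOn_invSqrt {e : ℝ} (he : 0 < e) : ContinuousOn (invSqrt e) (Set.Ici 0) :=
  fun _ hs => (hasDerivAt_invSqrt (add_pos_of_nonneg_of_pos hs he)).continuousAt.continuousWithinAt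

theorem isProfile_invSqrt {e : ℝ} (he : 0 < e) :
    IsProfile (invSqrt e) (fun s => -(1 / 2) * invSqrt e s ^ 3) (fun s => 3 / 4 * invSqrt e s ^ 5)
      (fun s => -(15 / 8) * invSqrt e s ^ 7) := by
  refine ⟨fun s hs => hasDerivAt_invSqrt (by linarith), fun s hs => ?_, fun s hs => ?_,
    continuousOn_const.mul ((continuousOn_invSqrt he).pow 7),
    ⟨invSqrt e 0 + 1 / 2 * invSqrt e 0 ^ 3 + 3 / 4 * invSqrt e 0 ^ 5 + 15 / 8 * invSqrt e 0 ^ 7,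
      fun s hs => ?_⟩⟩
  · convert hasDerivAt_invSqrt_pow (s := s) (e := e) (by linarith) (-(1 / 2)) 2 using 1
    norm_num
  · convert hasDerivAt_invSqrt_pow (s := s) (e := e) (by linarith) (3 / 4) 4 using 1
    norm_num
  · have h0 := invSqrt_nonneg e s
    have h1 := invSqrt_le he hs
    have h3 := pow_le_pow_left₀ h0 h1 3
    have h5 := pow_le_pow_left₀ h0 h1 5
    have h7 := pow_le_pow_left₀ h0 h1 7
    have p3 := pow_nonneg h0 3
    have p5 := pow_nonneg h0 5
    have p7 := pow_nonneg h0 7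
    refine ⟨?_, ?_, ?_, ?_⟩ <;> rw [abs_le] <;> constructor <;> linarith

variable {χ : ℝ → ℝ}

/-- The profile of the radial field `(1 - χ) x / |x|`, as a function of `|x|²`. -/
noncomputable def tailProfile (χ : ℝ → ℝ) (s : ℝ) : ℝ := (1 - χ √s) * (√s)⁻¹

theorem tailProfile_of_le_one (hχ : IsRadialCutoff χ) {s : ℝ} (hs : s ≤ 1) :
    tailProfile χ s = 0 := by
  rw [tailProfile, hχ.eq_one _ (Real.sqrt_nonneg s) (Real.sqrt_le_one.2 hs)]
  simp

theorem tailProfile_of_four_lt (hχ : IsRadialCutoff χ) {s : ℝ} (hs : 4 < s) :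
    tailProfile χ s = invSqrt 0 s := by
  rw [tailProfile, hχ.eq_zero, invSqrt, add_zero, sub_zero, one_mul]
  rw [Real.lt_sqrt (by norm_num)]
  linarith

/-- The square root is not smooth at s = 0, but the factor 1 − χ(√s) vanishes for s ≤ 1, so the
singularity is never seen. -/
theorem contDiff_tailProfile (hχ : IsRadialCutoff χ) : ContDiff ℝ ∞ (tailProfile χ) := by
  rw [contDiff_iff_contDiffAt]
  intro s
  rcases lt_or_ge s 1 with h | h
  · have : tailProfile χ =ᶠ[nhds s] fun _ => 0 := by
      filter_upwards [Iio_mem_nhds h] with y hy using tailProfile_of_le_one hχ (le_of_lt hy)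
    exact contDiffAt_const.congr_of_eventuallyEq this
  · have hs : 0 < s := by linarith
    have hr : 0 < √s := Real.sqrt_pos.2 hs
    have h1 : ContDiffAt ℝ ∞ (fun s : ℝ => √s) s := Real.contDiffAt_sqrt hs.ne'
    have h2 : ContDiffAt ℝ ∞ χ (√s) := hχ.smooth.contDiffAt (Ici_mem_nhds hr)
    exact (contDiffAt_const.sub (h2.comp s h1)).mul (h1.inv hr.ne')

noncomputable def tailProfile₁ (χ : ℝ → ℝ) : ℝ → ℝ := deriv (tailProfile χ)
noncomputable def tailProfile₂ (χ : ℝ → ℝ) : ℝ → ℝ := deriv (tailProfile₁ χ)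
noncomputable def tailProfile₃ (χ : ℝ → ℝ) : ℝ → ℝ := deriv (tailProfile₂ χ)

theorem contDiff_tailProfile₁ (hχ : IsRadialCutoff χ) : ContDiff ℝ ∞ (tailProfile₁ χ) :=
  (contDiff_infty_iff_deriv.1 (contDiff_tailProfile hχ)).2

theorem contDiff_tailProfile₂ (hχ : IsRadialCutoff χ) : ContDiff ℝ ∞ (tailProfile₂ χ) :=
  (contDiff_infty_iff_deriv.1 (contDiff_tailProfile₁ hχ)).2

theorem contDiff_tailProfile₃ (hχ : IsRadialCutoff χ) : ContDiff ℝ ∞ (tailProfile₃ χ) :=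
  (contDiff_infty_iff_deriv.1 (contDiff_tailProfile₂ hχ)).2

theorem tailProfile_derivs_of_lt_one (hχ : IsRadialCutoff χ) {s : ℝ} (hs : s < 1) :
    tailProfile₁ χ s = 0 ∧ tailProfile₂ χ s = 0 ∧ tailProfile₃ χ s = 0 := by
  have step : ∀ f : ℝ → ℝ, (∀ s < 1, f s = 0) → ∀ s < 1, deriv f s = 0 := fun f hf s hs => by
    have : f =ᶠ[nhds s] fun _ => 0 := by
      filter_upwards [Iio_mem_nhds hs] with y hy using hf y hy
    rw [this.deriv_eq, deriv_const]
  have h1 := step _ fun s hs => tailProfile_of_le_one hχ hs.le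
  have h2 := step _ h1
  exact ⟨h1 s hs, h2 s hs, step _ h2 s hs⟩

theorem tailProfile_derivs_of_four_lt (hχ : IsRadialCutoff χ) {s : ℝ} (hs : 4 < s) :
    tailProfile₁ χ s = -(1 / 2) * invSqrt 0 s ^ 3 ∧ tailProfile₂ χ s = 3 / 4 * invSqrt 0 s ^ 5 ∧
      tailProfile₃ χ s = -(15 / 8) * invSqrt 0 s ^ 7 := by
  have step : ∀ f g g' : ℝ → ℝ, (∀ s, 4 < s → f s = g s) →
      (∀ s, 4 < s → HasDerivAt g (g' s) s) → ∀ s, 4 < s → deriv f s = g' s :=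
    fun f g g' hf hg s hs => by
      have : f =ᶠ[nhds s] g := by
        filter_upwards [Ioi_mem_nhds hs] with y hy using hf y hy
      rw [this.deriv_eq, (hg s hs).deriv]
  have h1 := step _ _ (fun s => -(1 / 2) * invSqrt 0 s ^ 3)
    (fun s hs => tailProfile_of_four_lt hχ hs) fun s hs => hasDerivAt_invSqrt (by linarith)
  have h2 := step _ _ (fun s => 3 / 4 * invSqrt 0 s ^ 5) h1 fun s hs => by
    convert hasDerivAt_invSqrt_pow (s := s) (e := 0) (by linarith) (-(1 / 2)) 2 using 1
    norm_num
  have h3 := step _ _ (fun s => -(15 / 8) * invSqrt 0 s ^ 7) h2 fun s hs => by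
    convert hasDerivAt_invSqrt_pow (s := s) (e := 0) (by linarith) (3 / 4) 4 using 1
    norm_num
  exact ⟨h1 s hs, h2 s hs, h3 s hs⟩

theorem isProfile_tailProfile (hχ : IsRadialCutoff χ) :
    IsProfile (tailProfile χ) (tailProfile₁ χ) (tailProfile₂ χ) (tailProfile₃ χ) := by
  refine ⟨fun s _ => ((contDiff_tailProfile hχ).differentiable (by simp) s).hasDerivAt,
    fun s _ => ((contDiff_tailProfile₁ hχ).differentiable (by simp) s).hasDerivAt,
    fun s _ => ((contDiff_tailProfile₂ hχ).differentiable (by simp) s).hasDerivAt,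
    (contDiff_tailProfile₃ hχ).continuous.continuousOn, ?_⟩
  have hb : ∀ f : ℝ → ℝ, Continuous f → ∃ C, ∀ s ∈ Set.Icc (0 : ℝ) 5, |f s| ≤ C := fun f hf =>
    isCompact_Icc.exists_bound_of_continuousOn hf.continuousOn
  obtain ⟨B, hB⟩ := hb _ (contDiff_tailProfile hχ).continuous
  obtain ⟨B₁, hB₁⟩ := hb _ (contDiff_tailProfile₁ hχ).continuous
  obtain ⟨B₂, hB₂⟩ := hb _ (contDiff_tailProfile₂ hχ).continuous
  obtain ⟨B₃, hB₃⟩ := hb _ (contDiff_tailProfile₃ hχ).continuous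
  -- Compactness handles s ≤ 5. Beyond, the profiles are explicit multiples of powers of s^(-1/2) ≤
  -- 1 with coefficients at most 15/8 in absolute value, whence the 2.
  refine ⟨max (max B B₁) (max B₂ (max B₃ 2)), fun s hs => ?_⟩
  rcases le_or_gt s 5 with h | h
  · exact ⟨(hB s ⟨hs, h⟩).trans (by simp), (hB₁ s ⟨hs, h⟩).trans (by simp),
      (hB₂ s ⟨hs, h⟩).trans (by simp), (hB₃ s ⟨hs, h⟩).trans (by simp)⟩
  · obtain ⟨e1, e2, e3⟩ := tailProfile_derivs_of_four_lt hχ (by linarith : 4 < s)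
    have h0 := invSqrt_nonneg 0 s
    have h1 : invSqrt 0 s ≤ 1 := inv_le_one_of_one_le₀ (by
      rw [Real.one_le_sqrt]; linarith)
    have h3 := pow_le_one₀ h0 h1 (n := 3)
    have h5 := pow_le_one₀ h0 h1 (n := 5)
    have h7 := pow_le_one₀ h0 h1 (n := 7)
    have p3 := pow_nonneg h0 3
    have p5 := pow_nonneg h0 5
    have p7 := pow_nonneg h0 7
    have h2 : (2 : ℝ) ≤ max (max B B₁) (max B₂ (max B₃ 2)) := by simp
    rw [tailProfile_of_four_lt hχ (by linarith), e1, e2, e3]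
    refine ⟨?_, ?_, ?_, ?_⟩ <;> rw [abs_le] <;> constructor <;> linarith

/-- The profile of the annular part of `Δ div (χ x / |x|)`. -/
noncomputable def bilaplaceProfile (χ : ℝ → ℝ) (s : ℝ) : ℝ :=
  30 * tailProfile₁ χ s + 40 * s * tailProfile₂ χ s + 8 * s ^ 2 * tailProfile₃ χ s

/-- The profile of the radial part of the derivative of `(1 - χ) x / |x|`. -/
noncomputable def radialProfile (χ : ℝ → ℝ) (s : ℝ) : ℝ :=
  2 * s * tailProfile₁ χ s + tailProfile χ s

theorem contDiff_bilaplaceProfile (hχ : IsRadialCutoff χ) : ContDiff ℝ ∞ (bilaplaceProfile χ) :=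
  ((contDiff_const.mul (contDiff_tailProfile₁ hχ)).add
    ((contDiff_const.mul contDiff_id).mul (contDiff_tailProfile₂ hχ))).add
    ((contDiff_const.mul (contDiff_id.pow 2)).mul (contDiff_tailProfile₃ hχ))

theorem contDiff_radialProfile (hχ : IsRadialCutoff χ) : ContDiff ℝ ∞ (radialProfile χ) :=
  ((contDiff_const.mul contDiff_id).mul (contDiff_tailProfile₁ hχ)).add (contDiff_tailProfile hχ)

theorem eq_zero_of_le_of_continuous {f : ℝ → ℝ} (hf : Continuous f) {c : ℝ}
    (h : ∀ s < c, f s = 0) : ∀ s ≤ c, f s = 0 := fun s hs =>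
  closure_minimal (fun y hy => h y hy) (isClosed_singleton.preimage hf)
    (by simpa using hs : s ∈ closure (Set.Iio c))

theorem eq_zero_of_ge_of_continuous {f : ℝ → ℝ} (hf : Continuous f) {c : ℝ}
    (h : ∀ s, c < s → f s = 0) : ∀ s, c ≤ s → f s = 0 := fun s hs =>
  closure_minimal (fun y hy => h y hy) (isClosed_singleton.preimage hf)
    (by simpa using hs : s ∈ closure (Set.Ioi c))

theorem tailProfile₁_of_le_one (hχ : IsRadialCutoff χ) : ∀ s ≤ 1, tailProfile₁ χ s = 0 :=
  eq_zero_of_le_of_continuous (contDiff_tailProfile₁ hχ).continuous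
    fun _ hs => (tailProfile_derivs_of_lt_one hχ hs).1

theorem bilaplaceProfile_of_le_one (hχ : IsRadialCutoff χ) : ∀ s ≤ 1, bilaplaceProfile χ s = 0 :=
  eq_zero_of_le_of_continuous (contDiff_bilaplaceProfile hχ).continuous fun s hs => by
    obtain ⟨e1, e2, e3⟩ := tailProfile_derivs_of_lt_one hχ hs
    simp [bilaplaceProfile, e1, e2, e3]

theorem radialProfile_of_le_one (hχ : IsRadialCutoff χ) : ∀ s ≤ 1, radialProfile χ s = 0 :=
  eq_zero_of_le_of_continuous (contDiff_radialProfile hχ).continuous fun s hs => by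
    obtain ⟨e1, e2, e3⟩ := tailProfile_derivs_of_lt_one hχ hs
    simp [radialProfile, e1, tailProfile_of_le_one hχ hs.le]

/-- Beyond the cutoff the tail is the profile s^(-1/2) of z/|z| = ∇|z|, and |z| is biharmonic away
from the origin in dimension three: the coefficients −15 + 30 − 15 cancel. -/
theorem bilaplaceProfile_of_four_le (hχ : IsRadialCutoff χ) :
    ∀ s, 4 ≤ s → bilaplaceProfile χ s = 0 :=
  eq_zero_of_ge_of_continuous (contDiff_bilaplaceProfile hχ).continuous fun s hs => by
    obtain ⟨e1, e2, e3⟩ := tailProfile_derivs_of_four_lt hχ hs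
    have h := invSqrt_sq (s := s) (e := 0) (by linarith)
    rw [add_zero] at h
    rw [bilaplaceProfile, e1, e2, e3]
    linear_combination (15 * invSqrt 0 s ^ 3 - 15 * s * invSqrt 0 s ^ 5) * h

/-- For r > 0 the value at s = r² is the derivative of r · `tailProfile χ (r ^ 2)` = 1 − χ(r), that
is −χ'(r). -/
theorem radialProfile_of_four_le (hχ : IsRadialCutoff χ) :
    ∀ s, 4 ≤ s → radialProfile χ s = 0 :=
  eq_zero_of_ge_of_continuous (contDiff_radialProfile hχ).continuous fun s hs => by
    obtain ⟨e1, -, -⟩ := tailProfile_derivs_of_four_lt hχ hs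
    have h := invSqrt_sq (s := s) (e := 0) (by linarith)
    rw [add_zero] at h
    rw [radialProfile, e1, tailProfile_of_four_lt hχ hs]
    linear_combination (-invSqrt 0 s) * h

/-- The profile of the regularized Morawetz field. -/
noncomputable def regProfile (χ : ℝ → ℝ) (e s : ℝ) : ℝ := invSqrt e s - tailProfile χ s

noncomputable def regProfile₁ (χ : ℝ → ℝ) (e s : ℝ) : ℝ :=
  -(1 / 2) * invSqrt e s ^ 3 - tailProfile₁ χ s

noncomputable def regProfile₂ (χ : ℝ → ℝ) (e s : ℝ) : ℝ :=
  3 / 4 * invSqrt e s ^ 5 - tailProfile₂ χ s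

noncomputable def regProfile₃ (χ : ℝ → ℝ) (e s : ℝ) : ℝ :=
  -(15 / 8) * invSqrt e s ^ 7 - tailProfile₃ χ s

theorem isProfile_regProfile (hχ : IsRadialCutoff χ) {e : ℝ} (he : 0 < e) :
    IsProfile (regProfile χ e) (regProfile₁ χ e) (regProfile₂ χ e) (regProfile₃ χ e) :=
  (isProfile_invSqrt he).sub (isProfile_tailProfile hχ)

/-- With g = (s+e)^(-1/2), the contribution of `invSqrt e` is g⁷(−15(s+e)² + 30s(s+e) − 15s²), a
perfect square up to sign: −15e²g⁷. -/
theorem regProfile_bilaplace {e s : ℝ} (he : 0 < e) (hs : 0 ≤ s) :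
    30 * regProfile₁ χ e s + 40 * s * regProfile₂ χ e s + 8 * s ^ 2 * regProfile₃ χ e s =
      -(15 * e ^ 2 * invSqrt e s ^ 7) - bilaplaceProfile χ s := by
  have h := invSqrt_sq (s := s) (e := e) (by linarith)
  simp only [regProfile₁, regProfile₂, regProfile₃, bilaplaceProfile]
  linear_combination (15 * invSqrt e s ^ 3 - 15 * s * invSqrt e s ^ 5 +
    15 * e * invSqrt e s ^ 5) * h

/-- The derivative of the regularized Morawetz field is nonnegative up to a small error and an
annular radial term. -/
theorem regProfile_form_ge (hχ : IsRadialCutoff χ) {e s V Z : ℝ} (he : 0 < e) (hs : 0 ≤ s)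
    (hV : 0 ≤ V) (hZ : 0 ≤ Z) (hZV : Z ≤ s * V) :
    -(√e * V) - |radialProfile χ s| * (s⁻¹ * Z) ≤
      regProfile χ e s * V + 2 * regProfile₁ χ e s * Z := by
  have hg := invSqrt_sq (s := s) (e := e) (by linarith)
  have hg0 := invSqrt_nonneg e s
  rcases le_or_gt s 1 with h1 | h1
  · rw [regProfile, regProfile₁, tailProfile₁_of_le_one hχ s h1, tailProfile_of_le_one hχ h1,
      radialProfile_of_le_one hχ s h1, abs_zero, zero_mul, sub_zero, sub_zero, sub_zero]
    -- Inside the unit ball no cutoff is felt, and the derivative of z/√(|z|²+e) is a positive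
    -- multiple of (s+e) Id − z⊗z; hence no loss here.
    have e1 : invSqrt e s * V + 2 * (-(1 / 2) * invSqrt e s ^ 3) * Z =
        invSqrt e s ^ 3 * ((s + e) * V - Z) := by linear_combination (-invSqrt e s * V) * hg
    rw [e1]
    have : 0 ≤ invSqrt e s ^ 3 * ((s + e) * V - Z) := by
      apply mul_nonneg (pow_nonneg hg0 3)
      nlinarith [mul_nonneg he.le hV]
    linarith [mul_nonneg (Real.sqrt_nonneg e) hV]
  · have hs0 : 0 < s := by linarith
    have hσ := invSqrt_sq (s := s) (e := 0) (by linarith)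
    rw [add_zero] at hσ
    have hσ0 := invSqrt_nonneg 0 s
    have hgσ := invSqrt_anti he.le hs0
    have hσ1 : invSqrt 0 s ≤ 1 := inv_le_one_of_one_le₀ (by
      rw [Real.one_le_sqrt]; linarith)
    have hg1 : invSqrt e s ≤ 1 := hgσ.trans hσ1
    have hdiff : invSqrt 0 s - invSqrt e s ≤ √e := by
      have hpos : 0 < √(s + e) := Real.sqrt_pos.2 (by linarith)
      have hpos' : 0 < √s := Real.sqrt_pos.2 hs0
      have e1 : invSqrt 0 s - invSqrt e s = (√(s + e) - √s) * (invSqrt 0 s * invSqrt e s) := by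
        simp only [invSqrt, add_zero]; field_simp
      have e2 : √(s + e) ≤ √s + √e := by
        rw [Real.sqrt_le_left (by positivity)]
        nlinarith [Real.sq_sqrt hs, Real.sq_sqrt he.le, mul_nonneg hpos'.le (Real.sqrt_nonneg e)]
      have e3 : √s ≤ √(s + e) := Real.sqrt_le_sqrt (by linarith)
      have e4 : invSqrt 0 s * invSqrt e s ≤ 1 := mul_le_one₀ hσ1 hg0 hg1
      rw [e1]
      nlinarith [mul_nonneg hσ0 hg0]
    have hκ : tailProfile χ s = (1 - χ √s) * invSqrt 0 s := by
      rw [tailProfile, invSqrt, add_zero]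
    have hχ0 := hχ.nonneg _ (Real.sqrt_nonneg s)
    have hinv : s⁻¹ = invSqrt 0 s ^ 2 := by
      rw [inv_eq_iff_eq_inv, eq_comm, inv_eq_iff_eq_inv, eq_comm, ← one_div, div_eq_iff hs0.ne']
      linarith
    have hκ1 : 2 * tailProfile₁ χ s = (radialProfile χ s - tailProfile χ s) * invSqrt 0 s ^ 2 := by
      rw [radialProfile]; linear_combination (-2 * tailProfile₁ χ s) * hσ
    have hbr : 0 ≤ V - invSqrt 0 s ^ 2 * Z := by
      rw [← hinv, sub_nonneg, inv_mul_le_iff₀ hs0]; exact hZV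
    have hcube : invSqrt e s ^ 3 ≤ invSqrt 0 s ^ 3 := pow_le_pow_left₀ hg0 hgσ 3
    -- Four pieces: the regularization error in the trace, of size at most √e; a nonnegative gain
    -- from replacing s^(-3/2) by its regularization; the angular part with coefficient χ(r)/r ≥ 0;
    -- and the radial part with coefficient χ'(r), which has no sign.
    have key : regProfile χ e s * V + 2 * regProfile₁ χ e s * Z =
        -((invSqrt 0 s - invSqrt e s) * V) + (invSqrt 0 s ^ 3 - invSqrt e s ^ 3) * Z
        + χ √s * invSqrt 0 s * (V - invSqrt 0 s ^ 2 * Z)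
        - radialProfile χ s * (invSqrt 0 s ^ 2 * Z) := by
      rw [regProfile, regProfile₁]
      linear_combination (-Z) * hκ1 + (-V + invSqrt 0 s ^ 2 * Z) * hκ
    rw [key, hinv]
    have t1 : (invSqrt 0 s - invSqrt e s) * V ≤ √e * V := mul_le_mul_of_nonneg_right hdiff hV
    have t2 : 0 ≤ (invSqrt 0 s ^ 3 - invSqrt e s ^ 3) * Z := mul_nonneg (by linarith) hZ
    have t3 : 0 ≤ χ √s * invSqrt 0 s * (V - invSqrt 0 s ^ 2 * Z) :=
      mul_nonneg (mul_nonneg hχ0 hσ0) hbr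
    have t4 : radialProfile χ s * (invSqrt 0 s ^ 2 * Z) ≤
        |radialProfile χ s| * (invSqrt 0 s ^ 2 * Z) :=
      mul_le_mul_of_nonneg_right (le_abs_self _) (by positivity)
    linarith

end Profiles

/-! ### Bilinear pairings with translation-invariant kernels and integration by parts. -/

section Pairing

/-- Rapidly decreasing continuous functions on `ℝ³`. -/
def IsRapid (f : Space → ℝ) : Prop := RapidFamily fun _ : Unit => f

/-- Schwartz functions on `ℝ³`. -/
def IsSchwartz (f : Space → ℝ) : Prop := SchwartzFamily fun _ : Unit => f

theorem IsSchwartz.isRapid {f : Space → ℝ} (hf : IsSchwartz f) : IsRapid f :=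
  SchwartzFamily.rapid hf

theorem IsSchwartz.contDiff {f : Space → ℝ} (hf : IsSchwartz f) : ContDiff ℝ ∞ f :=
  SchwartzFamily.contDiff hf ()

theorem IsSchwartz.pd {f : Space → ℝ} (hf : IsSchwartz f) (j : Fin 3) : IsSchwartz (pd j f) :=
  SchwartzFamily.pd hf j

theorem IsSchwartz.add {f g : Space → ℝ} (hf : IsSchwartz f) (hg : IsSchwartz g) :
    IsSchwartz fun x => f x + g x :=
  SchwartzFamily.add hf hg

theorem IsSchwartz.sub {f g : Space → ℝ} (hf : IsSchwartz f) (hg : IsSchwartz g) :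
    IsSchwartz fun x => f x - g x :=
  SchwartzFamily.sub hf hg

theorem IsSchwartz.mul {f g : Space → ℝ} (hf : IsSchwartz f) (hg : IsSchwartz g) :
    IsSchwartz fun x => f x * g x :=
  SchwartzFamily.mul hf hg

theorem IsSchwartz.const_mul {f : Space → ℝ} (hf : IsSchwartz f) (c : ℝ) :
    IsSchwartz fun x => c * f x :=
  SchwartzFamily.const_mul hf c

theorem IsSchwartz.sum3 {f : Fin 3 → Space → ℝ} (hf : ∀ k, IsSchwartz (f k)) :
    IsSchwartz fun x => ∑ k, f k x :=
  SchwartzFamily.sum3 (f := fun k _ => f k) hf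

theorem IsRapid.continuous {f : Space → ℝ} (hf : IsRapid f) : Continuous f :=
  (RapidFamily.continuous hf).comp (Continuous.prodMk_right ())

theorem IsRapid.bound {f : Space → ℝ} (hf : IsRapid f) (k : ℕ) :
    ∃ C : ℝ, 0 ≤ C ∧ ∀ x, |f x| ≤ C * ((1 + ‖x‖) ^ k)⁻¹ := by
  obtain ⟨C, h0, hC⟩ := RapidFamily.bound hf k
  exact ⟨C, h0, hC ()⟩

/-- Four is the first integer exponent above the dimension three. -/
theorem integrable_inv_one_add_norm_pow_four :
    Integrable fun x : Space => ((1 + ‖x‖) ^ 4)⁻¹ := by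
  have h := integrable_one_add_norm (E := Space) (μ := volume) (r := 4) (by
    rw [finrank_euclideanSpace_fin]; norm_num)
  refine h.congr (Filter.Eventually.of_forall fun x => ?_)
  dsimp only
  rw [Real.rpow_neg (by positivity)]
  norm_cast

theorem IsRapid.integrable {f : Space → ℝ} (hf : IsRapid f) : Integrable f := by
  obtain ⟨C, -, hC⟩ := hf.bound 4
  exact (integrable_inv_one_add_norm_pow_four.const_mul C).mono'
    hf.continuous.aestronglyMeasurable (Filter.Eventually.of_forall hC)

/-- A measurable kernel of at most polynomial growth. -/
structure IsKernel (K : Space → ℝ) : Prop where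
  measurable : Measurable K
  growth : ∃ (C : ℝ) (m : ℕ), 0 ≤ C ∧ ∀ z, |K z| ≤ C * (1 + ‖z‖) ^ m

theorem IsKernel.of_bounded {K : Space → ℝ} (hK : Measurable K) {C : ℝ} (h : ∀ z, |K z| ≤ C) :
    IsKernel K :=
  ⟨hK, C, 0, (abs_nonneg _).trans (h 0), by simpa using h⟩

theorem IsKernel.add {K L : Space → ℝ} (hK : IsKernel K) (hL : IsKernel L) :
    IsKernel fun z => K z + L z := by
  refine ⟨hK.1.add hL.1, ?_⟩
  obtain ⟨C, m, hC, h⟩ := hK.2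
  obtain ⟨D, n, hD, h'⟩ := hL.2
  refine ⟨C + D, m + n, by positivity, fun z => ?_⟩
  have h1 : (1 : ℝ) ≤ 1 + ‖z‖ := by linarith [norm_nonneg z]
  calc |K z + L z| ≤ C * (1 + ‖z‖) ^ m + D * (1 + ‖z‖) ^ n :=
        (abs_add_le _ _).trans (add_le_add (h z) (h' z))
    _ ≤ C * (1 + ‖z‖) ^ (m + n) + D * (1 + ‖z‖) ^ (m + n) := by
        gcongr
        exacts [Nat.le_add_right _ _, Nat.le_add_left _ _]
    _ = _ := by ring

theorem IsKernel.mul {K L : Space → ℝ} (hK : IsKernel K) (hL : IsKernel L) :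
    IsKernel fun z => K z * L z := by
  refine ⟨hK.1.mul hL.1, ?_⟩
  obtain ⟨C, m, hC, h⟩ := hK.2
  obtain ⟨D, n, hD, h'⟩ := hL.2
  refine ⟨C * D, m + n, by positivity, fun z => ?_⟩
  rw [abs_mul, pow_add, mul_mul_mul_comm]
  exact mul_le_mul (h z) (h' z) (abs_nonneg _) (by positivity)

theorem IsKernel.const (c : ℝ) : IsKernel fun _ => c :=
  IsKernel.of_bounded measurable_const fun _ => le_rfl

theorem IsKernel.coord (j : Fin 3) : IsKernel fun z => z j := by
  refine ⟨by fun_prop, 1, 1, zero_le_one, fun z => ?_⟩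
  have := PiLp.norm_apply_le z j
  rw [Real.norm_eq_abs] at this
  linarith

theorem IsKernel.sum3 {K : Fin 3 → Space → ℝ} (hK : ∀ k, IsKernel (K k)) :
    IsKernel fun z => ∑ k, K k z := by
  simpa [Fin.sum_univ_three] using ((hK 0).add (hK 1)).add (hK 2)

theorem IsKernel.comp_neg {K : Space → ℝ} (hK : IsKernel K) : IsKernel fun z => K (-z) := by
  refine ⟨hK.1.comp measurable_neg, ?_⟩
  obtain ⟨C, m, hC, h⟩ := hK.2
  exact ⟨C, m, hC, fun z => by simpa using h (-z)⟩

/-- From 1 + ‖x − y‖ ≤ (1 + ‖x‖)(1 + ‖y‖): polynomial growth in the difference splits into growth in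
each variable, which rapid decay absorbs. -/
theorem IsKernel.bound_sub {K : Space → ℝ} (hK : IsKernel K) :
    ∃ (C : ℝ) (m : ℕ), 0 ≤ C ∧ ∀ x y, |K (x - y)| ≤ C * ((1 + ‖y‖) ^ m * (1 + ‖x‖) ^ m) := by
  obtain ⟨C, m, hC, h⟩ := hK.2
  refine ⟨C, m, hC, fun x y => (h _).trans ?_⟩
  rw [← mul_pow]
  gcongr
  nlinarith [norm_sub_le x y, norm_nonneg x, norm_nonneg y]

/-- Of the m + 4 orders of decay, m cancel the growth of the kernel and 4 remain for integrability
on ℝ³. -/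
theorem abs_kernel_mul_le {C D E : ℝ} (hD : 0 ≤ D) {m : ℕ}
    {k u v r s : ℝ} (hr : 0 < r) (hs : 0 < s) (hk : |k| ≤ C * (r ^ m * s ^ m))
    (hu : |u| ≤ D * (r ^ (m + 4))⁻¹) (hv : |v| ≤ E * (s ^ (m + 4))⁻¹) :
    |k * (u * v)| ≤ C * D * E * ((r ^ 4)⁻¹ * (s ^ 4)⁻¹) := by
  rw [abs_mul, abs_mul]
  calc |k| * (|u| * |v|) ≤ (C * (r ^ m * s ^ m)) * ((D * (r ^ (m + 4))⁻¹) * (E * (s ^ (m + 4))⁻¹)) :=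
        mul_le_mul hk (mul_le_mul hu hv (abs_nonneg _) (by positivity)) (by positivity)
          ((abs_nonneg _).trans hk)
    _ = _ := by
        rw [pow_add, pow_add]
        field_simp

theorem integrable_kernel_pairing {K f g : Space → ℝ} (hK : IsKernel K) (hf : IsRapid f)
    (hg : IsRapid g) :
    Integrable fun p : Space × Space => K (p.2 - p.1) * (f p.1 * g p.2) := by
  obtain ⟨C, m, hC0, hC⟩ := hK.bound_sub
  obtain ⟨D, hD0, hD⟩ := hf.bound (m + 4)
  obtain ⟨E, hE0, hE⟩ := hg.bound (m + 4)
  refine ((integrable_inv_one_add_norm_pow_four.mul_prod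
    integrable_inv_one_add_norm_pow_four).const_mul (C * D * E)).mono' ?_ ?_
  · refine Measurable.aestronglyMeasurable ?_
    have h1 := hK.measurable.comp (measurable_snd.sub measurable_fst : Measurable
      fun p : Space × Space => p.2 - p.1)
    exact h1.mul ((hf.continuous.measurable.comp measurable_fst).mul
      (hg.continuous.measurable.comp measurable_snd))
  · refine Filter.Eventually.of_forall fun p => ?_
    exact abs_kernel_mul_le hD0 (by positivity) (by positivity) (hC p.2 p.1) (hD p.1) (hE p.2)

theorem integrable_kernel_mul {K g : Space → ℝ} (hK : IsKernel K) (hg : IsRapid g) (y : Space) :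
    Integrable fun x => K (x - y) * g x := by
  obtain ⟨C, m, hC0, hC⟩ := hK.bound_sub
  obtain ⟨E, hE0, hE⟩ := hg.bound (m + 4)
  refine (integrable_inv_one_add_norm_pow_four.const_mul
    (C * (1 + ‖y‖) ^ m * E)).mono' ?_ (Filter.Eventually.of_forall fun x => ?_)
  · exact ((hK.measurable.comp (measurable_id.sub_const y)).mul
      hg.continuous.measurable).aestronglyMeasurable
  · rw [Real.norm_eq_abs, abs_mul]
    calc |K (x - y)| * |g x|
        ≤ (C * ((1 + ‖y‖) ^ m * (1 + ‖x‖) ^ m)) * (E * ((1 + ‖x‖) ^ (m + 4))⁻¹) :=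
          mul_le_mul (hC x y) (hE x) (abs_nonneg _) (by positivity)
      _ = _ := by rw [pow_add]; field_simp

/-- The bilinear pairing `∫∫ K (x - y) f (y) g (x) dx dy`. -/
noncomputable def pairing (K f g : Space → ℝ) : ℝ :=
  ∫ p : Space × Space, K (p.2 - p.1) * (f p.1 * g p.2)

theorem pairing_add_left {K f f' g : Space → ℝ} (hK : IsKernel K) (hf : IsRapid f)
    (hf' : IsRapid f') (hg : IsRapid g) :
    pairing K (fun x => f x + f' x) g = pairing K f g + pairing K f' g := by
  rw [pairing, pairing, pairing, ← integral_add (integrable_kernel_pairing hK hf hg)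
    (integrable_kernel_pairing hK hf' hg)]
  congr 1; funext p; ring

theorem pairing_add_right {K f g g' : Space → ℝ} (hK : IsKernel K) (hf : IsRapid f)
    (hg : IsRapid g) (hg' : IsRapid g') :
    pairing K f (fun x => g x + g' x) = pairing K f g + pairing K f g' := by
  rw [pairing, pairing, pairing, ← integral_add (integrable_kernel_pairing hK hf hg)
    (integrable_kernel_pairing hK hf hg')]
  congr 1; funext p; ring

theorem pairing_const_left (K f g : Space → ℝ) (c : ℝ) :
    pairing K (fun x => c * f x) g = c * pairing K f g := by
  rw [pairing, pairing, ← integral_const_mul]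
  congr 1; funext p; ring

theorem pairing_const_right (K f g : Space → ℝ) (c : ℝ) :
    pairing K f (fun x => c * g x) = c * pairing K f g := by
  rw [pairing, pairing, ← integral_const_mul]
  congr 1; funext p; ring

theorem pairing_sum_left {K g : Space → ℝ} {f : Fin 3 → Space → ℝ} (hK : IsKernel K)
    (hf : ∀ k, IsRapid (f k)) (hg : IsRapid g) :
    pairing K (fun x => ∑ k, f k x) g = ∑ k, pairing K (f k) g := by
  simp only [pairing]
  rw [← integral_finsetSum _ fun k _ => integrable_kernel_pairing hK (hf k) hg]
  congr 1; funext p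
  rw [Finset.sum_mul, Finset.mul_sum]

theorem pairing_sum_right {K f : Space → ℝ} {g : Fin 3 → Space → ℝ} (hK : IsKernel K)
    (hf : IsRapid f) (hg : ∀ k, IsRapid (g k)) :
    pairing K f (fun x => ∑ k, g k x) = ∑ k, pairing K f (g k) := by
  simp only [pairing]
  rw [← integral_finsetSum _ fun k _ => integrable_kernel_pairing hK hf (hg k)]
  congr 1; funext p
  rw [Finset.mul_sum, Finset.mul_sum]

theorem pairing_sum_kernel {f g : Space → ℝ} {K : Fin 3 → Space → ℝ} (hK : ∀ k, IsKernel (K k))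
    (hf : IsRapid f) (hg : IsRapid g) :
    pairing (fun z => ∑ k, K k z) f g = ∑ k, pairing (K k) f g := by
  simp only [pairing]
  rw [← integral_finsetSum _ fun k _ => integrable_kernel_pairing (hK k) hf hg]
  congr 1; funext p
  rw [Finset.sum_mul]

theorem pairing_swap (K f g : Space → ℝ) : pairing K f g = pairing (fun z => K (-z)) g f := by
  rw [pairing, pairing, Measure.volume_eq_prod, ← integral_prod_swap]
  congr 1; funext p
  simp only [Prod.fst_swap, Prod.snd_swap, neg_sub]
  ring

/-- `K'` is the partial derivative in the direction `j` of the kernel `K`. -/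
structure HasKernelDeriv (j : Fin 3) (K K' : Space → ℝ) : Prop where
  differentiable : Differentiable ℝ K
  pd_eq : ∀ z, pd j K z = K' z
  kernel : IsKernel K
  kernel_deriv : IsKernel K'

theorem integral_kernel_mul_pd {K K' g : Space → ℝ} {j : Fin 3} (hK : HasKernelDeriv j K K')
    (hg : IsSchwartz g) (y : Space) :
    ∫ x, K (x - y) * pd j g x = - ∫ x, K' (x - y) * g x := by
  have e : ∀ x, fderiv ℝ (fun x => K (x - y)) x (EuclideanSpace.single j 1) = K' (x - y) := by
    intro x
    rw [fderiv_comp_sub]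
    exact hK.pd_eq _
  have h := integral_mul_fderiv_eq_neg_fderiv_mul_of_integrable (μ := (volume : Measure Space))
    (f := fun x => K (x - y)) (g := g) (v := EuclideanSpace.single j (1 : ℝ)) ?_ ?_ ?_ ?_ ?_
  · simp only [e] at h
    exact h
  · simpa only [e] using integrable_kernel_mul hK.kernel_deriv hg.isRapid y
  · exact integrable_kernel_mul hK.kernel (hg.pd j).isRapid y
  · exact integrable_kernel_mul hK.kernel hg.isRapid y
  · exact fun x _ => (hK.differentiable _).comp x (differentiableAt_id.sub_const y)
  · exact fun x _ => hg.contDiff.differentiable (by simp) x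

/-- Fubini reduces to integration by parts in x alone. In the left slot, `pairing_pd_left`, the sign
is opposite: the kernel depends on x − y, so differentiating it in y produces a second minus. -/
theorem pairing_pd_right {K K' f g : Space → ℝ} {j : Fin 3} (hK : HasKernelDeriv j K K')
    (hf : IsRapid f) (hg : IsSchwartz g) : pairing K f (pd j g) = - pairing K' f g := by
  rw [pairing, pairing, Measure.volume_eq_prod,
    integral_prod _ (integrable_kernel_pairing hK.kernel hf (hg.pd j).isRapid),
    integral_prod _ (integrable_kernel_pairing hK.kernel_deriv hf hg.isRapid), ← integral_neg]
  congr 1; funext y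
  have h := integral_kernel_mul_pd hK hg y
  calc ∫ x, K (x - y) * (f y * pd j g x) = f y * ∫ x, K (x - y) * pd j g x := by
        rw [← integral_const_mul]; congr 1; funext x; ring
    _ = - (f y * ∫ x, K' (x - y) * g x) := by rw [h]; ring
    _ = - ∫ x, K' (x - y) * (f y * g x) := by
        rw [← integral_const_mul]; congr 2; funext x; ring

theorem HasKernelDeriv.comp_neg {K K' : Space → ℝ} {j : Fin 3} (hK : HasKernelDeriv j K K') :
    HasKernelDeriv j (fun z => K (-z)) fun z => -1 * K' (-z) := by
  refine ⟨hK.1.comp (differentiable_id.neg), fun z => ?_, hK.3.comp_neg,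
    (IsKernel.const (-1)).mul hK.4.comp_neg⟩
  have h1 := (hK.1 (-z)).hasFDerivAt.comp z (hasFDerivAt_id z).neg
  rw [← hK.pd_eq, pd, pd]
  change fderiv ℝ (K ∘ fun z => -z) z _ = _
  erw [h1.fderiv]
  simp

theorem pairing_pd_left {K K' f g : Space → ℝ} {j : Fin 3} (hK : HasKernelDeriv j K K')
    (hf : IsSchwartz f) (hg : IsRapid g) : pairing K (pd j f) g = pairing K' f g := by
  rw [pairing_swap, pairing_pd_right hK.comp_neg hg hf, pairing_swap K', pairing, pairing,
    ← integral_neg]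
  congr 1; funext p; ring

end Pairing

/-! ### Derivatives of radial vector fields h(|z|²) z. -/

section RadialKernels

theorem norm_sq_eq_sum (z : Space) : ‖z‖ ^ 2 = ∑ j, z j * z j := by
  rw [EuclideanSpace.norm_sq_eq]
  exact Finset.sum_congr rfl fun j _ => by rw [Real.norm_eq_abs, sq_abs, sq]

theorem hasFDerivAt_comp_norm_sq {g : ℝ → ℝ} {g' : ℝ} {z : Space}
    (hg : HasDerivAt g g' (‖z‖ ^ 2)) :
    HasFDerivAt (fun z : Space => g (‖z‖ ^ 2)) (g' • (2 • innerSL ℝ z)) z :=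
  hg.comp_hasFDerivAt z (hasStrictFDerivAt_norm_sq z).hasFDerivAt

theorem pd_comp_norm_sq {g : ℝ → ℝ} {g' : ℝ} {z : Space} (hg : HasDerivAt g g' (‖z‖ ^ 2))
    (j : Fin 3) : pd j (fun z : Space => g (‖z‖ ^ 2)) z = 2 * z j * g' := by
  rw [pd, (hasFDerivAt_comp_norm_sq hg).fderiv]
  simp [EuclideanSpace.inner_single_right]
  ring

theorem hasFDerivAt_coord (j : Fin 3) (z : Space) :
    HasFDerivAt (fun z : Space => z j) (EuclideanSpace.proj j : Space →L[ℝ] ℝ) z :=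
  (EuclideanSpace.proj j : Space →L[ℝ] ℝ).hasFDerivAt

theorem hasFDerivAt_comp_norm_sq_mul_coord {g : ℝ → ℝ} {g' : ℝ} {z : Space}
    (hg : HasDerivAt g g' (‖z‖ ^ 2)) (j : Fin 3) :
    HasFDerivAt (fun z : Space => g (‖z‖ ^ 2) * z j)
      (g (‖z‖ ^ 2) • (EuclideanSpace.proj j : Space →L[ℝ] ℝ) + z j • (g' • (2 • innerSL ℝ z))) z :=
  (hasFDerivAt_comp_norm_sq hg).mul (hasFDerivAt_coord j z)

theorem pd_comp_norm_sq_mul_coord {g : ℝ → ℝ} {g' : ℝ} {z : Space}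
    (hg : HasDerivAt g g' (‖z‖ ^ 2)) (j k : Fin 3) :
    pd k (fun z : Space => g (‖z‖ ^ 2) * z j) z =
      g (‖z‖ ^ 2) * (if j = k then 1 else 0) + 2 * g' * (z j * z k) := by
  rw [pd, (hasFDerivAt_comp_norm_sq_mul_coord hg j).fderiv]
  simp [EuclideanSpace.inner_single_right]
  ring

theorem isKernel_comp_norm_sq {g : ℝ → ℝ} (hg : ContinuousOn g (Set.Ici 0)) {B : ℝ}
    (hB : ∀ s, 0 ≤ s → |g s| ≤ B) : IsKernel fun z => g (‖z‖ ^ 2) :=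
  IsKernel.of_bounded (hg.comp_continuous (by fun_prop) fun z => sq_nonneg ‖z‖).measurable
    fun z => hB _ (sq_nonneg ‖z‖)

variable {h h₁ h₂ h₃ : ℝ → ℝ}

theorem IsProfile.isKernel (hh : IsProfile h h₁ h₂ h₃) :
    (IsKernel fun z => h (‖z‖ ^ 2)) ∧ (IsKernel fun z => h₁ (‖z‖ ^ 2)) ∧
      (IsKernel fun z => h₂ (‖z‖ ^ 2)) ∧ IsKernel fun z => h₃ (‖z‖ ^ 2) := by
  obtain ⟨B, hB⟩ := hh.bounded
  exact ⟨isKernel_comp_norm_sq (fun s hs => (hh.1 s hs).continuousAt.continuousWithinAt)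
      fun s hs => (hB s hs).1,
    isKernel_comp_norm_sq (fun s hs => (hh.2 s hs).continuousAt.continuousWithinAt)
      fun s hs => (hB s hs).2.1,
    isKernel_comp_norm_sq (fun s hs => (hh.3 s hs).continuousAt.continuousWithinAt)
      fun s hs => (hB s hs).2.2.1,
    isKernel_comp_norm_sq hh.4 fun s hs => (hB s hs).2.2.2⟩

/-- The derivative `∂ₖ (h(|z|²) zⱼ)` of a radial field. -/
noncomputable def fieldDeriv (h h₁ : ℝ → ℝ) (j k : Fin 3) (z : Space) : ℝ :=
  h (‖z‖ ^ 2) * (if j = k then 1 else 0) + 2 * h₁ (‖z‖ ^ 2) * (z j * z k)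

theorem fieldDeriv_neg (h h₁ : ℝ → ℝ) (j k : Fin 3) (z : Space) :
    fieldDeriv h h₁ j k (-z) = fieldDeriv h h₁ j k z := by
  simp [fieldDeriv]

theorem IsProfile.hasKernelDeriv_field (hh : IsProfile h h₁ h₂ h₃) (j k : Fin 3) :
    HasKernelDeriv k (fun z => h (‖z‖ ^ 2) * z j) (fieldDeriv h h₁ j k) := by
  obtain ⟨k0, k1, -, -⟩ := hh.isKernel
  refine ⟨fun z => (hasFDerivAt_comp_norm_sq_mul_coord
      (hh.deriv_zero _ (sq_nonneg ‖z‖)) j).differentiableAt,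
    fun z => pd_comp_norm_sq_mul_coord (hh.deriv_zero _ (sq_nonneg ‖z‖)) j k,
    k0.mul (IsKernel.coord j), ?_⟩
  exact (k0.mul (IsKernel.const _)).add
    (((IsKernel.const 2).mul k1).mul ((IsKernel.coord j).mul (IsKernel.coord k)))

/-- Profile of the divergence of the field `h(|z|²) z`. -/
noncomputable def divProfile (h h₁ : ℝ → ℝ) (s : ℝ) : ℝ := 3 * h s + 2 * s * h₁ s

noncomputable def divProfile₁ (h₁ h₂ : ℝ → ℝ) (s : ℝ) : ℝ := 5 * h₁ s + 2 * s * h₂ s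

noncomputable def divProfile₂ (h₂ h₃ : ℝ → ℝ) (s : ℝ) : ℝ := 7 * h₂ s + 2 * s * h₃ s

theorem sum_fieldDeriv_self (h h₁ : ℝ → ℝ) (z : Space) :
    ∑ j, fieldDeriv h h₁ j j z = divProfile h h₁ (‖z‖ ^ 2) := by
  have e := norm_sq_eq_sum z
  rw [Fin.sum_univ_three] at e
  simp only [fieldDeriv, divProfile, Fin.sum_univ_three, if_true]
  linear_combination (-2 * h₁ (‖z‖ ^ 2)) * e

theorem IsKernel.norm_sq : IsKernel fun z => ‖z‖ ^ 2 := by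
  simp only [norm_sq_eq_sum]
  exact IsKernel.sum3 fun k => (IsKernel.coord k).mul (IsKernel.coord k)

theorem IsProfile.hasKernelDeriv_div (hh : IsProfile h h₁ h₂ h₃) (k : Fin 3) :
    HasKernelDeriv k (fun z => divProfile h h₁ (‖z‖ ^ 2))
      (fun z => 2 * (divProfile₁ h₁ h₂ (‖z‖ ^ 2) * z k)) := by
  obtain ⟨k0, k1, k2, -⟩ := hh.isKernel
  have hd : ∀ s, 0 ≤ s → HasDerivAt (divProfile h h₁) (divProfile₁ h₁ h₂ s) s := fun s hs => by
    refine (((hh.1 s hs).const_mul 3).add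
      (((hasDerivAt_id s).const_mul 2).mul (hh.2 s hs))).congr_deriv ?_
    simp only [divProfile₁, id]; ring
  refine ⟨fun z => (hasFDerivAt_comp_norm_sq (hd _ (sq_nonneg ‖z‖))).differentiableAt,
    fun z => ?_, ?_, ?_⟩
  · rw [pd_comp_norm_sq (hd _ (sq_nonneg ‖z‖))]; ring
  · exact ((IsKernel.const 3).mul k0).add (((IsKernel.const 2).mul IsKernel.norm_sq).mul k1)
  · exact (IsKernel.const 2).mul ((((IsKernel.const 5).mul k1).add
      (((IsKernel.const 2).mul IsKernel.norm_sq).mul k2)).mul (IsKernel.coord k))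

/-- The second derivative `∂ₖ ∂ₖ` of the divergence of the field `h(|z|²) z`. -/
noncomputable def divDeriv₂ (h₁ h₂ h₃ : ℝ → ℝ) (k : Fin 3) (z : Space) : ℝ :=
  2 * fieldDeriv (divProfile₁ h₁ h₂) (divProfile₂ h₂ h₃) k k z

theorem IsProfile.hasKernelDeriv_div₂ (hh : IsProfile h h₁ h₂ h₃) (k : Fin 3) :
    HasKernelDeriv k (fun z => 2 * (divProfile₁ h₁ h₂ (‖z‖ ^ 2) * z k))
      (divDeriv₂ h₁ h₂ h₃ k) := by
  obtain ⟨k0, k1, k2, k3⟩ := hh.isKernel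
  have hd : ∀ s, 0 ≤ s → HasDerivAt (divProfile₁ h₁ h₂) (divProfile₂ h₂ h₃ s) s := fun s hs => by
    refine (((hh.2 s hs).const_mul 5).add
      (((hasDerivAt_id s).const_mul 2).mul (hh.3 s hs))).congr_deriv ?_
    simp only [divProfile₂, id]; ring
  have hD : ∀ z : Space, DifferentiableAt ℝ (fun z : Space => divProfile₁ h₁ h₂ (‖z‖ ^ 2) * z k) z :=
    fun z => (hasFDerivAt_comp_norm_sq_mul_coord (hd _ (sq_nonneg ‖z‖)) k).differentiableAt
  refine ⟨fun z => (hD z).const_mul 2, fun z => ?_, (hh.hasKernelDeriv_div k).kernel_deriv, ?_⟩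
  · have e := pd_comp_norm_sq_mul_coord (hd _ (sq_nonneg ‖z‖)) k k
    rw [pd] at e ⊢
    rw [fderiv_const_mul (hD z)]
    simp only [smul_apply, smul_eq_mul]
    rw [e, divDeriv₂, fieldDeriv]
  · exact (IsKernel.const 2).mul (((((IsKernel.const 5).mul k1).add
      (((IsKernel.const 2).mul IsKernel.norm_sq).mul k2)).mul (IsKernel.const _)).add
      (((IsKernel.const 2).mul (((IsKernel.const 7).mul k2).add
      (((IsKernel.const 2).mul IsKernel.norm_sq).mul k3))).mul
        ((IsKernel.coord k).mul (IsKernel.coord k))))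

/-- The gradient of the divergence is again a radial field, 2 · `divProfile₁`(|z|²) z, so Δ div is
obtained by applying the divergence formula a second time. -/
theorem sum_divDeriv₂ (h₁ h₂ h₃ : ℝ → ℝ) (z : Space) :
    ∑ k, divDeriv₂ h₁ h₂ h₃ k z = 30 * h₁ (‖z‖ ^ 2) + 40 * ‖z‖ ^ 2 * h₂ (‖z‖ ^ 2)
      + 8 * (‖z‖ ^ 2) ^ 2 * h₃ (‖z‖ ^ 2) := by
  simp only [divDeriv₂]
  rw [← Finset.mul_sum, sum_fieldDeriv_self]
  simp only [divProfile, divProfile₁, divProfile₂]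
  ring

end RadialKernels

/-! ### Densities, brackets and local conservation laws in real and imaginary parts. -/

section LocalIdentities

theorem pd_sub {f g : Space → ℝ} (hf : ContDiff ℝ ∞ f) (hg : ContDiff ℝ ∞ g) (j : Fin 3) :
    pd j (fun x => f x - g x) = fun x => pd j f x - pd j g x := by
  funext x
  have h1 := hf.differentiable (by simp) x
  have h2 := hg.differentiable (by simp) x
  simp [pd, fderiv_fun_sub h1 h2]

theorem pd_sum3 {f : Fin 3 → Space → ℝ} (hf : ∀ k, ContDiff ℝ ∞ (f k)) (j : Fin 3) :
    pd j (fun x => ∑ k, f k x) = fun x => ∑ k, pd j (f k) x := by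
  simp only [Fin.sum_univ_three]
  rw [pd_add ((hf 0).add (hf 1)) (hf 2), pd_add (hf 0) (hf 1)]

/-- The mass density `|u|²` of `u = p + i q`. -/
noncomputable def dens (p q : Space → ℝ) (x : Space) : ℝ := p x * p x + q x * q x

/-- The momentum density `2 Im (ū ∂ⱼ u)` of `u = p + i q`. -/
noncomputable def mom (p q : Space → ℝ) (j : Fin 3) (x : Space) : ℝ :=
  2 * (p x * pd j q x - q x * pd j p x)

/-- The stress `Re (∂ⱼ u ∂ₖ ū)` of `u = p + i q`. -/
noncomputable def stress (p q : Space → ℝ) (j k : Fin 3) (x : Space) : ℝ :=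
  pd j p x * pd k p x + pd j q x * pd k q x

/-- The Laplacian as a sum of iterated partial derivatives. -/
noncomputable def lap (f : Space → ℝ) (x : Space) : ℝ := ∑ k, pd k (pd k f) x

/-- The mass bracket `{P + i Q, p + i q}_m`. -/
noncomputable def massB (p q P Q : Space → ℝ) (x : Space) : ℝ := Q x * p x - P x * q x

/-- The momentum bracket `{P + i Q, p + i q}_p`. -/
noncomputable def momB (p q P Q : Space → ℝ) (j : Fin 3) (x : Space) : ℝ :=
  (P x * pd j p x + Q x * pd j q x) - (p x * pd j P x + q x * pd j Q x)

/-- The time derivative of the real part of a solution. -/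
noncomputable def reT (q Q : Space → ℝ) (x : Space) : ℝ := Q x - lap q x

/-- The time derivative of the imaginary part of a solution. -/
noncomputable def imT (p P : Space → ℝ) (x : Space) : ℝ := lap p x - P x

/-- The time derivative of the mass density. -/
noncomputable def densT (p q P Q : Space → ℝ) (x : Space) : ℝ :=
  2 * (p x * reT q Q x + q x * imT p P x)

/-- The time derivative of the momentum density. -/
noncomputable def momT (p q P Q : Space → ℝ) (j : Fin 3) (x : Space) : ℝ :=
  2 * ((reT q Q x * pd j q x + p x * pd j (imT p P) x) -
    (imT p P x * pd j p x + q x * pd j (reT q Q) x))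

theorem contDiff_lap {f : Space → ℝ} (hf : ContDiff ℝ ∞ f) : ContDiff ℝ ∞ (lap f) :=
  ContDiff.sum fun k _ => contDiff_pd (contDiff_pd hf k) k

theorem pd_lap {f : Space → ℝ} (hf : ContDiff ℝ ∞ f) (j : Fin 3) :
    pd j (lap f) = fun x => ∑ k, pd j (pd k (pd k f)) x :=
  pd_sum3 (fun k => contDiff_pd (contDiff_pd hf k) k) j

variable {p q P Q : Space → ℝ}

theorem pd_dens (hp : ContDiff ℝ ∞ p) (hq : ContDiff ℝ ∞ q) (k : Fin 3) :
    pd k (dens p q) = fun x => 2 * (p x * pd k p x + q x * pd k q x) := by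
  change pd k (fun x => p x * p x + q x * q x) = _
  rw [pd_add (hp.mul hp) (hq.mul hq), pd_mul hp hp, pd_mul hq hq]
  funext x; ring

theorem pd_pd_dens (hp : ContDiff ℝ ∞ p) (hq : ContDiff ℝ ∞ q) (k : Fin 3) :
    pd k (pd k (dens p q)) = fun x => 2 * ((pd k p x * pd k p x + p x * pd k (pd k p) x) +
      (pd k q x * pd k q x + q x * pd k (pd k q) x)) := by
  have hpk := contDiff_pd hp k
  have hqk := contDiff_pd hq k
  rw [pd_dens hp hq, pd_const_mul ((hp.mul hpk).add (hq.mul hqk)),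
    pd_add (hp.mul hpk) (hq.mul hqk), pd_mul hp hpk, pd_mul hq hqk]

theorem pd_pd_pd_dens (hp : ContDiff ℝ ∞ p) (hq : ContDiff ℝ ∞ q) (j k : Fin 3) (x : Space) :
    pd j (pd k (pd k (dens p q))) x =
      2 * ((2 * (pd k p x * pd j (pd k p) x) + pd j p x * pd k (pd k p) x
          + p x * pd j (pd k (pd k p)) x) +
        (2 * (pd k q x * pd j (pd k q) x) + pd j q x * pd k (pd k q) x
          + q x * pd j (pd k (pd k q)) x)) := by
  have hpk := contDiff_pd hp k
  have hqk := contDiff_pd hq k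
  have hpkk := contDiff_pd hpk k
  have hqkk := contDiff_pd hqk k
  rw [pd_pd_dens hp hq, pd_const_mul (((hpk.mul hpk).add (hp.mul hpkk)).add
      ((hqk.mul hqk).add (hq.mul hqkk))),
    pd_add ((hpk.mul hpk).add (hp.mul hpkk)) ((hqk.mul hqk).add (hq.mul hqkk)),
    pd_add (hpk.mul hpk) (hp.mul hpkk), pd_add (hqk.mul hqk) (hq.mul hqkk),
    pd_mul hpk hpk, pd_mul hp hpkk, pd_mul hqk hqk, pd_mul hq hqkk]
  ring

theorem pd_mom (hp : ContDiff ℝ ∞ p) (hq : ContDiff ℝ ∞ q) (k : Fin 3) (x : Space) :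
    pd k (mom p q k) x = 2 * (p x * pd k (pd k q) x - q x * pd k (pd k p) x) := by
  have hpk := contDiff_pd hp k
  have hqk := contDiff_pd hq k
  change pd k (fun x => 2 * (p x * pd k q x - q x * pd k p x)) x = _
  rw [pd_const_mul ((hp.mul hqk).sub (hq.mul hpk)), pd_sub (hp.mul hqk) (hq.mul hpk),
    pd_mul hp hqk, pd_mul hq hpk]
  ring

/-- The mixed derivatives are commuted to the order ∂_j ∂_k in which they occur in ∂_j of the
Laplacian of the density, so that the momentum law becomes a polynomial identity. -/
theorem pd_stress (hp : ContDiff ℝ ∞ p) (hq : ContDiff ℝ ∞ q) (j k : Fin 3) (x : Space) :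
    pd k (stress p q j k) x = (pd j (pd k p) x * pd k p x + pd j p x * pd k (pd k p) x) +
      (pd j (pd k q) x * pd k q x + pd j q x * pd k (pd k q) x) := by
  have hpk := contDiff_pd hp k
  have hqk := contDiff_pd hq k
  have hpj := contDiff_pd hp j
  have hqj := contDiff_pd hq j
  change pd k (fun x => pd j p x * pd k p x + pd j q x * pd k q x) x = _
  rw [pd_add (hpj.mul hpk) (hqj.mul hqk), pd_mul hpj hpk, pd_mul hqj hqk, pd_comm hp k j,
    pd_comm hq k j]

/-- The local conservation law for the mass. -/
theorem densT_eq (hp : ContDiff ℝ ∞ p) (hq : ContDiff ℝ ∞ q) :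
    densT p q P Q = fun x => -1 * (∑ k, pd k (mom p q k) x) + 2 * massB p q P Q x := by
  funext x
  simp only [densT, reT, imT, lap, massB, pd_mom hp hq, Fin.sum_univ_three]
  ring

/-- The local conservation law for the momentum. -/
theorem momT_eq (hp : ContDiff ℝ ∞ p) (hq : ContDiff ℝ ∞ q) (hP : ContDiff ℝ ∞ P)
    (hQ : ContDiff ℝ ∞ Q) (j : Fin 3) :
    momT p q P Q j = fun x => (2 * momB p q P Q j x + pd j (lap (dens p q)) x) +
      -4 * ∑ k, pd k (stress p q j k) x := by
  have h1 : pd j (imT p P) = fun x => (∑ k, pd j (pd k (pd k p)) x) - pd j P x := by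
    change pd j (fun x => lap p x - P x) = _
    rw [pd_sub (contDiff_lap hp) hP, pd_lap hp]
  have h2 : pd j (reT q Q) = fun x => pd j Q x - (∑ k, pd j (pd k (pd k q)) x) := by
    change pd j (fun x => Q x - lap q x) = _
    rw [pd_sub hQ (contDiff_lap hq), pd_lap hq]
  have hd : ContDiff ℝ ∞ (dens p q) := (hp.mul hp).add (hq.mul hq)
  funext x
  rw [pd_lap hd, momT, h1, h2]
  simp only [pd_pd_pd_dens hp hq, pd_stress hp hq, reT, imT, lap, momB, Fin.sum_univ_three]
  ring

theorem IsSchwartz.dens (hp : IsSchwartz p) (hq : IsSchwartz q) : IsSchwartz (dens p q) :=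
  (hp.mul hp).add (hq.mul hq)

theorem IsSchwartz.mom (hp : IsSchwartz p) (hq : IsSchwartz q) (j : Fin 3) :
    IsSchwartz (mom p q j) :=
  ((hp.mul (hq.pd j)).sub (hq.mul (hp.pd j))).const_mul 2

theorem IsSchwartz.stress (hp : IsSchwartz p) (hq : IsSchwartz q) (j k : Fin 3) :
    IsSchwartz (stress p q j k) :=
  ((hp.pd j).mul (hp.pd k)).add ((hq.pd j).mul (hq.pd k))

theorem IsSchwartz.lap {f : Space → ℝ} (hf : IsSchwartz f) : IsSchwartz (lap f) :=
  IsSchwartz.sum3 fun k => (hf.pd k).pd k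

theorem IsSchwartz.massB (hp : IsSchwartz p) (hq : IsSchwartz q) (hP : IsSchwartz P)
    (hQ : IsSchwartz Q) : IsSchwartz (massB p q P Q) :=
  (hQ.mul hp).sub (hP.mul hq)

theorem IsSchwartz.momB (hp : IsSchwartz p) (hq : IsSchwartz q) (hP : IsSchwartz P)
    (hQ : IsSchwartz Q) (j : Fin 3) : IsSchwartz (momB p q P Q j) :=
  ((hP.mul (hp.pd j)).add (hQ.mul (hq.pd j))).sub ((hp.mul (hP.pd j)).add (hq.mul (hQ.pd j)))

end LocalIdentities

/-! ### The interaction Morawetz identity for a regular field. -/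

section Identity

variable {h h₁ h₂ h₃ : ℝ → ℝ}

/-- The interaction Morawetz identity for the smooth radial field `h(|z|²) z`. -/
theorem pairing_morawetz_identity (hh : IsProfile h h₁ h₂ h₃) {p q P Q : Space → ℝ}
    (hp : IsSchwartz p) (hq : IsSchwartz q) (hP : IsSchwartz P) (hQ : IsSchwartz Q) :
    ∑ j, (pairing (fun z => h (‖z‖ ^ 2) * z j) (densT p q P Q) (mom p q j)
        + pairing (fun z => h (‖z‖ ^ 2) * z j) (dens p q) (momT p q P Q j)) =
      (∑ j, (2 * pairing (fun z => h (‖z‖ ^ 2) * z j) (massB p q P Q) (mom p q j)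
        + 2 * pairing (fun z => h (‖z‖ ^ 2) * z j) (dens p q) (momB p q P Q j)))
      + (∑ j, ∑ k, (4 * pairing (fieldDeriv h h₁ j k) (dens p q) (stress p q j k)
        - pairing (fieldDeriv h h₁ j k) (mom p q k) (mom p q j)))
      - pairing (fun z => 30 * h₁ (‖z‖ ^ 2) + 40 * ‖z‖ ^ 2 * h₂ (‖z‖ ^ 2)
        + 8 * (‖z‖ ^ 2) ^ 2 * h₃ (‖z‖ ^ 2)) (dens p q) (dens p q) := by
  have hρ := hp.dens hq
  have hK : ∀ j, IsKernel fun z => h (‖z‖ ^ 2) * z j := fun j =>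
    (hh.hasKernelDeriv_field j 0).kernel
  -- The mass law is inserted in the y slot, where the divergence moves onto the kernel without
  -- changing sign.
  have e1 : ∀ j, pairing (fun z => h (‖z‖ ^ 2) * z j) (densT p q P Q) (mom p q j) =
      -1 * (∑ k, pairing (fieldDeriv h h₁ j k) (mom p q k) (mom p q j)) +
        2 * pairing (fun z => h (‖z‖ ^ 2) * z j) (massB p q P Q) (mom p q j) := fun j => by
    have hT : ∀ k, IsSchwartz (pd k (mom p q k)) := fun k => (hp.mom hq k).pd k
    rw [densT_eq hp.contDiff hq.contDiff, pairing_add_left (hK j)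
      ((IsSchwartz.sum3 hT).const_mul (-1)).isRapid
      ((hp.massB hq hP hQ).const_mul 2).isRapid (hp.mom hq j).isRapid, pairing_const_left,
      pairing_const_left, pairing_sum_left (hK j) (fun k => (hT k).isRapid) (hp.mom hq j).isRapid]
    congr 2
    exact Finset.sum_congr rfl fun k _ =>
      pairing_pd_left (hh.hasKernelDeriv_field j k) (hp.mom hq k) (hp.mom hq j).isRapid
  have e2 : ∀ j, pairing (fun z => h (‖z‖ ^ 2) * z j) (dens p q) (momT p q P Q j) =
      2 * pairing (fun z => h (‖z‖ ^ 2) * z j) (dens p q) (momB p q P Q j)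
      + -1 * pairing (fieldDeriv h h₁ j j) (dens p q) (lap (dens p q))
      + 4 * ∑ k, pairing (fieldDeriv h h₁ j k) (dens p q) (stress p q j k) := fun j => by
    have hS : ∀ k, IsSchwartz (pd k (stress p q j k)) := fun k => (hp.stress hq j k).pd k
    have hB := (hp.momB hq hP hQ j).const_mul 2
    have hL := hρ.lap.pd j
    rw [momT_eq hp.contDiff hq.contDiff hP.contDiff hQ.contDiff, pairing_add_right (hK j)
      hρ.isRapid (hB.add hL).isRapid ((IsSchwartz.sum3 hS).const_mul (-4)).isRapid,
      pairing_add_right (hK j) hρ.isRapid hB.isRapid hL.isRapid, pairing_const_right,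
      pairing_const_right, pairing_sum_right (hK j) hρ.isRapid (fun k => (hS k).isRapid),
      pairing_pd_right (hh.hasKernelDeriv_field j j) hρ.isRapid hρ.lap]
    have : ∀ k, pairing (fun z => h (‖z‖ ^ 2) * z j) (dens p q) (pd k (stress p q j k)) =
        -1 * pairing (fieldDeriv h h₁ j k) (dens p q) (stress p q j k) := fun k => by
      rw [pairing_pd_right (hh.hasKernelDeriv_field j k) hρ.isRapid (hp.stress hq j k)]; ring
    simp only [this]
    rw [← Finset.mul_sum]
    ring
  -- Summing over j turns the derivatives of the field into its divergence; two more integrations by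
  -- parts in x move the Laplacian onto it.
  have e3 : ∑ j, pairing (fieldDeriv h h₁ j j) (dens p q) (lap (dens p q)) =
      pairing (fun z => 30 * h₁ (‖z‖ ^ 2) + 40 * ‖z‖ ^ 2 * h₂ (‖z‖ ^ 2)
        + 8 * (‖z‖ ^ 2) ^ 2 * h₃ (‖z‖ ^ 2)) (dens p q) (dens p q) := by
    rw [← pairing_sum_kernel (fun j => (hh.hasKernelDeriv_field j j).kernel_deriv) hρ.isRapid
      hρ.lap.isRapid]
    simp only [sum_fieldDeriv_self]
    change pairing _ _ (fun x => ∑ k, pd k (pd k (dens p q)) x) = _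
    rw [pairing_sum_right (hh.hasKernelDeriv_div 0).kernel hρ.isRapid
      fun k => ((hρ.pd k).pd k).isRapid]
    have : ∀ k, pairing (fun z => divProfile h h₁ (‖z‖ ^ 2)) (dens p q) (pd k (pd k (dens p q))) =
        pairing (divDeriv₂ h₁ h₂ h₃ k) (dens p q) (dens p q) := fun k => by
      rw [pairing_pd_right (hh.hasKernelDeriv_div k) hρ.isRapid (hρ.pd k),
        pairing_pd_right (hh.hasKernelDeriv_div₂ k) hρ.isRapid hρ, neg_neg]
    simp only [this]
    rw [← pairing_sum_kernel (fun k => (hh.hasKernelDeriv_div₂ k).kernel_deriv) hρ.isRapid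
      hρ.isRapid]
    simp only [sum_divDeriv₂]
  simp only [e1, e2]
  rw [← e3]
  simp only [Fin.sum_univ_three]
  ring

end Identity

/-! ### Positivity of the symmetrized momentum flux. -/

section Positivity

/-- The symmetrized momentum flux of the tensor product of two fields with values `a + i b`,
`a' + i b'` and gradients `α + i β`, `α' + i β'`. -/
noncomputable def flux (a b a' b' : ℝ) (α β α' β' : Fin 3 → ℝ) (j k : Fin 3) : ℝ :=
  2 * ((a' * a' + b' * b') * (α j * α k + β j * β k)) +
    2 * ((α' j * α' k + β' j * β' k) * (a * a + b * b)) -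
      2 * (a' * β' k - b' * α' k) * (2 * (a * β j - b * α j))

theorem sum_mul_sq_le (z v : Fin 3 → ℝ) :
    (∑ j, z j * v j) ^ 2 ≤ (∑ j, z j * z j) * ∑ j, v j * v j := by
  have := Finset.sum_mul_sq_le_sq_mul_sq Finset.univ z v
  simpa only [sq] using this

/-- With u, u' the values at x and y, the form is |ū'∇u + u∇ū'|² + |u'∇u − u∇u'|². The cross terms
of the two squares combine to −4 Im(ū∇u) Im(ū'∇u'). The four vectors are the real and imaginary
parts of these two expressions. -/
theorem flux_form (a b a' b' : ℝ) (α β α' β' : Fin 3 → ℝ) :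
    ∃ v : Fin 4 → Fin 3 → ℝ,
      (∑ j, flux a b a' b' α β α' β' j j = ∑ i, ∑ j, v i j * v i j) ∧
      ∀ z : Fin 3 → ℝ, ∑ j, ∑ k, z j * z k * flux a b a' b' α β α' β' j k =
        ∑ i, (∑ j, z j * v i j) ^ 2 := by
  refine ⟨![fun j => a' * α j + b' * β j + (a * α' j + b * β' j),
    fun j => a' * β j - b' * α j + (b * α' j - a * β' j),
    fun j => a' * α j - b' * β j - (a * α' j - b * β' j),
    fun j => a' * β j + b' * α j - (a * β' j + b * α' j)], ?_, fun z => ?_⟩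
  · simp only [flux, Fin.sum_univ_three, Fin.sum_univ_four, Matrix.cons_val]
    ring
  · simp only [flux, Fin.sum_univ_three, Fin.sum_univ_four, Matrix.cons_val]
    ring

/-- A parallelogram argument: reversing the sign of the gradient at y flips only the product of
momenta, the resulting form is still nonnegative, and the two forms add up to the right-hand side.
-/
theorem flux_form_le (a b a' b' : ℝ) (α β α' β' z : Fin 3 → ℝ) :
    ∑ j, ∑ k, z j * z k * flux a b a' b' α β α' β' j k ≤
      ∑ j, ∑ k, z j * z k * (4 * ((a' * a' + b' * b') * (α j * α k + β j * β k)) +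
        4 * ((α' j * α' k + β' j * β' k) * (a * a + b * b))) := by
  obtain ⟨v, -, hv⟩ := flux_form a b a' b' α β (-α') (-β')
  have h1 : 0 ≤ ∑ j, ∑ k, z j * z k * flux a b a' b' α β (-α') (-β') j k := by
    rw [hv]; exact Finset.sum_nonneg fun i _ => sq_nonneg _
  rw [← sub_nonneg]
  refine h1.trans_eq ?_
  simp only [flux, Fin.sum_univ_three, Pi.neg_apply]
  ring

variable {χ : ℝ → ℝ}

/-- The coordinates of the radial unit vector. -/
noncomputable def radialCoord (j : Fin 3) (z : Space) : ℝ := ‖z‖⁻¹ * z j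

/-- The derivative of a radial field is a multiple of the identity plus a multiple of z⊗z, so the
contraction sees the flux only through its trace V and Z = ⟨flux z, z⟩. Cauchy–Schwarz on the
squares gives 0 ≤ Z ≤ |z|²V, and `regProfile_form_ge` applies. -/
theorem sum_fieldDeriv_mul_flux_ge (hχ : IsRadialCutoff χ) {e : ℝ} (he : 0 < e) (z : Space)
    (a b a' b' : ℝ) (α β α' β' : Fin 3 → ℝ) :
    -(√e * ∑ j, flux a b a' b' α β α' β' j j) -
      ∑ j, ∑ k, |radialProfile χ (‖z‖ ^ 2)| * (radialCoord j z * radialCoord k z) *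
        (4 * ((a' * a' + b' * b') * (α j * α k + β j * β k)) +
        4 * ((α' j * α' k + β' j * β' k) * (a * a + b * b))) ≤
      ∑ j, ∑ k, fieldDeriv (regProfile χ e) (regProfile₁ χ e) j k z *
        flux a b a' b' α β α' β' j k := by
  obtain ⟨v, hV, hZ⟩ := flux_form a b a' b' α β α' β'
  have hz := norm_sq_eq_sum z
  set V := ∑ j, flux a b a' b' α β α' β' j j with hVdef
  set Z := ∑ j, ∑ k, z j * z k * flux a b a' b' α β α' β' j k with hZdef
  have hV0 : 0 ≤ V := by
    rw [hV]
    exact Finset.sum_nonneg fun i _ => Finset.sum_nonneg fun j _ => mul_self_nonneg _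
  have hZ0 : 0 ≤ Z := by
    rw [hZdef, hZ]; exact Finset.sum_nonneg fun i _ => sq_nonneg _
  have hZV : Z ≤ ‖z‖ ^ 2 * V := by
    rw [hZdef, hZ, hV, hz, Finset.mul_sum]
    exact Finset.sum_le_sum fun i _ => sum_mul_sq_le _ _
  have h1 := regProfile_form_ge hχ he (sq_nonneg ‖z‖) hV0 hZ0 hZV
  have h2 : ∑ j, ∑ k, fieldDeriv (regProfile χ e) (regProfile₁ χ e) j k z *
        flux a b a' b' α β α' β' j k =
      regProfile χ e (‖z‖ ^ 2) * V + 2 * regProfile₁ χ e (‖z‖ ^ 2) * Z := by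
    rw [hVdef, hZdef]
    simp only [fieldDeriv, Fin.sum_univ_three]
    simp
    ring
  have h3 : (‖z‖ ^ 2)⁻¹ * Z ≤ ∑ j, ∑ k, radialCoord j z * radialCoord k z *
        (4 * ((a' * a' + b' * b') * (α j * α k + β j * β k)) +
        4 * ((α' j * α' k + β' j * β' k) * (a * a + b * b))) := by
    have := mul_le_mul_of_nonneg_left (flux_form_le a b a' b' α β α' β' z)
      (inv_nonneg.2 (sq_nonneg ‖z‖))
    refine this.trans_eq ?_
    rw [Finset.mul_sum]
    refine Finset.sum_congr rfl fun j _ => ?_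
    rw [Finset.mul_sum]
    refine Finset.sum_congr rfl fun k _ => ?_
    simp only [radialCoord]
    rw [← inv_pow]
    ring
  have h4 : ∑ j, ∑ k, |radialProfile χ (‖z‖ ^ 2)| * (radialCoord j z * radialCoord k z) *
        (4 * ((a' * a' + b' * b') * (α j * α k + β j * β k)) +
        4 * ((α' j * α' k + β' j * β' k) * (a * a + b * b))) =
      |radialProfile χ (‖z‖ ^ 2)| * ∑ j, ∑ k, radialCoord j z * radialCoord k z *
        (4 * ((a' * a' + b' * b') * (α j * α k + β j * β k)) +
        4 * ((α' j * α' k + β' j * β' k) * (a * a + b * b))) := by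
    simp only [Finset.mul_sum, mul_assoc]
  rw [h2, h4]
  have h5 := mul_le_mul_of_nonneg_left h3 (abs_nonneg (radialProfile χ (‖z‖ ^ 2)))
  linarith

end Positivity

/-! ### The stress term bounded below by annular and vanishing errors. -/

section Error

variable {χ : ℝ → ℝ} {p q : Space → ℝ}

theorem abs_radialCoord_le (j : Fin 3) (z : Space) : |radialCoord j z| ≤ 1 := by
  rw [radialCoord, abs_mul, abs_inv, abs_norm]
  have := PiLp.norm_apply_le z j
  rw [Real.norm_eq_abs] at this
  rcases eq_or_ne ‖z‖ 0 with h | h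
  · simp [h]
  · rw [inv_mul_le_iff₀ (lt_of_le_of_ne (norm_nonneg _) h.symm), mul_one]; exact this

theorem measurable_radialCoord (j : Fin 3) : Measurable (radialCoord j) :=
  measurable_norm.inv.mul (by fun_prop)

theorem isKernel_radialCoord (j : Fin 3) : IsKernel (radialCoord j) :=
  IsKernel.of_bounded (measurable_radialCoord j) (abs_radialCoord_le j)

theorem radialCoord_neg (j : Fin 3) (z : Space) : radialCoord j (-z) = - radialCoord j z := by
  simp [radialCoord]

/-- For an even kernel the stress term may be symmetrized. -/
theorem pairing_flux {K : Space → ℝ} (hK : IsKernel K) (hKs : ∀ z, K (-z) = K z)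
    (hp : IsSchwartz p) (hq : IsSchwartz q) (j k : Fin 3) :
    Integrable (fun r : Space × Space => K (r.2 - r.1) * flux (p r.2) (q r.2) (p r.1) (q r.1)
      (fun i => pd i p r.2) (fun i => pd i q r.2) (fun i => pd i p r.1) (fun i => pd i q r.1) j k) ∧
    4 * pairing K (dens p q) (stress p q j k) - pairing K (mom p q k) (mom p q j) =
      ∫ r : Space × Space, K (r.2 - r.1) * flux (p r.2) (q r.2) (p r.1) (q r.1)
      (fun i => pd i p r.2) (fun i => pd i q r.2) (fun i => pd i p r.1) (fun i => pd i q r.1) j k := by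
  have i1 := (integrable_kernel_pairing hK (hp.dens hq).isRapid
    (hp.stress hq j k).isRapid).const_mul 2
  have i2 := (integrable_kernel_pairing hK (hp.stress hq j k).isRapid
    (hp.dens hq).isRapid).const_mul 2
  have i3 := integrable_kernel_pairing hK (hp.mom hq k).isRapid (hp.mom hq j).isRapid
  have e : (fun r : Space × Space => K (r.2 - r.1) * flux (p r.2) (q r.2) (p r.1) (q r.1)
      (fun i => pd i p r.2) (fun i => pd i q r.2) (fun i => pd i p r.1) (fun i => pd i q r.1) j k) =
      fun r => (2 * (K (r.2 - r.1) * (dens p q r.1 * stress p q j k r.2)) +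
        2 * (K (r.2 - r.1) * (stress p q j k r.1 * dens p q r.2))) -
        K (r.2 - r.1) * (mom p q k r.1 * mom p q j r.2) := by
    funext r
    simp only [flux, dens, stress, mom]
    ring
  rw [e]
  refine ⟨(i1.add i2).sub i3, ?_⟩
  have s : pairing K (stress p q j k) (dens p q) = pairing K (dens p q) (stress p q j k) := by
    rw [pairing_swap]
    simp only [hKs]
  have i12 := i1.add i2
  simp only [Pi.add_def] at i12
  rw [integral_sub i12 i3, integral_add i1 i2, integral_const_mul, integral_const_mul]
  change _ = 2 * pairing K (dens p q) (stress p q j k) + 2 * pairing K (stress p q j k) (dens p q) -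
    pairing K (mom p q k) (mom p q j)
  rw [s]
  ring

/-- The error is put in the same x–y symmetric shape as the flux, so that the two can be compared
pointwise under the integral. Each half contributes 4, which is the origin of the constant 8. -/
theorem pairing_stress_symm {K : Space → ℝ} (hK : IsKernel K) (hKs : ∀ z, K (-z) = K z)
    (hp : IsSchwartz p) (hq : IsSchwartz q) (j k : Fin 3) :
    Integrable (fun r : Space × Space => K (r.2 - r.1) *
      (4 * ((p r.1 * p r.1 + q r.1 * q r.1) * (pd j p r.2 * pd k p r.2 + pd j q r.2 * pd k q r.2)) +
       4 * ((pd j p r.1 * pd k p r.1 + pd j q r.1 * pd k q r.1) *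
        (p r.2 * p r.2 + q r.2 * q r.2)))) ∧
    8 * pairing K (dens p q) (stress p q j k) = ∫ r : Space × Space, K (r.2 - r.1) *
      (4 * ((p r.1 * p r.1 + q r.1 * q r.1) * (pd j p r.2 * pd k p r.2 + pd j q r.2 * pd k q r.2)) +
       4 * ((pd j p r.1 * pd k p r.1 + pd j q r.1 * pd k q r.1) *
        (p r.2 * p r.2 + q r.2 * q r.2))) := by
  have i1 := (integrable_kernel_pairing hK (hp.dens hq).isRapid
    (hp.stress hq j k).isRapid).const_mul 4
  have i2 := (integrable_kernel_pairing hK (hp.stress hq j k).isRapid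
    (hp.dens hq).isRapid).const_mul 4
  have e : (fun r : Space × Space => K (r.2 - r.1) *
      (4 * ((p r.1 * p r.1 + q r.1 * q r.1) * (pd j p r.2 * pd k p r.2 + pd j q r.2 * pd k q r.2)) +
       4 * ((pd j p r.1 * pd k p r.1 + pd j q r.1 * pd k q r.1) *
        (p r.2 * p r.2 + q r.2 * q r.2)))) =
      fun r => 4 * (K (r.2 - r.1) * (dens p q r.1 * stress p q j k r.2)) +
        4 * (K (r.2 - r.1) * (stress p q j k r.1 * dens p q r.2)) := by
    funext r
    simp only [dens, stress]
    ring
  rw [e]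
  refine ⟨i1.add i2, ?_⟩
  have s : pairing K (stress p q j k) (dens p q) = pairing K (dens p q) (stress p q j k) := by
    rw [pairing_swap]
    simp only [hKs]
  rw [integral_add i1 i2, integral_const_mul, integral_const_mul]
  change _ = 4 * pairing K (dens p q) (stress p q j k) + 4 * pairing K (stress p q j k) (dens p q)
  rw [s]
  ring

/-- The kernel of the annular radial error term. -/
noncomputable def radialErrorKernel (χ : ℝ → ℝ) (j k : Fin 3) (z : Space) : ℝ :=
  |radialProfile χ (‖z‖ ^ 2)| * (radialCoord j z * radialCoord k z)

theorem exists_bound_of_annular {w : ℝ → ℝ} (hw : Continuous w) (h1 : ∀ s ≤ 1, w s = 0)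
    (h4 : ∀ s, 4 ≤ s → w s = 0) : ∃ B, ∀ s, |w s| ≤ B := by
  obtain ⟨B, hB⟩ := isCompact_Icc.exists_bound_of_continuousOn (hw.continuousOn (s := Set.Icc 1 4))
  have hB0 : 0 ≤ B := (norm_nonneg _).trans (hB 1 (by norm_num))
  refine ⟨B, fun s => ?_⟩
  rcases le_or_gt s 1 with h | h
  · rw [h1 s h, abs_zero]; exact hB0
  rcases le_or_gt 4 s with h' | h'
  · rw [h4 s h', abs_zero]; exact hB0
  exact hB s ⟨h.le, h'.le⟩

theorem isKernel_radialErrorKernel (hχ : IsRadialCutoff χ) (j k : Fin 3) :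
    IsKernel (radialErrorKernel χ j k) := by
  obtain ⟨B, hB⟩ := exists_bound_of_annular (contDiff_radialProfile hχ).continuous
    (radialProfile_of_le_one hχ) (radialProfile_of_four_le hχ)
  refine IsKernel.mul ?_ ((isKernel_radialCoord j).mul (isKernel_radialCoord k))
  refine IsKernel.of_bounded (C := B) ?_ fun z => by rw [abs_abs]; exact hB _
  exact ((contDiff_radialProfile hχ).continuous.comp (by fun_prop)).abs.measurable

theorem isKernel_bilaplaceProfile (hχ : IsRadialCutoff χ) :
    IsKernel fun z => bilaplaceProfile χ (‖z‖ ^ 2) := by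
  obtain ⟨B, hB⟩ := exists_bound_of_annular (contDiff_bilaplaceProfile hχ).continuous
    (bilaplaceProfile_of_le_one hχ) (bilaplaceProfile_of_four_le hχ)
  exact IsKernel.of_bounded
    ((contDiff_bilaplaceProfile hχ).continuous.comp (by fun_prop)).measurable fun z => hB _

/-- Positivity holds only after symmetrization in x and y, which is allowed because all kernels
involved are even. The factor of √e depends neither on e nor on χ, so it disappears in the limit. -/
theorem sum_pairing_fieldDeriv_ge (hχ : IsRadialCutoff χ) {e : ℝ} (he : 0 < e)
    (hp : IsSchwartz p) (hq : IsSchwartz q) :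
    -(√e * ∑ j, (4 * pairing (fun _ => 1) (dens p q) (stress p q j j) -
        pairing (fun _ => 1) (mom p q j) (mom p q j))) -
      8 * ∑ j, ∑ k, pairing (radialErrorKernel χ j k) (dens p q) (stress p q j k) ≤
    ∑ j, ∑ k, (4 * pairing (fieldDeriv (regProfile χ e) (regProfile₁ χ e) j k)
        (dens p q) (stress p q j k) -
      pairing (fieldDeriv (regProfile χ e) (regProfile₁ χ e) j k) (mom p q k) (mom p q j)) := by
  have hA : ∀ j k, IsKernel (fieldDeriv (regProfile χ e) (regProfile₁ χ e) j k) := fun j k =>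
    ((isProfile_regProfile hχ he).hasKernelDeriv_field j k).kernel_deriv
  have hL := isKernel_radialErrorKernel hχ
  have fA := fun j k => pairing_flux (hA j k) (fieldDeriv_neg _ _ j k) hp hq j k
  have f1 := fun j => pairing_flux (IsKernel.const 1) (fun _ => rfl) hp hq j j
  have fL := fun j k => pairing_stress_symm (hL j k)
    (fun z => by simp [radialErrorKernel, radialCoord_neg]) hp hq j k
  have e8 : 8 * ∑ j, ∑ k, pairing (radialErrorKernel χ j k) (dens p q) (stress p q j k) =
      ∑ j, ∑ k, 8 * pairing (radialErrorKernel χ j k) (dens p q) (stress p q j k) := by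
    simp only [Finset.mul_sum]
  rw [e8]
  simp only [(fA _ _).2, (f1 _).2, (fL _ _).2]
  rw [← integral_finsetSum _ fun j _ => (f1 j).1, ← integral_const_mul]
  have sA : ∀ j, ∑ k, ∫ r : Space × Space, fieldDeriv (regProfile χ e) (regProfile₁ χ e) j k
      (r.2 - r.1) * flux (p r.2) (q r.2) (p r.1) (q r.1)
      (fun i => pd i p r.2) (fun i => pd i q r.2) (fun i => pd i p r.1) (fun i => pd i q r.1) j k =
      ∫ r : Space × Space, ∑ k, fieldDeriv (regProfile χ e) (regProfile₁ χ e) j k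
      (r.2 - r.1) * flux (p r.2) (q r.2) (p r.1) (q r.1)
      (fun i => pd i p r.2) (fun i => pd i q r.2) (fun i => pd i p r.1) (fun i => pd i q r.1) j k :=
    fun j => (integral_finsetSum _ fun k _ => (fA j k).1).symm
  have sL : ∀ j, ∑ k, ∫ r : Space × Space, radialErrorKernel χ j k (r.2 - r.1) *
      (4 * ((p r.1 * p r.1 + q r.1 * q r.1) * (pd j p r.2 * pd k p r.2 + pd j q r.2 * pd k q r.2)) +
       4 * ((pd j p r.1 * pd k p r.1 + pd j q r.1 * pd k q r.1) *
        (p r.2 * p r.2 + q r.2 * q r.2))) =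
      ∫ r : Space × Space, ∑ k, radialErrorKernel χ j k (r.2 - r.1) *
      (4 * ((p r.1 * p r.1 + q r.1 * q r.1) * (pd j p r.2 * pd k p r.2 + pd j q r.2 * pd k q r.2)) +
       4 * ((pd j p r.1 * pd k p r.1 + pd j q r.1 * pd k q r.1) *
        (p r.2 * p r.2 + q r.2 * q r.2))) :=
    fun j => (integral_finsetSum _ fun k _ => (fL j k).1).symm
  have iA := fun j => integrable_finsetSum Finset.univ fun k _ => (fA j k).1
  have iL := fun j => integrable_finsetSum Finset.univ fun k _ => (fL j k).1
  have i1 := (integrable_finsetSum Finset.univ fun j _ => (f1 j).1).const_mul √e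
  have i1n := i1.neg
  simp only [Pi.neg_def] at i1n
  simp only [sA, sL]
  rw [← integral_finsetSum _ fun j _ => iA j, ← integral_finsetSum _ fun j _ => iL j,
    ← integral_neg, ← integral_sub i1n (integrable_finsetSum _ fun j _ => iL j)]
  refine integral_mono (i1n.sub (integrable_finsetSum _ fun j _ => iL j))
    (integrable_finsetSum _ fun j _ => iA j) fun r => ?_
  have key := sum_fieldDeriv_mul_flux_ge hχ he (r.2 - r.1) (p r.2) (q r.2) (p r.1) (q r.1)
    (fun i => pd i p r.2) (fun i => pd i q r.2) (fun i => pd i p r.1) (fun i => pd i q r.1)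
  simpa only [one_mul, radialErrorKernel] using key

end Error

/-! ### Removing the regularization: convergence of the field and of the peak. -/

section Limit

variable {χ : ℝ → ℝ}

/-- The coordinates of the Morawetz field `χ(|z|) z / |z|`. -/
noncomputable def field (χ : ℝ → ℝ) (j : Fin 3) (z : Space) : ℝ := χ ‖z‖ * radialCoord j z

theorem IsRadialCutoff.bddAbove (hχ : IsRadialCutoff χ) :
    BddAbove (Set.range fun r : Set.Ici (0 : ℝ) => χ r) := by
  obtain ⟨B, hB⟩ := isCompact_Icc.exists_bound_of_continuousOn
    (hχ.smooth.continuousOn.mono (t := Set.Icc 0 2) fun x hx => hx.1)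
  refine ⟨max B 0, ?_⟩
  rintro _ ⟨⟨r, hr⟩, rfl⟩
  rcases le_or_gt r 2 with h | h
  · exact ((le_abs_self _).trans (hB r ⟨hr, h⟩)).trans (le_max_left _ _)
  · exact (hχ.eq_zero r h).trans_le (le_max_right _ _)

theorem IsRadialCutoff.le_iSup (hχ : IsRadialCutoff χ) {r : ℝ} (hr : 0 ≤ r) :
    χ r ≤ ⨆ r : Set.Ici (0 : ℝ), χ r :=
  le_ciSup hχ.bddAbove ⟨r, hr⟩

theorem measurable_cutoff_norm (hχ : IsRadialCutoff χ) : Measurable fun z : Space => χ ‖z‖ :=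
  (hχ.smooth.continuousOn.comp_continuous continuous_norm fun z => norm_nonneg z).measurable

theorem measurable_field (hχ : IsRadialCutoff χ) (j : Fin 3) : Measurable (field χ j) :=
  (measurable_cutoff_norm hχ).mul (measurable_radialCoord j)

theorem abs_field_le (hχ : IsRadialCutoff χ) (j : Fin 3) (z : Space) :
    |field χ j z| ≤ ⨆ r : Set.Ici (0 : ℝ), χ r := by
  rw [field, abs_mul, abs_of_nonneg (hχ.nonneg _ (norm_nonneg z))]
  exact (mul_le_of_le_one_right (hχ.nonneg _ (norm_nonneg z)) (abs_radialCoord_le j z)).trans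
    (hχ.le_iSup (norm_nonneg z))

theorem isKernel_field (hχ : IsRadialCutoff χ) (j : Fin 3) : IsKernel (field χ j) :=
  IsKernel.of_bounded (measurable_field hχ j) (abs_field_le hχ j)

/-- The regularized unit field contributes 1 and the tail (1 − χ) z/|z| at most 1 + sup χ.
Uniformity in e is what dominated convergence needs. -/
theorem abs_regProfile_mul_coord_le (hχ : IsRadialCutoff χ) {e : ℝ} (he : 0 < e) (j : Fin 3)
    (z : Space) :
    |regProfile χ e (‖z‖ ^ 2) * z j| ≤ 2 + ⨆ r : Set.Ici (0 : ℝ), χ r := by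
  have hz := PiLp.norm_apply_le z j
  rw [Real.norm_eq_abs] at hz
  have h1 : |invSqrt e (‖z‖ ^ 2) * z j| ≤ 1 := by
    rw [abs_mul, abs_of_nonneg (invSqrt_nonneg _ _), invSqrt, inv_mul_le_iff₀ (by positivity),
      mul_one]
    exact hz.trans (Real.le_sqrt_of_sq_le (by linarith))
  have h2 : |tailProfile χ (‖z‖ ^ 2) * z j| ≤ 1 + ⨆ r : Set.Ici (0 : ℝ), χ r := by
    have e1 : tailProfile χ (‖z‖ ^ 2) * z j = (1 - χ ‖z‖) * radialCoord j z := by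
      rw [tailProfile, Real.sqrt_sq (norm_nonneg z), radialCoord, mul_assoc]
    have e2 : |1 - χ ‖z‖| ≤ 1 + ⨆ r : Set.Ici (0 : ℝ), χ r := by
      have := hχ.nonneg _ (norm_nonneg z)
      have := hχ.le_iSup (norm_nonneg z)
      rw [abs_le]; constructor <;> linarith
    rw [e1, abs_mul]
    exact (mul_le_of_le_one_right (abs_nonneg _) (abs_radialCoord_le j z)).trans e2
  rw [regProfile, sub_mul]
  exact (abs_sub _ _).trans (by linarith)

theorem tendsto_regProfile_mul_coord (χ : ℝ → ℝ) (j : Fin 3) (z : Space) {e : ℕ → ℝ}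
    (he : Filter.Tendsto e Filter.atTop (nhds 0)) :
    Filter.Tendsto (fun n => regProfile χ (e n) (‖z‖ ^ 2) * z j) Filter.atTop
      (nhds (field χ j z)) := by
  rcases eq_or_ne z 0 with rfl | hz
  -- At the origin both sides vanish, thanks to the convention 0⁻¹ = 0.
  · simp [field, radialCoord]
  have hn : 0 < ‖z‖ := norm_pos_iff.2 hz
  have h1 : field χ j z = (invSqrt 0 (‖z‖ ^ 2) - tailProfile χ (‖z‖ ^ 2)) * z j := by
    rw [field, radialCoord, tailProfile, invSqrt, add_zero, Real.sqrt_sq hn.le]; ring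
  rw [h1]
  refine Filter.Tendsto.mul_const _ (Filter.Tendsto.sub_const ?_ _)
  have h2 : Filter.Tendsto (fun n => √(‖z‖ ^ 2 + e n)) Filter.atTop (nhds √(‖z‖ ^ 2 + 0)) :=
    (Real.continuous_sqrt.tendsto _).comp (he.const_add _)
  exact h2.inv₀ (by rw [add_zero, Real.sqrt_sq hn.le]; exact hn.ne')

theorem tendsto_pairing {K : ℕ → Space → ℝ} {L : Space → ℝ} {f g : Space → ℝ} {B : ℝ}
    (hK : ∀ n, Measurable (K n)) (hB : ∀ n z, |K n z| ≤ B)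
    (hL : ∀ z, Filter.Tendsto (fun n => K n z) Filter.atTop (nhds (L z)))
    (hf : IsRapid f) (hg : IsRapid g) :
    Filter.Tendsto (fun n => pairing (K n) f g) Filter.atTop (nhds (pairing L f g)) := by
  have i := integrable_kernel_pairing (IsKernel.const 1) hf hg
  refine tendsto_integral_of_dominated_convergence (fun r : Space × Space =>
    B * |1 * (f r.1 * g r.2)|) (fun n => ?_) (i.abs.const_mul B) (fun n => ?_) ?_
  · exact (integrable_kernel_pairing (IsKernel.of_bounded (hK n) (hB n)) hf hg).1
  · refine Filter.Eventually.of_forall fun r => ?_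
    rw [one_mul, Real.norm_eq_abs, abs_mul]
    exact mul_le_mul_of_nonneg_right (hB n _) (abs_nonneg _)
  · exact Filter.Eventually.of_forall fun r => (hL _).mul_const _

/-- The regularization of `8 π δ` arising as the bilaplacian of `-|z|`. -/
noncomputable def peak (e : ℝ) (z : Space) : ℝ := 15 * e ^ 2 * invSqrt e (‖z‖ ^ 2) ^ 7

theorem isKernel_peak {e : ℝ} (he : 0 < e) : IsKernel (peak e) := by
  have h := (isProfile_invSqrt he).isKernel.2.2.2
  have h2 := (IsKernel.const (15 * e ^ 2 * -(8 / 15))).mul h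
  convert h2 using 2
  rw [peak]; ring

theorem integral_peak_radial :
    ∫ r in Set.Ioi (0 : ℝ), r ^ 2 * (15 * invSqrt 1 (r ^ 2) ^ 7) = 2 := by
  have hpos : ∀ r : ℝ, 0 < r ^ 2 + 1 := fun r => by positivity
  have hg : ∀ r : ℝ, HasDerivAt (fun r : ℝ => r * invSqrt 1 (r ^ 2)) (invSqrt 1 (r ^ 2) ^ 3) r := by
    intro r
    have h1 : HasDerivAt (fun r : ℝ => invSqrt 1 (r ^ 2))
        (-(1 / 2) * invSqrt 1 (r ^ 2) ^ 3 * (2 * r)) r := by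
      refine (HasDerivAt.comp (h₂ := invSqrt 1) (h := fun r => r ^ 2) r
        (hasDerivAt_invSqrt (hpos r)) (hasDerivAt_pow 2 r)).congr_deriv ?_
      norm_num
    refine ((hasDerivAt_id r).mul h1).congr_deriv ?_
    have := invSqrt_sq (hpos r)
    simp only [id]
    linear_combination (-invSqrt 1 (r ^ 2)) * this
  -- With w = r/√(1+r²) one has w' = (1+r²)^(-3/2) and 1 − w² = (1+r²)⁻¹, so the integrand is
  -- 15w²(1−w²)w', with primitive 5w³ − 3w⁵. Since w → 1 the integral is 2.
  have hG : ∀ r : ℝ, HasDerivAt (fun r : ℝ => 5 * (r * invSqrt 1 (r ^ 2)) ^ 3 -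
      3 * (r * invSqrt 1 (r ^ 2)) ^ 5) (r ^ 2 * (15 * invSqrt 1 (r ^ 2) ^ 7)) r := by
    intro r
    refine ((((hg r).pow 3).const_mul 5).sub (((hg r).pow 5).const_mul 3)).congr_deriv ?_
    have := invSqrt_sq (hpos r)
    push_cast
    linear_combination (-15 * r ^ 2 * invSqrt 1 (r ^ 2) ^ 5) * this
  have hlim : Filter.Tendsto (fun r : ℝ => r * invSqrt 1 (r ^ 2)) Filter.atTop (nhds 1) := by
    have h1 : Filter.Tendsto (fun r : ℝ => (√(1 + (r ^ 2)⁻¹))⁻¹) Filter.atTop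
        (nhds (√(1 + 0))⁻¹) := by
      refine Filter.Tendsto.inv₀ ?_ (by simp)
      refine (Real.continuous_sqrt.tendsto _).comp (Filter.Tendsto.const_add _ ?_)
      exact tendsto_inv_atTop_zero.comp (Filter.tendsto_pow_atTop two_ne_zero)
    rw [add_zero, Real.sqrt_one, inv_one] at h1
    refine h1.congr' ?_
    filter_upwards [Filter.eventually_gt_atTop 0] with r hr
    have e1 : r ^ 2 + 1 = r ^ 2 * (1 + (r ^ 2)⁻¹) := by field_simp
    rw [invSqrt, e1, Real.sqrt_mul (by positivity), Real.sqrt_sq hr.le]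
    field_simp
  have hlim' := ((hlim.pow 3).const_mul 5).sub ((hlim.pow 5).const_mul 3)
  have := integral_Ioi_of_hasDerivAt_of_nonneg' (a := 0) (fun r _ => hG r)
    (fun r _ => mul_nonneg (sq_nonneg r) (mul_nonneg (by norm_num)
      (pow_nonneg (invSqrt_nonneg _ _) 7))) hlim'
  rw [this]
  norm_num

/-- In polar coordinates: dimension 3, times the volume 4π/3 of the unit ball, times the radial
integral 2. -/
theorem integral_peak_one : ∫ z, peak 1 z = 8 * Real.pi := by
  have h := integral_fun_norm_addHaar (volume : Measure Space)
    (fun r : ℝ => 15 * invSqrt 1 (r ^ 2) ^ 7)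
  have e : (fun z => peak 1 z) = fun z : Space => 15 * invSqrt 1 (‖z‖ ^ 2) ^ 7 := by
    funext z; rw [peak]; ring
  have hb : (volume : Measure Space).real (Metric.ball 0 1) = Real.pi * 4 / 3 := by
    rw [Measure.real, EuclideanSpace.volume_ball_fin_three]
    simp only [ENNReal.ofReal_one, one_pow, one_mul]
    rw [ENNReal.toReal_ofReal (by positivity)]
  rw [e, h, hb, finrank_euclideanSpace_fin]
  simp only [smul_eq_mul, Nat.reduceSub]
  rw [integral_peak_radial]
  simp
  ring

/-- The Bochner integral of a non-integrable function is 0, whereas this one is 8π. -/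
theorem integrable_peak_one : Integrable (peak 1) := by
  by_contra h
  have := integral_peak_one
  rw [integral_undef h] at this
  linarith [Real.pi_pos]

theorem peak_scale {c : ℝ} (hc : 0 < c) (z : Space) : peak (c ^ 2)⁻¹ z = c ^ 3 * peak 1 (c • z) := by
  have h1 : invSqrt (c ^ 2)⁻¹ (‖z‖ ^ 2) = c * invSqrt 1 (‖c • z‖ ^ 2) := by
    have e1 : ‖z‖ ^ 2 + (c ^ 2)⁻¹ = (c ^ 2)⁻¹ * (‖c • z‖ ^ 2 + 1) := by
      rw [norm_smul, Real.norm_of_nonneg hc.le]; field_simp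
    rw [invSqrt, e1, Real.sqrt_mul (by positivity), Real.sqrt_inv, Real.sqrt_sq hc.le, invSqrt,
      mul_inv, inv_inv]
  rw [peak, peak, h1]
  field_simp

/-- Translation and dilation make the kernel fixed and put the small parameter into the argument of
g, where continuity and boundedness give the limit. -/
theorem pairing_peak {c : ℝ} (hc : 0 < c) {f g : Space → ℝ} (hf : IsRapid f) (hg : IsRapid g) :
    pairing (peak (c ^ 2)⁻¹) f g =
      ∫ r : Space × Space, f r.1 * (peak 1 r.2 * g (c⁻¹ • r.2 + r.1)) := by
  obtain ⟨C, hC0, hC⟩ := hg.bound 0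
  have hi : Integrable fun r : Space × Space => f r.1 * (peak 1 r.2 * g (c⁻¹ • r.2 + r.1)) := by
    refine ((hf.integrable.mul_prod integrable_peak_one).norm.const_mul C).mono' ?_
      (Filter.Eventually.of_forall fun r => ?_)
    · exact ((hf.continuous.measurable.comp measurable_fst).mul
        (((isKernel_peak one_pos).measurable.comp measurable_snd).mul
          (hg.continuous.measurable.comp (by fun_prop)))).aestronglyMeasurable
    · have h1 := hC (c⁻¹ • r.2 + r.1)
      rw [pow_zero, inv_one, mul_one] at h1
      rw [norm_mul, norm_mul, norm_mul, Real.norm_eq_abs (g _), ← mul_assoc, mul_comm C]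
      exact mul_le_mul_of_nonneg_left h1 (by positivity)
  have hpk := isKernel_peak (e := (c ^ 2)⁻¹) (by positivity)
  rw [pairing, Measure.volume_eq_prod, integral_prod _ (integrable_kernel_pairing hpk hf hg),
    integral_prod _ hi]
  congr 1; funext y
  dsimp only
  have h1 : ∫ x, peak (c ^ 2)⁻¹ (x - y) * (f y * g x) =
      f y * ∫ z, peak (c ^ 2)⁻¹ z * g (z + y) := by
    rw [← integral_const_mul, ← integral_add_right_eq_self _ y]
    congr 1; funext x
    rw [add_sub_cancel_right]; ring
  have h2 : ∫ z, peak (c ^ 2)⁻¹ z * g (z + y) = ∫ w, peak 1 w * g (c⁻¹ • w + y) := by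
    have e := Measure.integral_comp_smul (volume : Measure Space)
      (fun w => peak 1 w * g (c⁻¹ • w + y)) c
    rw [finrank_euclideanSpace_fin, abs_of_pos (by positivity), smul_eq_mul] at e
    have hc3 : c ^ 3 ≠ 0 := by positivity
    rw [inv_mul_eq_div, eq_div_iff hc3] at e
    rw [← e, ← integral_mul_const]
    congr 1; funext z
    rw [peak_scale hc, smul_smul, inv_mul_cancel₀ hc.ne', one_smul]
    ring
  rw [h1, h2, integral_const_mul]

theorem tendsto_pairing_peak {f g : Space → ℝ} (hf : IsRapid f) (hg : IsRapid g) :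
    Filter.Tendsto (fun n : ℕ => pairing (peak (((n : ℝ) + 1) ^ 2)⁻¹) f g) Filter.atTop
      (nhds (8 * Real.pi * ∫ x, f x * g x)) := by
  obtain ⟨C, hC0, hC⟩ := hg.bound 0
  have e0 : 8 * Real.pi * ∫ x, f x * g x =
      ∫ r : Space × Space, f r.1 * (peak 1 r.2 * g r.1) := by
    rw [← integral_peak_one, mul_comm, Measure.volume_eq_prod, ← integral_prod_mul]
    congr 1; funext r; ring
  rw [e0]
  simp only [fun n : ℕ => pairing_peak (c := (n : ℝ) + 1) (by positivity) hf hg]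
  have hlim : Filter.Tendsto (fun n : ℕ => ((n : ℝ) + 1)⁻¹) Filter.atTop (nhds 0) := by
    simpa [one_div] using tendsto_one_div_add_atTop_nhds_zero_nat (𝕜 := ℝ)
  refine tendsto_integral_of_dominated_convergence (fun r : Space × Space =>
    C * ‖f r.1 * peak 1 r.2‖) (fun n => ?_)
    ((hf.integrable.mul_prod integrable_peak_one).norm.const_mul C) (fun n => ?_) ?_
  · exact ((hf.continuous.measurable.comp measurable_fst).mul
      (((isKernel_peak one_pos).measurable.comp measurable_snd).mul
        (hg.continuous.measurable.comp (by fun_prop)))).aestronglyMeasurable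
  · refine Filter.Eventually.of_forall fun r => ?_
    have h1 := hC (((n : ℝ) + 1)⁻¹ • r.2 + r.1)
    rw [pow_zero, inv_one, mul_one] at h1
    rw [norm_mul, norm_mul, norm_mul, Real.norm_eq_abs (g _), ← mul_assoc, mul_comm C]
    exact mul_le_mul_of_nonneg_left h1 (by positivity)
  · refine Filter.Eventually.of_forall fun r => ?_
    refine Filter.Tendsto.const_mul _ (Filter.Tendsto.const_mul _ ?_)
    have h2 : Filter.Tendsto (fun n : ℕ => ((n : ℝ) + 1)⁻¹ • r.2 + r.1) Filter.atTop
        (nhds ((0 : ℝ) • r.2 + r.1)) := (hlim.smul_const _).add_const _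
    rw [zero_smul, zero_add] at h2
    exact (hg.continuous.tendsto _).comp h2

end Limit

/-! ### The fixed-time inequality for the singular field. -/

section FixedTime

variable {χ : ℝ → ℝ} {p q P Q : Space → ℝ}

theorem IsSchwartz.densT (hp : IsSchwartz p) (hq : IsSchwartz q) (hP : IsSchwartz P)
    (hQ : IsSchwartz Q) : IsSchwartz (densT p q P Q) :=
  ((hp.mul (hQ.sub hq.lap)).add (hq.mul (hp.lap.sub hP))).const_mul 2

theorem IsSchwartz.momT (hp : IsSchwartz p) (hq : IsSchwartz q) (hP : IsSchwartz P)
    (hQ : IsSchwartz Q) (j : Fin 3) : IsSchwartz (momT p q P Q j) :=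
  ((((hQ.sub hq.lap).mul (hq.pd j)).add (hp.mul ((hp.lap.sub hP).pd j))).sub
    (((hp.lap.sub hP).mul (hp.pd j)).add (hq.mul ((hQ.sub hq.lap).pd j)))).const_mul 2

/-- The interaction Morawetz inequality at a fixed time. -/
theorem pairing_morawetz_le (hχ : IsRadialCutoff χ)
    (hp : IsSchwartz p) (hq : IsSchwartz q) (hP : IsSchwartz P) (hQ : IsSchwartz Q) :
    8 * Real.pi * (∫ x, dens p q x * dens p q x)
      + ∑ j, (2 * pairing (field χ j) (massB p q P Q) (mom p q j)
        + 2 * pairing (field χ j) (dens p q) (momB p q P Q j)) ≤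
    ∑ j, (pairing (field χ j) (densT p q P Q) (mom p q j)
        + pairing (field χ j) (dens p q) (momT p q P Q j))
      + 8 * ∑ j, ∑ k, pairing (radialErrorKernel χ j k) (dens p q) (stress p q j k)
      + pairing (fun z => |bilaplaceProfile χ (‖z‖ ^ 2)|) (dens p q) (dens p q) := by
  have hρ := (hp.dens hq).isRapid
  have hT := fun j => (hp.mom hq j).isRapid
  -- The coefficient of the regularization error, independent of n.
  set E := ∑ j, (4 * pairing (fun _ => 1) (dens p q) (stress p q j j) -
        pairing (fun _ => 1) (mom p q j) (mom p q j)) with hE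
  set ε : ℕ → ℝ := fun n => (((n : ℝ) + 1) ^ 2)⁻¹ with hε
  have hεpos : ∀ n, 0 < ε n := fun n => by positivity
  have hε0 : Filter.Tendsto ε Filter.atTop (nhds 0) := by
    have h1 : Filter.Tendsto (fun n : ℕ => ((n : ℝ) + 1)⁻¹) Filter.atTop (nhds 0) := by
      simpa [one_div] using tendsto_one_div_add_atTop_nhds_zero_nat (𝕜 := ℝ)
    simpa [hε, inv_pow] using h1.pow 2
  have hlim : ∀ (f g : Space → ℝ), IsRapid f → IsRapid g → ∀ j, Filter.Tendsto (fun n =>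
      pairing (fun z => regProfile χ (ε n) (‖z‖ ^ 2) * z j) f g) Filter.atTop
      (nhds (pairing (field χ j) f g)) := fun f g hf hg j =>
    tendsto_pairing
      (fun n => ((isProfile_regProfile hχ (hεpos n)).hasKernelDeriv_field j 0).kernel.measurable)
      (fun n z => abs_regProfile_mul_coord_le hχ (hεpos n) j z)
      (fun z => tendsto_regProfile_mul_coord χ j z hε0) hf hg
  have hw := isKernel_bilaplaceProfile hχ
  have hineq : ∀ n, pairing (peak (ε n)) (dens p q) (dens p q)
      + ∑ j, (2 * pairing (fun z => regProfile χ (ε n) (‖z‖ ^ 2) * z j)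
          (massB p q P Q) (mom p q j)
        + 2 * pairing (fun z => regProfile χ (ε n) (‖z‖ ^ 2) * z j)
          (dens p q) (momB p q P Q j)) ≤
      ∑ j, (pairing (fun z => regProfile χ (ε n) (‖z‖ ^ 2) * z j) (densT p q P Q) (mom p q j)
        + pairing (fun z => regProfile χ (ε n) (‖z‖ ^ 2) * z j) (dens p q) (momT p q P Q j))
      + 8 * ∑ j, ∑ k, pairing (radialErrorKernel χ j k) (dens p q) (stress p q j k)
      + pairing (fun z => |bilaplaceProfile χ (‖z‖ ^ 2)|) (dens p q) (dens p q)
      + √(ε n) * E := by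
    intro n
    have h1 := pairing_morawetz_identity (isProfile_regProfile hχ (hεpos n)) hp hq hP hQ
    have h2 := sum_pairing_fieldDeriv_ge hχ (hεpos n) hp hq
    have h3 : pairing (fun z => 30 * regProfile₁ χ (ε n) (‖z‖ ^ 2)
        + 40 * ‖z‖ ^ 2 * regProfile₂ χ (ε n) (‖z‖ ^ 2)
        + 8 * (‖z‖ ^ 2) ^ 2 * regProfile₃ χ (ε n) (‖z‖ ^ 2)) (dens p q) (dens p q) =
        -(pairing (peak (ε n)) (dens p q) (dens p q)) -
          pairing (fun z => bilaplaceProfile χ (‖z‖ ^ 2)) (dens p q) (dens p q) := by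
      simp only [regProfile_bilaplace (hεpos n) (sq_nonneg _)]
      have hn := (integrable_kernel_pairing (isKernel_peak (hεpos n)) hρ hρ).neg
      simp only [Pi.neg_def] at hn
      rw [pairing, pairing, pairing, ← integral_neg, ← integral_sub hn
        (integrable_kernel_pairing hw hρ hρ)]
      congr 1; funext r
      rw [peak]; ring
    -- The annular part of the bilaplacian has no sign; as ρ(y)ρ(x) ≥ 0 it can be replaced by its
    -- absolute value.
    have h4 : -pairing (fun z => |bilaplaceProfile χ (‖z‖ ^ 2)|) (dens p q) (dens p q) ≤
        pairing (fun z => bilaplaceProfile χ (‖z‖ ^ 2)) (dens p q) (dens p q) := by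
      have hwa : IsKernel fun z => |bilaplaceProfile χ (‖z‖ ^ 2)| := by
        refine ⟨hw.measurable.abs, ?_⟩
        simpa only [abs_abs] using hw.growth
      rw [pairing, pairing, ← integral_neg]
      refine integral_mono (integrable_kernel_pairing hwa hρ hρ).neg
        (integrable_kernel_pairing hw hρ hρ) fun r => ?_
      have hnn : 0 ≤ dens p q r.1 * dens p q r.2 := by
        unfold dens
        exact mul_nonneg (add_nonneg (mul_self_nonneg _) (mul_self_nonneg _))
          (add_nonneg (mul_self_nonneg _) (mul_self_nonneg _))
      have := mul_le_mul_of_nonneg_right (neg_abs_le (bilaplaceProfile χ (‖r.2 - r.1‖ ^ 2))) hnn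
      dsimp only
      linarith
    rw [h1, h3]
    linarith
  have hsq : Filter.Tendsto (fun n => √(ε n) * E) Filter.atTop (nhds 0) := by
    have h1 := (Real.continuous_sqrt.tendsto 0).comp hε0
    rw [Real.sqrt_zero] at h1
    simpa using h1.mul_const E
  have L := le_of_tendsto_of_tendsto'
    ((tendsto_pairing_peak hρ hρ).add (tendsto_finsetSum Finset.univ fun j _ =>
      ((hlim _ _ (hp.massB hq hP hQ).isRapid (hT j) j).const_mul 2).add
      ((hlim _ _ hρ (hp.momB hq hP hQ j).isRapid j).const_mul 2)))
    ((((tendsto_finsetSum Finset.univ fun j _ =>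
      (hlim _ _ (hp.densT hq hP hQ).isRapid (hT j) j).add
      (hlim _ _ hρ (hp.momT hq hP hQ j).isRapid j)).add_const _).add_const _).add hsq) hineq
  simpa using L

end FixedTime

/-! ### Integration in time of pairings. -/

section TimeIntegration

variable {a b : ℝ}

variable (a b) in
/-- Lebesgue measure on the time interval. -/
noncomputable def timeMeasure : Measure (Set.Icc a b) := Measure.comap Subtype.val volume

instance isFiniteMeasure_timeMeasure : IsFiniteMeasure (timeMeasure a b) := by
  refine ⟨?_⟩
  rw [timeMeasure, comap_subtype_coe_apply measurableSet_Icc, Set.image_univ, Subtype.range_coe]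
  exact measure_Icc_lt_top

theorem integral_timeMeasure (f : ℝ → ℝ) :
    ∫ t : Set.Icc a b, f t ∂(timeMeasure a b) = ∫ t in Set.Icc a b, f t :=
  integral_subtype_comap measurableSet_Icc f

theorem RapidFamily.isRapid {τ : Type*} [TopologicalSpace τ] {f : τ → Space → ℝ}
    (hf : RapidFamily f) (t : τ) : IsRapid (f t) :=
  hf.comp (continuous_const (y := t))

theorem SchwartzFamily.isSchwartz {τ : Type*} [TopologicalSpace τ] {f : τ → Space → ℝ}
    (hf : SchwartzFamily f) (t : τ) : IsSchwartz (f t) :=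
  hf.comp (continuous_const (y := t))

theorem integrable_kernel_family {K : Space → ℝ} {f g : Set.Icc a b → Space → ℝ}
    (hK : IsKernel K) (hf : RapidFamily f) (hg : RapidFamily g) :
    Integrable (fun r : Set.Icc a b × (Space × Space) =>
      K (r.2.2 - r.2.1) * (f r.1 r.2.1 * g r.1 r.2.2)) ((timeMeasure a b).prod volume) := by
  obtain ⟨C, m, hC0, hC⟩ := hK.bound_sub
  obtain ⟨D, hD0, hD⟩ := hf.bound (m + 4)
  obtain ⟨E, hE0, hE⟩ := hg.bound (m + 4)
  have hi := ((integrable_inv_one_add_norm_pow_four.mul_prod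
    integrable_inv_one_add_norm_pow_four).const_mul (C * D * E)).comp_snd (timeMeasure a b)
  refine hi.mono' ?_ (Filter.Eventually.of_forall fun r => ?_)
  · refine Measurable.aestronglyMeasurable ?_
    have h1 : Measurable fun r : Set.Icc a b × (Space × Space) => K (r.2.2 - r.2.1) :=
      hK.measurable.comp (by fun_prop)
    have h2 : Continuous fun r : Set.Icc a b × (Space × Space) => f r.1 r.2.1 :=
      hf.continuous.comp (by fun_prop : Continuous fun r : Set.Icc a b × (Space × Space) =>
        (r.1, r.2.1))
    have h3 : Continuous fun r : Set.Icc a b × (Space × Space) => g r.1 r.2.2 :=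
      hg.continuous.comp (by fun_prop : Continuous fun r : Set.Icc a b × (Space × Space) =>
        (r.1, r.2.2))
    exact h1.mul (h2.measurable.mul h3.measurable)
  · exact abs_kernel_mul_le hD0 (by positivity) (by positivity) (hC _ _) (hD _ _) (hE _ _)

theorem integrable_pairing_family {K : Space → ℝ} {f g : Set.Icc a b → Space → ℝ}
    (hK : IsKernel K) (hf : RapidFamily f) (hg : RapidFamily g) :
    Integrable (fun t => pairing K (f t) (g t)) (timeMeasure a b) :=
  (integrable_kernel_family hK hf hg).integral_prod_left

/-- The fundamental theorem of calculus for time-dependent pairings. -/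
theorem integral_deriv_pairing (hab : a < b) {K : Space → ℝ} {F G F' G' : ℝ → Space → ℝ}
    (hK : IsKernel K) (hF : RapidFamily fun t : Set.Icc a b => F t)
    (hG : RapidFamily fun t : Set.Icc a b => G t) (hF' : RapidFamily fun t : Set.Icc a b => F' t)
    (hG' : RapidFamily fun t : Set.Icc a b => G' t)
    (dF : ∀ t ∈ Set.Ioo a b, ∀ x, HasDerivAt (fun s => F s x) (F' t x) t)
    (dG : ∀ t ∈ Set.Ioo a b, ∀ x, HasDerivAt (fun s => G s x) (G' t x) t) :
    ∫ t : Set.Icc a b, (pairing K (F' t) (G t) + pairing K (F t) (G' t))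
      ∂(timeMeasure a b) =
      pairing K (F b) (G b) - pairing K (F a) (G a) := by
  have i1 := integrable_kernel_family hK hF' hG
  have i2 := integrable_kernel_family hK hF hG'
  have i12 := i1.add i2
  simp only [Pi.add_def] at i12
  have hcont : ∀ {H : ℝ → Space → ℝ}, RapidFamily (fun t : Set.Icc a b => H t) → ∀ x,
      ContinuousOn (fun t => H t x) (Set.Icc a b) := fun hH x => by
    rw [continuousOn_iff_continuous_domRestrict]
    exact hH.continuous.comp (Continuous.prodMk_left x)
  have e1 : ∀ t : Set.Icc a b, pairing K (F' t) (G t) + pairing K (F t) (G' t) =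
      ∫ r : Space × Space, (K (r.2 - r.1) * (F' t r.1 * G t r.2) +
        K (r.2 - r.1) * (F t r.1 * G' t r.2)) := fun t =>
    (integral_add (integrable_kernel_pairing hK (hF'.isRapid t) (hG.isRapid t))
      (integrable_kernel_pairing hK (hF.isRapid t) (hG'.isRapid t))).symm
  simp only [e1]
  -- Exchanging the integrals reduces to the fundamental theorem of calculus at fixed x and y, so
  -- the kernel never has to be differentiated.
  have swap := integral_integral_swap (f := fun (t : Set.Icc a b) (r : Space × Space) =>
    K (r.2 - r.1) * (F' t r.1 * G t r.2) + K (r.2 - r.1) * (F t r.1 * G' t r.2)) i12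
  rw [swap, pairing, pairing, ← integral_sub
    (integrable_kernel_pairing hK (hF.isRapid ⟨b, Set.right_mem_Icc.2 hab.le⟩)
      (hG.isRapid ⟨b, Set.right_mem_Icc.2 hab.le⟩))
    (integrable_kernel_pairing hK (hF.isRapid ⟨a, Set.left_mem_Icc.2 hab.le⟩)
      (hG.isRapid ⟨a, Set.left_mem_Icc.2 hab.le⟩))]
  congr 1; funext r
  have e2 : ∫ t : Set.Icc a b, (K (r.2 - r.1) * (F' t r.1 * G t r.2) +
      K (r.2 - r.1) * (F t r.1 * G' t r.2)) ∂(timeMeasure a b) =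
      K (r.2 - r.1) * ∫ t in Set.Icc a b, (F' t r.1 * G t r.2 + F t r.1 * G' t r.2) := by
    rw [← integral_timeMeasure, ← integral_const_mul]
    refine integral_congr_ae (Filter.Eventually.of_forall fun t => ?_)
    dsimp only
    ring
  -- Continuity up to the end points gives integrability; derivatives in time are used only in the
  -- open interval.
  have hc : ContinuousOn (fun t => F' t r.1 * G t r.2 + F t r.1 * G' t r.2) (Set.Icc a b) :=
    ((hcont hF' _).mul (hcont hG _)).add ((hcont hF _).mul (hcont hG' _))
  rw [e2, integral_Icc_eq_integral_Ioc, ← intervalIntegral.integral_of_le hab.le,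
    intervalIntegral.integral_eq_sub_of_hasDerivAt_of_le hab.le
      ((hcont hF r.1).mul (hcont hG r.2)) (fun t ht => (dF t ht r.1).mul (dG t ht r.2))
      (by
        rw [← Set.uIcc_of_le hab.le] at hc
        exact hc.intervalIntegrable)]
  simp only [Pi.mul_apply]
  ring

end TimeIntegration

/-! ### Time derivatives of the densities through the equation. -/

section TimeDerivatives

variable {a b : ℝ} {φ N : ℝ → Space → ℂ}

theorem IsSchwartzOnSlab.contDiffAt (h : IsSchwartzOnSlab a b φ) {t : ℝ} (ht : t ∈ Set.Ioo a b)
    (x : Space) : ContDiffAt ℝ ∞ (fun p : ℝ × Space => φ p.1 p.2) (t, x) :=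
  h.smooth.contDiffAt (prod_mem_nhds (Icc_mem_nhds ht.1 ht.2) Filter.univ_mem)

/-- The time derivative of a field, as a function on space-time. -/
noncomputable def timeDeriv (φ : ℝ → Space → ℂ) (t : ℝ) (x : Space) : ℂ :=
  fderiv ℝ (fun p : ℝ × Space => φ p.1 p.2) (t, x) (1, 0)

theorem IsSchwartzOnSlab.hasDerivAt (h : IsSchwartzOnSlab a b φ) {t : ℝ} (ht : t ∈ Set.Ioo a b)
    (x : Space) : HasDerivAt (fun s => φ s x) (timeDeriv φ t x) t := by
  have h1 := ((h.contDiffAt ht x).differentiableAt (by simp)).hasFDerivAt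
  exact HasFDerivAt.comp_hasDerivAt (f := fun s : ℝ => (s, x)) t h1
    ((hasDerivAt_id t).prodMk (hasDerivAt_const t x))

theorem IsSchwartzOnSlab.partialDeriv_eq_fderiv (h : IsSchwartzOnSlab a b φ) {t : ℝ}
    (ht : t ∈ Set.Ioo a b) (x : Space) (j : Fin 3) :
    InteractionMorawetz.partialDeriv (φ t) j x =
      fderiv ℝ (fun p : ℝ × Space => φ p.1 p.2) (t, x) (0, EuclideanSpace.single j (1 : ℝ)) := by
  have h1 := ((h.contDiffAt ht x).differentiableAt (by simp)).hasFDerivAt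
  have h2 := HasFDerivAt.comp (f := fun y : Space => (t, y)) x h1 (hasFDerivAt_prodMk_right t x)
  rw [InteractionMorawetz.partialDeriv]
  change fderiv ℝ ((fun p : ℝ × Space => φ p.1 p.2) ∘ fun y : Space => (t, y)) x _ = _
  rw [h2.fderiv]
  simp

/-- Time derivatives commute with spatial derivatives. -/
theorem IsSchwartzOnSlab.hasDerivAt_partialDeriv (h : IsSchwartzOnSlab a b φ) {t : ℝ}
    (ht : t ∈ Set.Ioo a b) (x : Space) (j : Fin 3) :
    HasDerivAt (fun s => InteractionMorawetz.partialDeriv (φ s) j x)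
      (InteractionMorawetz.partialDeriv (timeDeriv φ t) j x) t := by
  set Φ := fun p : ℝ × Space => φ p.1 p.2 with hΦ
  have hc := h.contDiffAt ht x
  have hsym : IsSymmSndFDerivAt ℝ Φ (t, x) := hc.isSymmSndFDerivAt (by
    rw [minSmoothness_of_isRCLikeNormedField]
    exact ENat.LEInfty.out)
  have hd : HasFDerivAt (fderiv ℝ Φ) (fderiv ℝ (fderiv ℝ Φ) (t, x)) (t, x) :=
    ((hc.fderiv_right (m := ∞) (by simp)).differentiableAt (by simp)).hasFDerivAt
  have hev : ∀ v : ℝ × Space, HasFDerivAt (fun p => fderiv ℝ Φ p v)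
      ((fderiv ℝ (fderiv ℝ Φ) (t, x)).flip v) (t, x) := fun v => by
    refine (hd.clm_apply (hasFDerivAt_const v (t, x))).congr_fderiv ?_
    simp
  have h1 : HasDerivAt (fun s => fderiv ℝ Φ (s, x) (0, EuclideanSpace.single j (1 : ℝ)))
      (fderiv ℝ (fderiv ℝ Φ) (t, x) (1, 0) (0, EuclideanSpace.single j (1 : ℝ))) t :=
    HasFDerivAt.comp_hasDerivAt (f := fun s : ℝ => (s, x)) t (hev _)
      ((hasDerivAt_id t).prodMk (hasDerivAt_const t x))
  have h2 : InteractionMorawetz.partialDeriv (timeDeriv φ t) j x =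
      fderiv ℝ (fderiv ℝ Φ) (t, x) (0, EuclideanSpace.single j (1 : ℝ)) (1, 0) := by
    have h3 := HasFDerivAt.comp (f := fun y : Space => (t, y)) x (hev (1, 0))
      (hasFDerivAt_prodMk_right t x)
    rw [InteractionMorawetz.partialDeriv]
    change fderiv ℝ ((fun p => fderiv ℝ Φ p (1, 0)) ∘ fun y : Space => (t, y)) x _ = _
    rw [h3.fderiv]
    simp
  rw [h2, ← hsym (1, 0) (0, EuclideanSpace.single j (1 : ℝ))]
  refine h1.congr_of_eventuallyEq ?_
  filter_upwards [Ioo_mem_nhds ht.1 ht.2] with s hs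
  exact h.partialDeriv_eq_fderiv hs x j

theorem lap_clm_comp {f : Space → ℂ} (hf : ContDiff ℝ ∞ f) (L : ℂ →L[ℝ] ℝ) (x : Space) :
    lap (fun x => L (f x)) x = L (Laplacian.laplacian f x) := by
  have hd : DifferentiableAt ℝ (fderiv ℝ f) x :=
    (hf.fderiv_right (m := ∞) (by simp)).differentiable (by simp) x
  rw [InnerProductSpace.laplacian_eq_iteratedFDeriv_orthonormalBasis f
    (EuclideanSpace.basisFun (Fin 3) ℝ), lap, map_sum]
  refine Finset.sum_congr rfl fun k _ => ?_
  have hk : ContDiff ℝ ∞ (partialDeriv f k) :=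
    (hf.fderiv_right (m := ∞) (by simp)).clm_apply contDiff_const
  rw [pd_clm_comp hf L k, pd_clm_comp hk L k, iteratedFDeriv_two_apply]
  change L (fderiv ℝ (fun y => fderiv ℝ f y (EuclideanSpace.single k 1)) x _) = _
  rw [fderiv_clm_apply hd (differentiableAt_const _)]
  simp

theorem IsSchwartzSolution.timeDeriv_eq (h : IsSchwartzSolution a b φ N) {t : ℝ}
    (ht : t ∈ Set.Ioo a b) (x : Space) :
    timeDeriv φ t x = Complex.I * (Laplacian.laplacian (φ t) x - N t x) := by
  have h1 := h.equation t (Set.Ioo_subset_Icc_self ht) x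
  have h2 : derivWithin (fun s => φ s x) (Set.Icc a b) t = timeDeriv φ t x := by
    rw [derivWithin_of_mem_nhds (Icc_mem_nhds ht.1 ht.2), (h.schwartz.hasDerivAt ht x).deriv]
  rw [h2] at h1
  -- The equation is multiplied by −i, and i² = −1 isolates the time derivative.
  linear_combination (-Complex.I) * h1 + timeDeriv φ t x * Complex.I_mul_I

/-- The real part of a complex-valued function. -/
noncomputable def rp (u : Space → ℂ) (x : Space) : ℝ := Complex.reCLM (u x)

/-- The imaginary part of a complex-valued function. -/
noncomputable def ip (u : Space → ℂ) (x : Space) : ℝ := Complex.imCLM (u x)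

theorem IsSchwartzSolution.re_timeDeriv (h : IsSchwartzSolution a b φ N) {t : ℝ}
    (ht : t ∈ Set.Ioo a b) :
    (fun x => Complex.reCLM (timeDeriv φ t x)) = reT (ip (φ t)) (ip (N t)) := by
  funext x
  rw [h.timeDeriv_eq ht, reT]
  unfold ip
  rw [lap_clm_comp (h.schwartz.contDiff (Set.Ioo_subset_Icc_self ht))]
  simp

theorem IsSchwartzSolution.im_timeDeriv (h : IsSchwartzSolution a b φ N) {t : ℝ}
    (ht : t ∈ Set.Ioo a b) :
    (fun x => Complex.imCLM (timeDeriv φ t x)) = imT (rp (φ t)) (rp (N t)) := by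
  funext x
  rw [h.timeDeriv_eq ht, imT]
  unfold rp
  rw [lap_clm_comp (h.schwartz.contDiff (Set.Ioo_subset_Icc_self ht))]
  simp

theorem IsSchwartzOnSlab.hasDerivAt_clm (h : IsSchwartzOnSlab a b φ) {t : ℝ}
    (ht : t ∈ Set.Ioo a b) (L : ℂ →L[ℝ] ℝ) (x : Space) :
    HasDerivAt (fun s => L (φ s x)) (L (timeDeriv φ t x)) t :=
  L.hasFDerivAt.comp_hasDerivAt t (h.hasDerivAt ht x)

theorem IsSchwartzOnSlab.contDiff_timeDeriv (h : IsSchwartzOnSlab a b φ) {t : ℝ}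
    (ht : t ∈ Set.Ioo a b) : ContDiff ℝ ∞ (timeDeriv φ t) := by
  rw [contDiff_iff_contDiffAt]
  intro x
  have h1 : ContDiffAt ℝ ∞ (fun p => fderiv ℝ (fun p : ℝ × Space => φ p.1 p.2) p (1, 0)) (t, x) :=
    ((h.contDiffAt ht x).fderiv_right (m := ∞) (by simp)).clm_apply contDiffAt_const
  exact ContDiffAt.comp (f := fun y : Space => (t, y)) x h1
    (contDiffAt_const.prodMk contDiffAt_id)

theorem IsSchwartzOnSlab.hasDerivAt_pd_clm (h : IsSchwartzOnSlab a b φ) {t : ℝ}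
    (ht : t ∈ Set.Ioo a b) (L : ℂ →L[ℝ] ℝ) (j : Fin 3) (x : Space) :
    HasDerivAt (fun s => pd j (fun y => L (φ s y)) x)
      (pd j (fun y => L (timeDeriv φ t y)) x) t := by
  rw [pd_clm_comp (h.contDiff_timeDeriv ht)]
  refine (L.hasFDerivAt.comp_hasDerivAt t (h.hasDerivAt_partialDeriv ht x j)).congr_of_eventuallyEq
    ?_
  filter_upwards [Ioo_mem_nhds ht.1 ht.2] with s hs
  rw [pd_clm_comp (h.contDiff (Set.Ioo_subset_Icc_self hs))]
  rfl

theorem IsSchwartzSolution.hasDerivAt_dens (h : IsSchwartzSolution a b φ N) {t : ℝ}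
    (ht : t ∈ Set.Ioo a b) (x : Space) :
    HasDerivAt (fun s => dens (rp (φ s)) (ip (φ s)) x)
      (densT (rp (φ t)) (ip (φ t)) (rp (N t)) (ip (N t)) x) t := by
  have h1 := h.schwartz.hasDerivAt_clm ht Complex.reCLM x
  have h2 := h.schwartz.hasDerivAt_clm ht Complex.imCLM x
  rw [congrFun (h.re_timeDeriv ht) x] at h1
  rw [congrFun (h.im_timeDeriv ht) x] at h2
  refine ((h1.mul h1).add (h2.mul h2)).congr_deriv ?_
  simp only [densT, rp, ip]
  ring

theorem IsSchwartzSolution.hasDerivAt_mom (h : IsSchwartzSolution a b φ N) {t : ℝ}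
    (ht : t ∈ Set.Ioo a b) (j : Fin 3) (x : Space) :
    HasDerivAt (fun s => mom (rp (φ s)) (ip (φ s)) j x)
      (momT (rp (φ t)) (ip (φ t)) (rp (N t)) (ip (N t)) j x) t := by
  have h1 := h.schwartz.hasDerivAt_clm ht Complex.reCLM x
  have h2 := h.schwartz.hasDerivAt_clm ht Complex.imCLM x
  have h3 := h.schwartz.hasDerivAt_pd_clm ht Complex.reCLM j x
  have h4 := h.schwartz.hasDerivAt_pd_clm ht Complex.imCLM j x
  rw [h.re_timeDeriv ht] at h3
  rw [h.im_timeDeriv ht] at h4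
  rw [congrFun (h.re_timeDeriv ht) x] at h1
  rw [congrFun (h.im_timeDeriv ht) x] at h2
  exact ((h1.mul h4).sub (h2.mul h3)).const_mul 2

end TimeDerivatives

/-! ### Densities and moduli of Schwartz families. -/

section FamilyClosure

variable {τ : Type*} [TopologicalSpace τ] {p q P Q : τ → Space → ℝ}

/-- Intended for |u| and |∇u|, which are continuous and rapidly decreasing but need not be smooth at
their zeros. -/
theorem RapidFamily.of_abs_le {f g : τ → Space → ℝ} (hf : RapidFamily f)
    (hg : Continuous fun r : τ × Space => g r.1 r.2) (h : ∀ t x, |g t x| ≤ f t x) :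
    RapidFamily g := by
  refine ⟨hg, fun k => ?_⟩
  obtain ⟨C, hC⟩ := hf.decay k
  exact ⟨C, fun t x => (mul_le_mul_of_nonneg_left ((h t x).trans (le_abs_self _))
    (by positivity)).trans (hC t x)⟩

theorem RapidFamily.abs {f : τ → Space → ℝ} (hf : RapidFamily f) :
    RapidFamily fun t x => |f t x| := by
  refine ⟨hf.continuous.abs, fun k => ?_⟩
  simpa only [abs_abs] using hf.decay k

theorem SchwartzFamily.dens (hp : SchwartzFamily p) (hq : SchwartzFamily q) :
    SchwartzFamily fun t => dens (p t) (q t) :=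
  (hp.mul hp).add (hq.mul hq)

theorem SchwartzFamily.mom (hp : SchwartzFamily p) (hq : SchwartzFamily q) (j : Fin 3) :
    SchwartzFamily fun t => mom (p t) (q t) j :=
  ((hp.mul (hq.pd j)).sub (hq.mul (hp.pd j))).const_mul 2

theorem SchwartzFamily.stress (hp : SchwartzFamily p) (hq : SchwartzFamily q) (j k : Fin 3) :
    SchwartzFamily fun t => stress (p t) (q t) j k :=
  ((hp.pd j).mul (hp.pd k)).add ((hq.pd j).mul (hq.pd k))

theorem SchwartzFamily.lap {f : τ → Space → ℝ} (hf : SchwartzFamily f) :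
    SchwartzFamily fun t => lap (f t) :=
  SchwartzFamily.sum3 fun k => (hf.pd k).pd k

theorem SchwartzFamily.massB (hp : SchwartzFamily p) (hq : SchwartzFamily q)
    (hP : SchwartzFamily P) (hQ : SchwartzFamily Q) :
    SchwartzFamily fun t => massB (p t) (q t) (P t) (Q t) :=
  (hQ.mul hp).sub (hP.mul hq)

theorem SchwartzFamily.momB (hp : SchwartzFamily p) (hq : SchwartzFamily q)
    (hP : SchwartzFamily P) (hQ : SchwartzFamily Q) (j : Fin 3) :
    SchwartzFamily fun t => momB (p t) (q t) (P t) (Q t) j :=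
  ((hP.mul (hp.pd j)).add (hQ.mul (hq.pd j))).sub ((hp.mul (hP.pd j)).add (hq.mul (hQ.pd j)))

theorem SchwartzFamily.densT (hp : SchwartzFamily p) (hq : SchwartzFamily q)
    (hP : SchwartzFamily P) (hQ : SchwartzFamily Q) :
    SchwartzFamily fun t => densT (p t) (q t) (P t) (Q t) :=
  ((hp.mul (hQ.sub hq.lap)).add (hq.mul (hp.lap.sub hP))).const_mul 2

theorem SchwartzFamily.momT (hp : SchwartzFamily p) (hq : SchwartzFamily q)
    (hP : SchwartzFamily P) (hQ : SchwartzFamily Q) (j : Fin 3) :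
    SchwartzFamily fun t => momT (p t) (q t) (P t) (Q t) j :=
  ((((hQ.sub hq.lap).mul (hq.pd j)).add (hp.mul ((hp.lap.sub hP).pd j))).sub
    (((hp.lap.sub hP).mul (hp.pd j)).add (hq.mul ((hQ.sub hq.lap).pd j)))).const_mul 2

/-- The modulus of `u = p + i q`. -/
noncomputable def modulus (p q : Space → ℝ) (x : Space) : ℝ := √(dens p q x)

/-- The modulus of the gradient of `u = p + i q`. -/
noncomputable def gradModulus (p q : Space → ℝ) (x : Space) : ℝ := √(∑ j, stress p q j j x)

theorem dens_nonneg (p q : Space → ℝ) (x : Space) : 0 ≤ dens p q x :=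
  add_nonneg (mul_self_nonneg _) (mul_self_nonneg _)

theorem stress_self_nonneg (p q : Space → ℝ) (j : Fin 3) (x : Space) : 0 ≤ stress p q j j x :=
  add_nonneg (mul_self_nonneg _) (mul_self_nonneg _)

theorem SchwartzFamily.modulus (hp : SchwartzFamily p) (hq : SchwartzFamily q) :
    RapidFamily fun t => modulus (p t) (q t) := by
  refine (hp.rapid.abs.add hq.rapid.abs).of_abs_le
    (Real.continuous_sqrt.comp (hp.dens hq).rapid.continuous) fun t x => ?_
  rw [InteractionMorawetz.modulus, abs_of_nonneg (Real.sqrt_nonneg _),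
    Real.sqrt_le_left (by positivity), InteractionMorawetz.dens]
  nlinarith [abs_mul_abs_self (p t x), abs_mul_abs_self (q t x),
    mul_nonneg (abs_nonneg (p t x)) (abs_nonneg (q t x))]

theorem SchwartzFamily.gradModulus (hp : SchwartzFamily p) (hq : SchwartzFamily q) :
    RapidFamily fun t => gradModulus (p t) (q t) := by
  have hm := fun j => (hp.pd j).modulus (hq.pd j)
  refine (((hm 0).add (hm 1)).add (hm 2)).of_abs_le (Real.continuous_sqrt.comp
    (SchwartzFamily.sum3 fun j => hp.stress hq j j).rapid.continuous) fun t x => ?_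
  have hn : ∀ j, 0 ≤ InteractionMorawetz.modulus (InteractionMorawetz.pd j (p t))
    (InteractionMorawetz.pd j (q t)) x := fun j => Real.sqrt_nonneg _
  have hs : ∀ j, InteractionMorawetz.modulus (InteractionMorawetz.pd j (p t))
    (InteractionMorawetz.pd j (q t)) x ^ 2 = InteractionMorawetz.stress (p t) (q t) j j x :=
    fun j => Real.sq_sqrt (dens_nonneg _ _ _)
  rw [InteractionMorawetz.gradModulus, abs_of_nonneg (Real.sqrt_nonneg _),
    Real.sqrt_le_left (by linarith [hn 0, hn 1, hn 2]), Fin.sum_univ_three, ← hs, ← hs, ← hs]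
  nlinarith [mul_nonneg (hn 0) (hn 1), mul_nonneg (hn 0) (hn 2), mul_nonneg (hn 1) (hn 2)]

end FamilyClosure

/-! ### Bounds for the action, the mass bracket and the annular errors. -/

section Bounds

variable {χ : ℝ → ℝ} {p q P Q : Space → ℝ}

theorem IsSchwartz.modulus (hp : IsSchwartz p) (hq : IsSchwartz q) : IsRapid (modulus p q) :=
  SchwartzFamily.modulus hp hq

theorem IsSchwartz.gradModulus (hp : IsSchwartz p) (hq : IsSchwartz q) :
    IsRapid (gradModulus p q) :=
  SchwartzFamily.gradModulus hp hq

theorem IsRapid.mul {f g : Space → ℝ} (hf : IsRapid f) (hg : IsRapid g) :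
    IsRapid fun x => f x * g x :=
  RapidFamily.mul hf hg

theorem IsRapid.abs {f : Space → ℝ} (hf : IsRapid f) : IsRapid fun x => |f x| :=
  RapidFamily.abs hf

theorem sum_radialCoord_sq_le (z : Space) : ∑ j, radialCoord j z * radialCoord j z ≤ 1 := by
  have e : ∑ j, radialCoord j z * radialCoord j z = ‖z‖⁻¹ ^ 2 * ‖z‖ ^ 2 := by
    rw [norm_sq_eq_sum z, Finset.mul_sum]
    exact Finset.sum_congr rfl fun j _ => by rw [radialCoord]; ring
  rw [e]
  rcases eq_or_ne ‖z‖ 0 with h | h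
  · simp [h]
  · rw [← mul_pow, inv_mul_cancel₀ h, one_pow]

/-- The momentum density is bounded by `2 |u| |∇u|`. -/
theorem abs_sum_field_mul_mom_le (hχ : IsRadialCutoff χ) (z x : Space) :
    |∑ j, field χ j z * mom p q j x| ≤ χ ‖z‖ * (2 * (modulus p q x * gradModulus p q x)) := by
  have hχ0 := hχ.nonneg _ (norm_nonneg z)
  have e : ∑ j, field χ j z * mom p q j x = χ ‖z‖ * ∑ j, radialCoord j z * mom p q j x := by
    rw [Finset.mul_sum]
    exact Finset.sum_congr rfl fun j _ => by rw [field]; ring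
  rw [e, abs_mul, abs_of_nonneg hχ0]
  refine mul_le_mul_of_nonneg_left ?_ hχ0
  refine abs_le_of_sq_le_sq ?_ (by
    have := mul_nonneg (Real.sqrt_nonneg (dens p q x)) (Real.sqrt_nonneg (∑ j, stress p q j j x))
    unfold modulus gradModulus; linarith)
  have h1 : ∑ j, mom p q j x * mom p q j x ≤ 4 * (dens p q x * ∑ j, stress p q j j x) := by
    rw [Finset.mul_sum, Finset.mul_sum]
    refine Finset.sum_le_sum fun j _ => ?_
    simp only [mom, dens, stress]
    -- Lagrange's identity: (p² + q²)((∂p)² + (∂q)²) − (p∂q − q∂p)² = (p∂p + q∂q)².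
    nlinarith [sq_nonneg (p x * pd j p x + q x * pd j q x)]
  have h0 : 0 ≤ ∑ j, mom p q j x * mom p q j x := Finset.sum_nonneg fun j _ => mul_self_nonneg _
  calc (∑ j, radialCoord j z * mom p q j x) ^ 2
      ≤ (∑ j, radialCoord j z * radialCoord j z) * ∑ j, mom p q j x * mom p q j x :=
        sum_mul_sq_le (fun j => radialCoord j z) (fun j => mom p q j x)
    _ ≤ 1 * ∑ j, mom p q j x * mom p q j x :=
        mul_le_mul_of_nonneg_right (sum_radialCoord_sq_le z) h0
    _ ≤ 4 * (dens p q x * ∑ j, stress p q j j x) := by rw [one_mul]; exact h1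
    _ = (2 * (modulus p q x * gradModulus p q x)) ^ 2 := by
        rw [mul_pow, mul_pow, modulus, gradModulus, Real.sq_sqrt (dens_nonneg _ _ _),
          Real.sq_sqrt (Finset.sum_nonneg fun j _ => stress_self_nonneg _ _ _ _)]
        norm_num

theorem sum_pairing_eq {K : Fin 3 → Space → ℝ} {f : Space → ℝ} {g : Fin 3 → Space → ℝ}
    (hK : ∀ j, IsKernel (K j)) (hf : IsRapid f) (hg : ∀ j, IsRapid (g j)) :
    ∑ j, pairing (K j) f (g j) =
      ∫ r : Space × Space, f r.1 * ∑ j, K j (r.2 - r.1) * g j r.2 := by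
  simp only [pairing]
  rw [← integral_finsetSum _ fun j _ => integrable_kernel_pairing (hK j) hf (hg j)]
  congr 1; funext r
  rw [Finset.mul_sum]
  exact Finset.sum_congr rfl fun j _ => by ring

theorem isKernel_cutoff_norm (hχ : IsRadialCutoff χ) : IsKernel fun z => |χ ‖z‖| :=
  IsKernel.of_bounded (C := ⨆ r : Set.Ici (0 : ℝ), χ r) (measurable_cutoff_norm hχ).abs fun z => by
    rw [abs_abs, abs_of_nonneg (hχ.nonneg _ (norm_nonneg z))]
    exact hχ.le_iSup (norm_nonneg z)

theorem integrable_sum_kernel {K : Fin 3 → Space → ℝ} {f : Space → ℝ} {g : Fin 3 → Space → ℝ}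
    (hK : ∀ j, IsKernel (K j)) (hf : IsRapid f) (hg : ∀ j, IsRapid (g j)) :
    Integrable fun r : Space × Space => f r.1 * ∑ j, K j (r.2 - r.1) * g j r.2 := by
  refine (integrable_finsetSum Finset.univ fun j _ =>
    integrable_kernel_pairing (hK j) hf (hg j)).congr (Filter.Eventually.of_forall fun r => ?_)
  dsimp only
  rw [Finset.mul_sum]
  exact Finset.sum_congr rfl fun j _ => by ring

/-- Serves twice: with the mass bracket in place of f for the forcing term, and with the density for
the action. -/
theorem abs_sum_pairing_field_le (hχ : IsRadialCutoff χ) (hp : IsSchwartz p) (hq : IsSchwartz q)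
    {f : Space → ℝ} (hf : IsRapid f) :
    |∑ j, pairing (field χ j) f (mom p q j)| ≤
      2 * pairing (fun z => |χ ‖z‖|) (fun x => |f x|)
        (fun x => modulus p q x * gradModulus p q x) := by
  have hm := fun j => (hp.mom hq j).isRapid
  have hi := integrable_kernel_pairing (isKernel_cutoff_norm hχ) hf.abs
    ((hp.modulus hq).mul (hp.gradModulus hq))
  rw [sum_pairing_eq (isKernel_field hχ) hf hm, pairing, ← integral_const_mul]
  refine (abs_integral_le_integral_abs).trans (integral_mono
    (integrable_sum_kernel (isKernel_field hχ) hf hm).abs (hi.const_mul 2) fun r => ?_)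
  dsimp only
  rw [abs_mul, abs_of_nonneg (hχ.nonneg _ (norm_nonneg (r.2 - r.1)))]
  have := mul_le_mul_of_nonneg_left (abs_sum_field_mul_mom_le (p := p) (q := q) hχ (r.2 - r.1) r.2)
    (abs_nonneg (f r.1))
  linarith

theorem IsRapid.memLp_two {f : Space → ℝ} (hf : IsRapid f) : MemLp f 2 := by
  rw [memLp_two_iff_integrable_sq hf.continuous.aestronglyMeasurable]
  exact (hf.mul hf).integrable.congr (Filter.Eventually.of_forall fun x => (sq (f x)).symm)

theorem integral_modulus_mul_le (hp : IsSchwartz p) (hq : IsSchwartz q) :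
    ∫ x, modulus p q x * gradModulus p q x ≤
      √(∫ x, modulus p q x ^ 2) * √(∫ x, gradModulus p q x ^ 2) := by
  have h := integral_mul_le_Lp_mul_Lq_of_nonneg (μ := (volume : Measure Space))
    Real.HolderConjugate.two_two
    (f := modulus p q) (g := gradModulus p q)
    (Filter.Eventually.of_forall fun x => Real.sqrt_nonneg _)
    (Filter.Eventually.of_forall fun x => Real.sqrt_nonneg _)
    (by simpa using (hp.modulus hq).memLp_two) (by simpa using (hp.gradModulus hq).memLp_two)
  simpa only [Real.sqrt_eq_rpow, Real.rpow_two] using h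

/-- The Morawetz action is bounded by the mass and the energy. -/
theorem abs_action_le (hχ : IsRadialCutoff χ) (hp : IsSchwartz p) (hq : IsSchwartz q) :
    |∑ j, pairing (field χ j) (dens p q) (mom p q j)| ≤
      2 * (⨆ r : Set.Ici (0 : ℝ), χ r) * √(∫ x, modulus p q x ^ 2) ^ 3 *
        √(∫ x, gradModulus p q x ^ 2) := by
  set X := ⨆ r : Set.Ici (0 : ℝ), χ r with hX
  have hX0 : 0 ≤ X := (hχ.nonneg 0 le_rfl).trans (hχ.le_iSup le_rfl)
  have hd := (hp.dens hq).isRapid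
  have hmg := (hp.modulus hq).mul (hp.gradModulus hq)
  have hsq : ∀ x, modulus p q x ^ 2 = dens p q x := fun x => Real.sq_sqrt (dens_nonneg _ _ _)
  have hI0 : 0 ≤ ∫ x, modulus p q x ^ 2 := integral_nonneg fun x => sq_nonneg _
  have h1 : pairing (fun z => |χ ‖z‖|) (fun x => |dens p q x|)
      (fun x => modulus p q x * gradModulus p q x) ≤
      X * ((∫ x, dens p q x) * ∫ x, modulus p q x * gradModulus p q x) := by
    rw [← integral_prod_mul, ← integral_const_mul, pairing, Measure.volume_eq_prod]
    refine integral_mono (integrable_kernel_pairing (isKernel_cutoff_norm hχ) hd.abs hmg)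
      ((hd.integrable.mul_prod hmg.integrable).const_mul X) fun r => ?_
    dsimp only
    rw [abs_of_nonneg (dens_nonneg _ _ _), abs_of_nonneg (hχ.nonneg _ (norm_nonneg _))]
    exact mul_le_mul_of_nonneg_right (hχ.le_iSup (norm_nonneg _))
      (mul_nonneg (dens_nonneg _ _ _) (mul_nonneg (Real.sqrt_nonneg _) (Real.sqrt_nonneg _)))
  refine (abs_sum_pairing_field_le hχ hp hq hd).trans ?_
  have h2 := integral_modulus_mul_le hp hq
  simp only [← hsq] at h1
  calc 2 * pairing (fun z => |χ ‖z‖|) (fun x => |dens p q x|)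
          (fun x => modulus p q x * gradModulus p q x)
      ≤ 2 * (X * ((∫ x, modulus p q x ^ 2) * (√(∫ x, modulus p q x ^ 2) *
          √(∫ x, gradModulus p q x ^ 2)))) := by
        simp only [← hsq]
        refine mul_le_mul_of_nonneg_left (h1.trans ?_) zero_le_two
        gcongr
    _ = 2 * (X * (√(∫ x, modulus p q x ^ 2) ^ 2 * (√(∫ x, modulus p q x ^ 2) *
          √(∫ x, gradModulus p q x ^ 2)))) := by rw [Real.sq_sqrt hI0]
    _ = _ := by ring

/-- The annular error term of the interaction Morawetz inequality. -/
noncomputable def annularError (ψ : ℝ → ℝ) (p q : Space → ℝ) : ℝ :=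
  pairing (fun z => |ψ ‖z‖|) (dens p q) (dens p q) +
    ∑ j, ∑ k, pairing (fun z => |ψ ‖z‖| * (radialCoord j z * radialCoord k z)) (dens p q)
      (stress p q j k)

theorem sum_radialCoord_stress_nonneg (p q : Space → ℝ) (z x : Space) :
    0 ≤ ∑ j, ∑ k, radialCoord j z * radialCoord k z * stress p q j k x := by
  have e : ∑ j, ∑ k, radialCoord j z * radialCoord k z * stress p q j k x =
      (∑ j, radialCoord j z * pd j p x) ^ 2 + (∑ j, radialCoord j z * pd j q x) ^ 2 := by
    simp only [stress, Fin.sum_univ_three]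
    ring
  rw [e]
  positivity

theorem isKernel_annular {ψ : ℝ → ℝ} (hψ : IsAnnularCutoff ψ) : IsKernel fun z => |ψ ‖z‖| := by
  have hc : HasCompactSupport ψ := HasCompactSupport.of_support_subset_isCompact isCompact_Icc
    hψ.support_subset
  obtain ⟨C, hC⟩ := hc.exists_bound_of_continuous hψ.smooth.continuous
  exact IsKernel.of_bounded (C := C) (hψ.smooth.continuous.comp continuous_norm).abs.measurable
    fun z => by rw [abs_abs]; exact hC _

theorem sum_sum_pairing_eq {K : Fin 3 → Fin 3 → Space → ℝ} {f : Space → ℝ}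
    {g : Fin 3 → Fin 3 → Space → ℝ}
    (hK : ∀ j k, IsKernel (K j k)) (hf : IsRapid f) (hg : ∀ j k, IsRapid (g j k)) :
    Integrable (fun r : Space × Space => f r.1 * ∑ j, ∑ k, K j k (r.2 - r.1) * g j k r.2) ∧
    ∑ j, ∑ k, pairing (K j k) f (g j k) =
      ∫ r : Space × Space, f r.1 * ∑ j, ∑ k, K j k (r.2 - r.1) * g j k r.2 := by
  have hi := fun j => integrable_sum_kernel (hK j) hf (hg j)
  have e : (fun r : Space × Space => f r.1 * ∑ j, ∑ k, K j k (r.2 - r.1) * g j k r.2) =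
      fun r => ∑ j, f r.1 * ∑ k, K j k (r.2 - r.1) * g j k r.2 := by
    funext r; rw [Finset.mul_sum]
  rw [e]
  refine ⟨integrable_finsetSum _ fun j _ => hi j, ?_⟩
  rw [integral_finsetSum _ fun j _ => hi j]
  exact Finset.sum_congr rfl fun j _ => sum_pairing_eq (hK j) hf (hg j)

/-- Domination by ψ is legitimate because the contracted stress is |∂_r u|² ≥ 0. The bilaplacian
part enters with coefficient 1 and is raised to 8, its majorant being nonnegative. -/
theorem error_le_annularError (hχ : IsRadialCutoff χ) {ψ : ℝ → ℝ} (hψ : IsAnnularCutoff ψ)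
    (h1 : ∀ r, 0 ≤ r → |bilaplaceProfile χ (r ^ 2)| ≤ |ψ r|)
    (h2 : ∀ r, 0 ≤ r → |radialProfile χ (r ^ 2)| ≤ |ψ r|)
    (hp : IsSchwartz p) (hq : IsSchwartz q) :
    8 * ∑ j, ∑ k, pairing (radialErrorKernel χ j k) (dens p q) (stress p q j k)
      + pairing (fun z => |bilaplaceProfile χ (‖z‖ ^ 2)|) (dens p q) (dens p q) ≤
    8 * annularError ψ p q := by
  have hd := (hp.dens hq).isRapid
  have hs := fun j k => (hp.stress hq j k).isRapid
  have kψ := isKernel_annular hψ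
  have kw : IsKernel fun z => |bilaplaceProfile χ (‖z‖ ^ 2)| := by
    refine ⟨(isKernel_bilaplaceProfile hχ).measurable.abs, ?_⟩
    simpa only [abs_abs] using (isKernel_bilaplaceProfile hχ).growth
  have a1 : pairing (fun z => |bilaplaceProfile χ (‖z‖ ^ 2)|) (dens p q) (dens p q) ≤
      pairing (fun z => |ψ ‖z‖|) (dens p q) (dens p q) :=
    integral_mono (integrable_kernel_pairing kw hd hd) (integrable_kernel_pairing kψ hd hd)
      fun r => mul_le_mul_of_nonneg_right (h1 _ (norm_nonneg _))
        (mul_nonneg (dens_nonneg _ _ _) (dens_nonneg _ _ _))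
  have a0 : 0 ≤ pairing (fun z => |ψ ‖z‖|) (dens p q) (dens p q) :=
    integral_nonneg fun r => mul_nonneg (abs_nonneg _)
      (mul_nonneg (dens_nonneg _ _ _) (dens_nonneg _ _ _))
  obtain ⟨i1, e1⟩ := sum_sum_pairing_eq (isKernel_radialErrorKernel hχ) hd hs
  obtain ⟨i2, e2⟩ := sum_sum_pairing_eq
    (fun j k => kψ.mul ((isKernel_radialCoord j).mul (isKernel_radialCoord k))) hd hs
  have a2 : ∑ j, ∑ k, pairing (radialErrorKernel χ j k) (dens p q) (stress p q j k) ≤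
      ∑ j, ∑ k, pairing (fun z => |ψ ‖z‖| * (radialCoord j z * radialCoord k z)) (dens p q)
        (stress p q j k) := by
    rw [e1, e2]
    refine integral_mono i1 i2 fun r => ?_
    refine mul_le_mul_of_nonneg_left ?_ (dens_nonneg _ _ _)
    have := mul_le_mul_of_nonneg_right (h2 ‖r.2 - r.1‖ (norm_nonneg _))
      (sum_radialCoord_stress_nonneg p q (r.2 - r.1) r.2)
    simp only [radialErrorKernel, mul_assoc] at this ⊢
    simpa only [Finset.mul_sum] using this
  rw [annularError]
  linarith

/-- The fixed-time inequality with all error terms estimated. -/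
theorem morawetz_le (hχ : IsRadialCutoff χ) {ψ : ℝ → ℝ} (hψ : IsAnnularCutoff ψ)
    (h1 : ∀ r, 0 ≤ r → |bilaplaceProfile χ (r ^ 2)| ≤ |ψ r|)
    (h2 : ∀ r, 0 ≤ r → |radialProfile χ (r ^ 2)| ≤ |ψ r|)
    (hp : IsSchwartz p) (hq : IsSchwartz q) (hP : IsSchwartz P) (hQ : IsSchwartz Q) :
    8 * Real.pi * (∫ x, dens p q x * dens p q x)
      + 2 * ∑ j, pairing (field χ j) (dens p q) (momB p q P Q j) ≤
    ∑ j, (pairing (field χ j) (densT p q P Q) (mom p q j)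
        + pairing (field χ j) (dens p q) (momT p q P Q j))
      + 4 * pairing (fun z => |χ ‖z‖|) (fun x => |massB p q P Q x|)
        (fun x => modulus p q x * gradModulus p q x)
      + 8 * annularError ψ p q := by
  have e1 := pairing_morawetz_le hχ hp hq hP hQ
  have e2 := error_le_annularError hχ hψ h1 h2 hp hq
  -- The mass bracket enters with factor 2 and the momentum bound gives another 2, whence the 4 in
  -- the statement.
  have e3 := (abs_le.1 (abs_sum_pairing_field_le hχ hp hq (hp.massB hq hP hQ).isRapid)).1
  rw [Finset.sum_add_distrib, ← Finset.mul_sum, ← Finset.mul_sum] at e1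
  linarith

end Bounds

/-! ### Translation between complex notation and real and imaginary parts. -/

section Conversion

variable {χ : ℝ → ℝ} {u n : Space → ℂ}

theorem norm_eq_modulus (u : Space → ℂ) (x : Space) : ‖u x‖ = modulus (rp u) (ip u) x := by
  rw [Complex.norm_def, Complex.normSq_apply]; rfl

theorem norm_sq_eq_dens (u : Space → ℂ) (x : Space) : ‖u x‖ ^ 2 = dens (rp u) (ip u) x := by
  rw [norm_eq_modulus, modulus, Real.sq_sqrt (dens_nonneg _ _ _)]

theorem partialDeriv_re (hu : ContDiff ℝ ∞ u) (j : Fin 3) (x : Space) :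
    (partialDeriv u j x).re = pd j (rp u) x :=
  (congrFun (pd_clm_comp hu Complex.reCLM j) x).symm

theorem partialDeriv_im (hu : ContDiff ℝ ∞ u) (j : Fin 3) (x : Space) :
    (partialDeriv u j x).im = pd j (ip u) x :=
  (congrFun (pd_clm_comp hu Complex.imCLM j) x).symm

theorem norm_grad_eq (hu : ContDiff ℝ ∞ u) (x : Space) :
    ‖grad u x‖ = gradModulus (rp u) (ip u) x := by
  rw [EuclideanSpace.norm_eq, gradModulus]
  congr 1
  refine Finset.sum_congr rfl fun j _ => ?_
  change ‖partialDeriv u j x‖ ^ 2 = _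
  rw [← Complex.normSq_eq_norm_sq, Complex.normSq_apply, partialDeriv_re hu, partialDeriv_im hu]
  rfl

theorem massBracket_eq (u n : Space → ℂ) (x : Space) :
    massBracket n u x = massB (rp u) (ip u) (rp n) (ip n) x := by
  simp only [massBracket, massB, rp, ip, Complex.mul_im, Complex.conj_re, Complex.conj_im,
    Complex.reCLM_apply, Complex.imCLM_apply]
  ring

theorem momentumBracket_eq (hu : ContDiff ℝ ∞ u) (hn : ContDiff ℝ ∞ n) (x : Space) (j : Fin 3) :
    momentumBracket n u x j = momB (rp u) (ip u) (rp n) (ip n) j x := by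
  change (n x * (starRingEnd ℂ) (partialDeriv u j x)
    - u x * (starRingEnd ℂ) (partialDeriv n j x)).re = _
  simp only [Complex.sub_re, Complex.mul_re, Complex.conj_re, Complex.conj_im, partialDeriv_re hu,
    partialDeriv_im hu, partialDeriv_re hn, partialDeriv_im hn, momB]
  simp only [rp, ip, Complex.reCLM_apply, Complex.imCLM_apply]
  ring

theorem radialDeriv_eq (u : Space → ℂ) (y x : Space) :
    radialDeriv u y x = ∑ j, (radialCoord j (x - y) : ℂ) * partialDeriv u j x := by
  have e : unitVec x y = ∑ j, radialCoord j (x - y) • EuclideanSpace.single j (1 : ℝ) := by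
    ext i
    simp [unitVec, radialCoord, Finset.sum_apply, Pi.single_apply]
  rw [radialDeriv, e, map_sum]
  refine Finset.sum_congr rfl fun j _ => ?_
  rw [map_smul, partialDeriv, Complex.real_smul]

theorem norm_sq_radialDeriv_eq (hu : ContDiff ℝ ∞ u) (y x : Space) :
    ‖radialDeriv u y x‖ ^ 2 = ∑ j, ∑ k, radialCoord j (x - y) * radialCoord k (x - y) *
      stress (rp u) (ip u) j k x := by
  rw [radialDeriv_eq, ← Complex.normSq_eq_norm_sq, Complex.normSq_apply]
  simp only [Complex.re_sum, Complex.im_sum, Complex.mul_re, Complex.mul_im, Complex.ofReal_re,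
    Complex.ofReal_im, zero_mul, sub_zero, add_zero, partialDeriv_re hu, partialDeriv_im hu]
  simp only [Fin.sum_univ_three, stress]
  ring

theorem integral_norm_pow_four (u : Space → ℂ) :
    ∫ y, ‖u y‖ ^ 4 = ∫ y, dens (rp u) (ip u) y * dens (rp u) (ip u) y := by
  congr 1; funext y
  rw [← norm_sq_eq_dens]; ring

theorem integral_momentum_eq (hχ : IsRadialCutoff χ) (hu : ContDiff ℝ ∞ u) (hn : ContDiff ℝ ∞ n)
    (hp : IsSchwartz (rp u)) (hq : IsSchwartz (ip u)) (hP : IsSchwartz (rp n))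
    (hQ : IsSchwartz (ip n)) :
    ∫ y : Space, ∫ x : Space, ‖u y‖ ^ 2 *
        inner ℝ (χ ‖x - y‖ • unitVec x y) (momentumBracket n u x) =
      ∑ j, pairing (field χ j) (dens (rp u) (ip u)) (momB (rp u) (ip u) (rp n) (ip n) j) := by
  have hd := (hp.dens hq).isRapid
  have hm := fun j => (hp.momB hq hP hQ j).isRapid
  rw [sum_pairing_eq (isKernel_field hχ) hd hm, Measure.volume_eq_prod,
    integral_prod _ (integrable_sum_kernel (isKernel_field hχ) hd hm)]
  congr 1; funext y; congr 1; funext x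
  rw [norm_sq_eq_dens, PiLp.inner_apply]
  congr 1
  refine Finset.sum_congr rfl fun j _ => ?_
  rw [momentumBracket_eq hu hn]
  simp only [field, radialCoord, unitVec, PiLp.smul_apply, smul_eq_mul, PiLp.sub_apply]
  simp
  ring

theorem integral_mass_eq (hχ : IsRadialCutoff χ) (hu : ContDiff ℝ ∞ u)
    (hp : IsSchwartz (rp u)) (hq : IsSchwartz (ip u)) (hP : IsSchwartz (rp n))
    (hQ : IsSchwartz (ip n)) :
    ∫ y : Space, ∫ x : Space, |massBracket n u y| * |χ ‖x - y‖| * ‖u x‖ * ‖grad u x‖ =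
      pairing (fun z => |χ ‖z‖|) (fun x => |massB (rp u) (ip u) (rp n) (ip n) x|)
        (fun x => modulus (rp u) (ip u) x * gradModulus (rp u) (ip u) x) := by
  rw [pairing, Measure.volume_eq_prod, integral_prod _ (integrable_kernel_pairing
    (isKernel_cutoff_norm hχ) (hp.massB hq hP hQ).isRapid.abs
    ((hp.modulus hq).mul (hp.gradModulus hq)))]
  congr 1; funext y; congr 1; funext x
  rw [massBracket_eq, norm_eq_modulus, norm_grad_eq hu]
  ring

theorem integral_annular_eq {ψ : ℝ → ℝ} (hψ : IsAnnularCutoff ψ) (hu : ContDiff ℝ ∞ u)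
    (hp : IsSchwartz (rp u)) (hq : IsSchwartz (ip u)) :
    ∫ y : Space, ∫ x : Space, ‖u y‖ ^ 2 * |ψ ‖x - y‖| *
        (‖u x‖ ^ 2 + ‖radialDeriv u y x‖ ^ 2) = annularError ψ (rp u) (ip u) := by
  have hd := (hp.dens hq).isRapid
  have kψ := isKernel_annular hψ
  have i1 := integrable_kernel_pairing kψ hd hd
  obtain ⟨i2, e2⟩ := sum_sum_pairing_eq
    (fun j k => kψ.mul ((isKernel_radialCoord j).mul (isKernel_radialCoord k))) hd
    (fun j k => (hp.stress hq j k).isRapid)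
  have i12 := i1.add i2
  simp only [Pi.add_def] at i12
  rw [annularError, e2, pairing, ← integral_add i1 i2, Measure.volume_eq_prod,
    integral_prod _ i12]
  congr 1; funext y; congr 1; funext x
  rw [norm_sq_eq_dens, norm_sq_eq_dens, norm_sq_radialDeriv_eq hu]
  simp only [mul_assoc, ← Finset.mul_sum]
  ring

end Conversion

/-! ### The inequality on a nondegenerate time interval. -/

section Slab

variable {a b : ℝ} {χ : ℝ → ℝ} {φ N : ℝ → Space → ℂ}

theorem integrable_integral_family {f : Set.Icc a b → Space → ℝ} (hf : RapidFamily f) :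
    Integrable (fun t => ∫ x, f t x) (timeMeasure a b) := by
  obtain ⟨C, hC0, hC⟩ := hf.bound 4
  have hi := (integrable_inv_one_add_norm_pow_four.const_mul C).comp_snd (timeMeasure a b)
  have : Integrable (fun r : Set.Icc a b × Space => f r.1 r.2) ((timeMeasure a b).prod volume) :=
    hi.mono' hf.continuous.measurable.aestronglyMeasurable
      (Filter.Eventually.of_forall fun r => hC r.1 r.2)
  exact this.integral_prod_left

theorem bddAbove_sqrt_integral {f : Set.Icc a b → Space → ℝ} (hf : RapidFamily f) :
    BddAbove (Set.range fun t => √(∫ x, f t x)) := by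
  obtain ⟨C, hC0, hC⟩ := hf.bound 4
  refine ⟨√(∫ x : Space, C * ((1 + ‖x‖) ^ 4)⁻¹), ?_⟩
  rintro _ ⟨t, rfl⟩
  exact Real.sqrt_le_sqrt (integral_mono (hf.isRapid t).integrable
    (integrable_inv_one_add_norm_pow_four.const_mul C)
    fun x => (le_abs_self _).trans (hC t x))

theorem normLinftyL2_nonneg (a b : ℝ) (φ : ℝ → Space → ℂ) : 0 ≤ normLinftyL2 a b φ :=
  Real.iSup_nonneg fun _ => Real.sqrt_nonneg _

theorem normLinftyHdot1_nonneg (a b : ℝ) (φ : ℝ → Space → ℂ) : 0 ≤ normLinftyHdot1 a b φ :=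
  Real.iSup_nonneg fun _ => Real.sqrt_nonneg _

theorem IsSchwartzOnSlab.re (hab : a < b) (h : IsSchwartzOnSlab a b φ) :
    SchwartzFamily fun t : Set.Icc a b => rp (φ t) :=
  h.schwartzFamily hab Complex.reCLM

theorem IsSchwartzOnSlab.im (hab : a < b) (h : IsSchwartzOnSlab a b φ) :
    SchwartzFamily fun t : Set.Icc a b => ip (φ t) :=
  h.schwartzFamily hab Complex.imCLM

/-- The uniform decay of the families makes both suprema finite; without boundedness a real supremum
would default to 0 and majorize nothing. -/
theorem IsSchwartzOnSlab.abs_action_le (hχ : IsRadialCutoff χ) (hab : a < b)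
    (h : IsSchwartzOnSlab a b φ) {t : ℝ} (ht : t ∈ Set.Icc a b) :
    |∑ j, pairing (field χ j) (dens (rp (φ t)) (ip (φ t))) (mom (rp (φ t)) (ip (φ t)) j)| ≤
      2 * (⨆ r : Set.Ici (0 : ℝ), χ r) * normLinftyL2 a b φ ^ 3 * normLinftyHdot1 a b φ := by
  have hp := h.re hab
  have hq := h.im hab
  have hX0 : 0 ≤ ⨆ r : Set.Ici (0 : ℝ), χ r := (hχ.nonneg 0 le_rfl).trans (hχ.le_iSup le_rfl)
  have e1 : ∀ s : Set.Icc a b, √(∫ x, ‖φ s x‖ ^ 2) =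
      √(∫ x, modulus (rp (φ s)) (ip (φ s)) x ^ 2) := fun s => by
    simp only [norm_eq_modulus]
  have e2 : ∀ s : Set.Icc a b, √(∫ x, ‖grad (φ s) x‖ ^ 2) =
      √(∫ x, gradModulus (rp (φ s)) (ip (φ s)) x ^ 2) := fun s => by
    simp only [norm_grad_eq (h.contDiff s.2)]
  have b1 : BddAbove (Set.range fun s : Set.Icc a b => √(∫ x, ‖φ s x‖ ^ 2)) := by
    simp only [e1]
    simp only [sq]
    exact bddAbove_sqrt_integral ((hp.modulus hq).mul (hp.modulus hq))
  have b2 : BddAbove (Set.range fun s : Set.Icc a b => √(∫ x, ‖grad (φ s) x‖ ^ 2)) := by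
    simp only [e2]
    simp only [sq]
    exact bddAbove_sqrt_integral ((hp.gradModulus hq).mul (hp.gradModulus hq))
  have l1 : √(∫ x, modulus (rp (φ t)) (ip (φ t)) x ^ 2) ≤ normLinftyL2 a b φ := by
    rw [← e1 ⟨t, ht⟩]; exact le_ciSup b1 ⟨t, ht⟩
  have l2 : √(∫ x, gradModulus (rp (φ t)) (ip (φ t)) x ^ 2) ≤ normLinftyHdot1 a b φ := by
    rw [← e2 ⟨t, ht⟩]; exact le_ciSup b2 ⟨t, ht⟩
  refine (InteractionMorawetz.abs_action_le hχ (hp.isSchwartz ⟨t, ht⟩)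
    (hq.isSchwartz ⟨t, ht⟩)).trans ?_
  have := normLinftyL2_nonneg a b φ
  dsimp only
  gcongr

theorem IsSchwartzSolution.integral_deriv_action (hχ : IsRadialCutoff χ) (hab : a < b)
    (h : IsSchwartzSolution a b φ N) :
    ∫ t : Set.Icc a b, ∑ j,
      (pairing (field χ j) (densT (rp (φ t)) (ip (φ t)) (rp (N t)) (ip (N t)))
          (mom (rp (φ t)) (ip (φ t)) j)
        + pairing (field χ j) (dens (rp (φ t)) (ip (φ t)))
          (momT (rp (φ t)) (ip (φ t)) (rp (N t)) (ip (N t)) j)) ∂(timeMeasure a b) =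
      ∑ j, pairing (field χ j) (dens (rp (φ b)) (ip (φ b))) (mom (rp (φ b)) (ip (φ b)) j) -
      ∑ j, pairing (field χ j) (dens (rp (φ a)) (ip (φ a))) (mom (rp (φ a)) (ip (φ a)) j) := by
  have hp := h.schwartz.re hab
  have hq := h.schwartz.im hab
  have hP := h.schwartz_forcing.re hab
  have hQ := h.schwartz_forcing.im hab
  have i := fun j => (integrable_pairing_family (isKernel_field hχ j)
    (hp.densT hq hP hQ).rapid (hp.mom hq j).rapid).add (integrable_pairing_family
    (isKernel_field hχ j) (hp.dens hq).rapid (hp.momT hq hP hQ j).rapid)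
  simp only [Pi.add_def] at i
  rw [integral_finsetSum _ fun j _ => i j, ← Finset.sum_sub_distrib]
  refine Finset.sum_congr rfl fun j _ => ?_
  exact integral_deriv_pairing hab
    (F := fun t => dens (rp (φ t)) (ip (φ t))) (G := fun t => mom (rp (φ t)) (ip (φ t)) j)
    (F' := fun t => densT (rp (φ t)) (ip (φ t)) (rp (N t)) (ip (N t)))
    (G' := fun t => momT (rp (φ t)) (ip (φ t)) (rp (N t)) (ip (N t)) j)
    (isKernel_field hχ j) (hp.dens hq).rapid (hp.mom hq j).rapid
    (hp.densT hq hP hQ).rapid (hp.momT hq hP hQ j).rapid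
    (fun t ht x => h.hasDerivAt_dens ht x) (fun t ht x => h.hasDerivAt_mom ht j x)

theorem IsSchwartzSolution.morawetz_le (hχ : IsRadialCutoff χ) {ψ : ℝ → ℝ}
    (hψ : IsAnnularCutoff ψ)
    (h1 : ∀ r, 0 ≤ r → |bilaplaceProfile χ (r ^ 2)| ≤ |ψ r|)
    (h2 : ∀ r, 0 ≤ r → |radialProfile χ (r ^ 2)| ≤ |ψ r|) (hab : a < b)
    (h : IsSchwartzSolution a b φ N) :
    8 * Real.pi * (∫ t in Set.Icc a b, ∫ y : Space, ‖φ t y‖ ^ 4)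
        + 2 * (∫ t in Set.Icc a b, ∫ y : Space, ∫ x : Space,
            ‖φ t y‖ ^ 2 *
              inner ℝ (χ ‖x - y‖ • unitVec x y) (momentumBracket (N t) (φ t) x))
      ≤ 4 * (⨆ r : Set.Ici (0 : ℝ), χ r) *
            normLinftyL2 a b φ ^ 3 * normLinftyHdot1 a b φ
        + 4 * (∫ t in Set.Icc a b, ∫ y : Space, ∫ x : Space,
            |massBracket (N t) (φ t) y| * |χ ‖x - y‖| * ‖φ t x‖ * ‖grad (φ t) x‖)
        + 8 * (∫ t in Set.Icc a b, ∫ y : Space, ∫ x : Space,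
            ‖φ t y‖ ^ 2 * |ψ ‖x - y‖| *
              (‖φ t x‖ ^ 2 + ‖radialDeriv (φ t) y x‖ ^ 2)) := by
  have hp := h.schwartz.re hab
  have hq := h.schwartz.im hab
  have hP := h.schwartz_forcing.re hab
  have hQ := h.schwartz_forcing.im hab
  have cφ := fun t : Set.Icc a b => h.schwartz.contDiff t.2
  have cN := fun t : Set.Icc a b => h.schwartz_forcing.contDiff t.2
  -- On the subtype every time carries its membership in [a, b], so the fixed-time identities can be
  -- rewritten under the integral.
  simp only [← integral_timeMeasure]
  simp only [integral_norm_pow_four, fun t : Set.Icc a b => integral_momentum_eq hχ (cφ t) (cN t)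
      (hp.isSchwartz t) (hq.isSchwartz t) (hP.isSchwartz t) (hQ.isSchwartz t),
    fun t : Set.Icc a b => integral_mass_eq hχ (cφ t)
      (hp.isSchwartz t) (hq.isSchwartz t) (hP.isSchwartz t) (hQ.isSchwartz t),
    fun t : Set.Icc a b => integral_annular_eq hψ (cφ t) (hp.isSchwartz t) (hq.isSchwartz t)]
  have i1 := (integrable_integral_family ((hp.dens hq).mul (hp.dens hq)).rapid).const_mul
    (8 * Real.pi)
  have i2 := (integrable_finsetSum Finset.univ fun j _ => integrable_pairing_family
    (isKernel_field hχ j) (hp.dens hq).rapid (hp.momB hq hP hQ j).rapid).const_mul 2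
  have i3 := integrable_finsetSum Finset.univ fun j _ => (integrable_pairing_family
    (isKernel_field hχ j) (hp.densT hq hP hQ).rapid (hp.mom hq j).rapid).add
    (integrable_pairing_family (isKernel_field hχ j) (hp.dens hq).rapid
      (hp.momT hq hP hQ j).rapid)
  simp only [Pi.add_def] at i3
  have i4 := (integrable_pairing_family (isKernel_cutoff_norm hχ) (hp.massB hq hP hQ).rapid.abs
    ((hp.modulus hq).mul (hp.gradModulus hq))).const_mul 4
  have kψ := isKernel_annular hψ
  have i5 := ((integrable_pairing_family kψ (hp.dens hq).rapid (hp.dens hq).rapid).add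
    (integrable_finsetSum Finset.univ fun j _ => integrable_finsetSum Finset.univ fun k _ =>
      integrable_pairing_family (kψ.mul ((isKernel_radialCoord j).mul (isKernel_radialCoord k)))
        (hp.dens hq).rapid (hp.stress hq j k).rapid)).const_mul 8
  have key := integral_mono (i1.add i2) ((i3.add i4).add i5) fun t =>
    InteractionMorawetz.morawetz_le hχ hψ h1 h2 (hp.isSchwartz t) (hq.isSchwartz t)
      (hP.isSchwartz t) (hQ.isSchwartz t)
  rw [integral_add' i1 i2, integral_add' (i3.add i4) i5, integral_add' i3 i4, integral_const_mul,
    integral_const_mul, integral_const_mul, integral_const_mul,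
    h.integral_deriv_action hχ hab] at key
  -- Each end point costs 2 sup χ times the norms; together they give the constant 4.
  have ab := (abs_le.1 (h.schwartz.abs_action_le hχ hab (Set.right_mem_Icc.2 hab.le))).2
  have aa := (abs_le.1 (h.schwartz.abs_action_le hχ hab (Set.left_mem_Icc.2 hab.le))).1
  simp only [Pi.add_apply] at key
  simp only [annularError]
  linarith

end Slab

end InteractionMorawetz

/-! ### Choice of ψ and of the constant. -/

open InteractionMorawetz in
theorem proposition10 (χ : ℝ → ℝ) (hχ : IsRadialCutoff χ) :
    ∃ ψ : ℝ → ℝ, IsAnnularCutoff ψ ∧ ∃ C : ℝ, 0 < C ∧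
      ∀ (a b : ℝ), a ≤ b → ∀ φ N : ℝ → Space → ℂ, IsSchwartzSolution a b φ N →
        8 * Real.pi * (∫ t in Set.Icc a b, ∫ y : Space, ‖φ t y‖ ^ 4)
          + 2 * (∫ t in Set.Icc a b, ∫ y : Space, ∫ x : Space,
              ‖φ t y‖ ^ 2 *
                inner ℝ (χ ‖x - y‖ • unitVec x y) (momentumBracket (N t) (φ t) x))
        ≤ 4 * (⨆ r : Set.Ici (0 : ℝ), χ r) *
              normLinftyL2 a b φ ^ 3 * normLinftyHdot1 a b φ
          + 4 * (∫ t in Set.Icc a b, ∫ y : Space, ∫ x : Space,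
              |massBracket (N t) (φ t) y| * |χ ‖x - y‖| * ‖φ t x‖ * ‖grad (φ t) x‖)
          + C * (∫ t in Set.Icc a b, ∫ y : Space, ∫ x : Space,
              ‖φ t y‖ ^ 2 * |ψ ‖x - y‖| *
                (‖φ t x‖ ^ 2 + ‖radialDeriv (φ t) y x‖ ^ 2)) := by
  obtain ⟨ψ₁, hψ₁, n₁, b₁⟩ := exists_annularCutoff (contDiff_bilaplaceProfile hχ)
    (bilaplaceProfile_of_le_one hχ) (bilaplaceProfile_of_four_le hχ)
  obtain ⟨ψ₂, hψ₂, n₂, b₂⟩ := exists_annularCutoff (contDiff_radialProfile hχ)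
    (radialProfile_of_le_one hχ) (radialProfile_of_four_le hχ)
  -- Both majorants are nonnegative, so their sum dominates each of the two profiles.
  have hψ : IsAnnularCutoff fun r => ψ₁ r + ψ₂ r :=
    ⟨hψ₁.smooth.add hψ₂.smooth, (Function.support_add ψ₁ ψ₂).trans
      (Set.union_subset hψ₁.support_subset hψ₂.support_subset)⟩
  refine ⟨fun r => ψ₁ r + ψ₂ r, hψ, 8, by norm_num, fun a b hab φ N h => ?_⟩
  -- For a = b the slab lacks unique differentiability, but all time integrals vanish and the
  -- remaining term on the right is nonnegative.
  rcases hab.eq_or_lt with rfl | hab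
  · have hX0 : 0 ≤ ⨆ r : Set.Ici (0 : ℝ), χ r := (hχ.nonneg 0 le_rfl).trans (hχ.le_iSup le_rfl)
    have := normLinftyL2_nonneg a a φ
    have := normLinftyHdot1_nonneg a a φ
    simp only [Set.Icc_self, Measure.restrict_singleton, Real.volume_singleton, zero_smul,
      integral_zero_measure, mul_zero, add_zero]
    positivity
  · exact h.morawetz_le hχ hψ
      (fun r hr => (b₁ r hr).trans ((le_add_of_nonneg_right (n₂ r)).trans (le_abs_self _)))
      (fun r hr => (b₂ r hr).trans ((le_add_of_nonneg_left (n₁ r)).trans (le_abs_self _))) hab
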